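/- Let $n$ and $M$ be natural numbers, $T>0$, $A,Q\in\mathbb R^{n\times n}$ with $Q\succeq 0$, and for $j=1,\dots,M$ let $H_j\in\mathbb R^{p_j\times n}$ and $R_j\in\mathbb R^{p_j\times p_j}$ with $R_j\succ0$. Put $$S_j=H_j^\top R_j^{-1}H_j,\qquad g_j(P)=PH_j^\top(H_jPH_j^\top+R_j)^{-1}H_jP .$$ Let $\lambda=(\lambda_1,\dots,\lambda_M)$ be a deterministic schedule: each $\lambda_j:[0,T]\to[0,\infty)$ is measurable and essentially bounded. On a filtered probability space, let $N_1,\dots,N_M$ be independent Poisson counting processes with intensities $\lambda_j(t)$ relative to the filtration $(\mathcal F_t)$ (the increments of $(N_1,\dots,N_M)$ after time $s$ are independent of $\mathcal F_s$), and let $P(t)$, $t\in[0,T]$, be the covariance process of the continuous-discrete Kalman filter (CD-KF), that is, an adapted càdlàg process of positive definite matrices with a possibly random, $\mathcal F_0$-measurable initial value $P(0)$ and $$dP(t)=\big(AP(t)+P(t)A^\top+Q\big)\,dt-\sum_{j=1}^M g_j(P(t^-))\,dN_j(t).$$ Let $Y(t)=P(t)^{-1}$ be the information process, and assume that for every $t\in[0,T]$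 $$\mathbb E\big[\|Y(t)\|_F^2+\|P(t)\|_F\,\big|\,Y(0)\big]<\infty\quad\text{almost surely.}$$ Let $\hat Y$ and $\hat P$ be pathwise solutions on $[0,T]$ (absolutely continuous, with the equation holding for almost every $t$) of the information-form and covariance-form surrogate Riccati equations $$\dot{\hat Y}=-\hat YA-A^\top\hat Y-\hat YQ\hat Y+\sum_{j=1}^M\lambda_j(t)S_j,\qquad \dot{\hat P}=A\hat P+\hat PA^\top+Q-\sum_{j=1}^M\lambda_j(t)\,g_j(\hat P),$$ with $\hat Y(0)=Y(0)=P(0)^{-1}$ and $\hat P(0)=P(0)$ almost surely. Then for every $t\in[0,T]$, almost surely, in the Loewner order, $$\hat Y(t)\succeq\mathbb E[Y(t)\mid Y(0)]\qquad\text{and}\qquad \hat P(t)\succeq\mathbb E[P(t)\mid P(0)].$$ Here the conditional expectations are taken entrywise as $\mathbb E[X\mid\cdot]=\mathbb E[X^+\mid\cdot]-\mathbb E[X^-\mid\cdot]$, so that $P(0)$ and $Y(0)$ need not be integrable. -/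

import Mathlib

open MeasureTheory ProbabilityTheory
open scoped NNReal ENNReal Matrix

noncomputable section

namespace CDKF

/-- A continuous-time linear-Gaussian model with `n` states and `M` sensors: drift matrix `A`,
process-noise covariance `Q ⪰ 0`, and for the sensor `j` an output matrix `H j` and a
measurement-noise covariance `R j ≻ 0`. -/
structure Model (n M : ℕ) where
  A : Matrix (Fin n) (Fin n) ℝ
  Q : Matrix (Fin n) (Fin n) ℝ
  p : Fin M → ℕ
  H : (j : Fin M) → Matrix (Fin (p j)) (Fin n) ℝ
  R : (j : Fin M) → Matrix (Fin (p j)) (Fin (p j)) ℝ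
  Q_posSemidef : Q.PosSemidef
  R_posDef : ∀ j, (R j).PosDef

namespace Model

variable {n M : ℕ}

/-- The information gain `S_j = H_jᵀ R_j⁻¹ H_j` of one measurement by the sensor `j`. -/
def S (m : Model n M) (j : Fin M) : Matrix (Fin n) (Fin n) ℝ :=
  (m.H j)ᵀ * (m.R j)⁻¹ * m.H j

/-- The covariance reduction `g_j(P) = P H_jᵀ (H_j P H_jᵀ + R_j)⁻¹ H_j P` of one measurement
by the sensor `j`. -/
def g (m : Model n M) (j : Fin M) (P : Matrix (Fin n) (Fin n) ℝ) : Matrix (Fin n) (Fin n) ℝ :=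
  P * (m.H j)ᵀ * (m.H j * P * (m.H j)ᵀ + m.R j)⁻¹ * m.H j * P

/-- The right-hand side of the information-form surrogate Riccati equation. -/
def infoField (m : Model n M) (lam : Fin M → ℝ → ℝ) (t : ℝ) (Y : Matrix (Fin n) (Fin n) ℝ) :
    Matrix (Fin n) (Fin n) ℝ :=
  -(Y * m.A) - m.Aᵀ * Y - Y * m.Q * Y + ∑ j, lam j t • m.S j

/-- The right-hand side of the covariance-form surrogate Riccati equation. -/
def covField (m : Model n M) (lam : Fin M → ℝ → ℝ) (t : ℝ) (P : Matrix (Fin n) (Fin n) ℝ) :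
    Matrix (Fin n) (Fin n) ℝ :=
  m.A * P + P * m.Aᵀ + m.Q - ∑ j, lam j t • m.g j P

end Model

/-- A deterministic schedule of sensing rates on `[0,T]`: measurable, nonnegative and
essentially bounded in each component. -/
structure IsSchedule {M : ℕ} (T : ℝ) (lam : Fin M → ℝ → ℝ) : Prop where
  aemeasurable : ∀ j, AEMeasurable (lam j) (volume.restrict (Set.Icc 0 T))
  nonneg : ∀ j, ∀ᵐ t ∂(volume.restrict (Set.Icc 0 T)), 0 ≤ lam j t
  bounded : ∃ B : ℝ, ∀ j, ∀ᵐ t ∂(volume.restrict (Set.Icc 0 T)), lam j t ≤ B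

/-- The entrywise integral of a matrix-valued function over `[0,t]`. -/
def matIntegral {n : ℕ} (F : ℝ → Matrix (Fin n) (Fin n) ℝ) (t : ℝ) :
    Matrix (Fin n) (Fin n) ℝ :=
  Matrix.of fun i k => ∫ s in (0 : ℝ)..t, F s i k

/-- `X` solves `Ẋ = F(t, X)` on `[0,T]` in the sense of Carathéodory: it is continuous, and it is
the integral of an integrable right-hand side. -/
structure IsSolution {n : ℕ} (T : ℝ)
    (F : ℝ → Matrix (Fin n) (Fin n) ℝ → Matrix (Fin n) (Fin n) ℝ)
    (X : ℝ → Matrix (Fin n) (Fin n) ℝ) : Prop where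
  continuousOn : ContinuousOn X (Set.Icc 0 T)
  integrable : ∀ i k, IntegrableOn (fun s => F s (X s) i k) (Set.Icc 0 T)
  eq_integral : ∀ t ∈ Set.Icc 0 T, X t = X 0 + matIntegral (fun s => F s (X s)) t

/-- `N 0, …, N (M-1)` are independent Poisson counting processes on `[0,T]` with intensities
`lam j`, relative to the filtration `ℱ`: they start at zero, are nondecreasing and
right-continuous with unit jumps, and over each interval `(s,t]` the increments have Poisson laws
with means `∫ lam j` and are independent of each other and of `ℱ s`. -/
structure IsPoissonFamily {Ω : Type*} {mΩ : MeasurableSpace Ω} {M : ℕ} (T : ℝ)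
    (lam : Fin M → ℝ → ℝ) (ℱ : Filtration ℝ mΩ) (μ : Measure Ω)
    (N : Fin M → ℝ → Ω → ℕ) : Prop where
  adapted : ∀ j, ∀ t ∈ Set.Icc 0 T, Measurable[ℱ t] (N j t)
  paths : ∀ᵐ ω ∂μ, ∀ j, N j 0 ω = 0 ∧
    MonotoneOn (fun t => N j t ω) (Set.Icc 0 T) ∧
    (∀ t ∈ Set.Ico 0 T, ContinuousWithinAt (fun s => N j s ω) (Set.Ici t) t) ∧
    (∀ t ∈ Set.Ioc 0 T, N j t ω ≤ Function.leftLim (fun s => N j s ω) t + 1)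
  law : ∀ j, ∀ s ∈ Set.Icc 0 T, ∀ t ∈ Set.Icc 0 T, s ≤ t →
    μ.map (fun ω => N j t ω - N j s ω) = poissonMeasure (∫ u in s..t, lam j u).toNNReal
  indep : ∀ s ∈ Set.Icc 0 T, ∀ t ∈ Set.Icc 0 T, s ≤ t →
    iIndepFun (fun j ω => N j t ω - N j s ω) μ
  indep_past : ∀ s ∈ Set.Icc 0 T, ∀ t ∈ Set.Icc 0 T, s ≤ t →
    Indep (⨆ j, MeasurableSpace.comap (fun ω => N j t ω - N j s ω) ⊤) (ℱ s) μ

/-- The pathwise integral `∫_{(0,t]} F(s) dN(s)` against a counting path `N`, that is, the sum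
of `ΔN(s) F(s)` over the jump times `s ∈ (0,t]` of `N`. -/
def jumpIntegral {n : ℕ} (N : ℝ → ℕ) (F : ℝ → Matrix (Fin n) (Fin n) ℝ) (t : ℝ) :
    Matrix (Fin n) (Fin n) ℝ :=
  ∑ᶠ s ∈ Set.Ioc 0 t, ((N s : ℝ) - ((Function.leftLim N s : ℕ) : ℝ)) • F s

/-- `P` is the error-covariance process of the continuous-discrete Kalman filter with measurement
counts `N`: an adapted càdlàg process of positive definite matrices with
`dP = (A P + P Aᵀ + Q) dt - ∑ j, g_j(P(t-)) dN_j`. The initial value is `ℱ 0`-measurable. -/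
structure IsCovProcess {Ω : Type*} {mΩ : MeasurableSpace Ω} {n M : ℕ} (m : Model n M) (T : ℝ)
    (ℱ : Filtration ℝ mΩ) (μ : Measure Ω) (N : Fin M → ℝ → Ω → ℕ)
    (P : ℝ → Ω → Matrix (Fin n) (Fin n) ℝ) : Prop where
  adapted : ∀ t ∈ Set.Icc 0 T, ∀ i k, Measurable[ℱ t] (fun ω => P t ω i k)
  posDef : ∀ᵐ ω ∂μ, ∀ t ∈ Set.Icc 0 T, (P t ω).PosDef
  cadlag : ∀ᵐ ω ∂μ,
    (∀ t ∈ Set.Ico 0 T, ContinuousWithinAt (fun s => P s ω) (Set.Ici t) t) ∧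
    (∀ t ∈ Set.Ioc 0 T, ∃ L, Filter.Tendsto (fun s => P s ω) (nhdsWithin t (Set.Iio t)) (nhds L))
  sde : ∀ᵐ ω ∂μ, ∀ t ∈ Set.Icc 0 T,
    P t ω = P 0 ω + matIntegral (fun s => m.A * P s ω + P s ω * m.Aᵀ + m.Q) t
      - ∑ j, jumpIntegral (fun s => N j s ω)
          (fun s => m.g j (Function.leftLim (fun r => P r ω) s)) t

/-- The information process `Y(t) = P(t)⁻¹`. -/
def info {Ω : Type*} {n : ℕ} (P : ℝ → Ω → Matrix (Fin n) (Fin n) ℝ) (t : ℝ) (ω : Ω) :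
    Matrix (Fin n) (Fin n) ℝ :=
  (P t ω)⁻¹

/-- The σ-algebra generated by a random matrix. -/
@[reducible] def sigmaOf {Ω : Type*} {n : ℕ} (Z : Ω → Matrix (Fin n) (Fin n) ℝ) : MeasurableSpace Ω :=
  ⨆ i, ⨆ k, MeasurableSpace.comap (fun ω => Z ω i k) (borel ℝ)

/-- The conditional expectation `E[X | Z]` of a random matrix, entry by entry as
`E[X⁺ | Z] - E[X⁻ | Z]`. This makes sense as soon as `E[|X| | Z] < ∞` almost surely,
also when `X` itself is not integrable. -/
def condMean {Ω : Type*} {mΩ : MeasurableSpace Ω} {n : ℕ} (μ : Measure Ω)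
    (X Z : Ω → Matrix (Fin n) (Fin n) ℝ) (ω : Ω) : Matrix (Fin n) (Fin n) ℝ :=
  Matrix.of fun i k =>
    (condLExp (sigmaOf Z) μ (fun ω' => ENNReal.ofReal (X ω' i k)) ω).toReal
      - (condLExp (sigmaOf Z) μ (fun ω' => ENNReal.ofReal (-(X ω' i k))) ω).toReal

/-- The Frobenius norm. -/
def frobNorm {n : ℕ} (X : Matrix (Fin n) (Fin n) ℝ) : ℝ :=
  Real.sqrt (∑ i, ∑ k, X i k ^ 2)

/-- The moment condition `E[‖Y(t)‖_F² + ‖P(t)‖_F | Y(0)] < ∞` almost surely, for every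
`t ∈ [0,T]`. -/
def FiniteMoments {Ω : Type*} {mΩ : MeasurableSpace Ω} {n : ℕ} (T : ℝ) (μ : Measure Ω)
    (P : ℝ → Ω → Matrix (Fin n) (Fin n) ℝ) : Prop :=
  ∀ t ∈ Set.Icc 0 T, ∀ᵐ ω ∂μ,
    condLExp (sigmaOf (info P 0)) μ
      (fun ω' => ENNReal.ofReal (frobNorm (info P t ω') ^ 2 + frobNorm (P t ω'))) ω < ∞

end CDKF

end

/-! Given the initial value, each mean satisfies a differential inequality that its surrogate
satisfies with equality, because the dynamics is concave. In information form a measurement adds the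
constant matrix `S j` (Woodbury, `inv_sub_corr`), and the drift -YA - AᵀY - YQY lies below its
tangent at any symmetric Z, the gap being (Y-Z)Q(Y-Z). In covariance form `g j` is a supremum of
maps affine in P, one for each gain K (`corr_sub_gainForm`), attained at the Kalman gain
(`gainForm_optimal`). Affine maps commute with means, and Poisson increments are independent of the
past, so the mean is a subsolution of every linearized equation. Linearize at the surrogate itself:
the difference D = surrogate - mean is then driven from below by Lyapunov terms LD + DLᵀ and, in
covariance form, by the positive maps D ↦ (KH)D(KH)ᵀ. Such a flow preserves D ⪰ 0; this is
`comparison`.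

The rates are merely bounded and measurable, so derivatives of the means are avoided. Everything is
an inequality over a short interval (s,t] with error O((t-s)²). Pathwise
(`exists_covPath_expansion`, `exists_infoPath_expansion`) the errors are (t-s)², (t-s)ΔN and
ΔN(ΔN-1), up to random factors with finite mean; for Poisson counts each has mean O((t-s)²). This
gives `exists_mean_step` and `exists_mean_info_step`.

The initial value need not be integrable. It is therefore confined to a small cell G in the
σ-algebra that it generates. Conditioning on G leaves the increments of the counts untouched
(`IsPoissonFamily.cond`), makes the initial value bounded, and puts it within ε of its value at a
chosen outcome ω₀. The comparison of the surrogate path at ω₀ with the mean over G loses only ε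
times a constant depending on ω₀ and the time. Cells that also fix the conditional mean up to ε turn
this into the almost sure bound (`ae_posSemidef_sub_condMean`). -/

noncomputable section

namespace CDKF

/-! ### The entrywise `ℓ¹` norm and quadratic forms -/

/-- The entrywise `ℓ¹` norm of a matrix. -/
def l1 {a b : ℕ} (X : Matrix (Fin a) (Fin b) ℝ) : ℝ := ∑ i, ∑ k, |X i k|

/-- The quadratic form of a square matrix. -/
def qf {n : ℕ} (X : Matrix (Fin n) (Fin n) ℝ) (x : Fin n → ℝ) : ℝ := x ⬝ᵥ (X *ᵥ x)

variable {a b c n p : ℕ}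

lemma l1_nonneg (X : Matrix (Fin a) (Fin b) ℝ) : 0 ≤ l1 X :=
  Finset.sum_nonneg fun _ _ => Finset.sum_nonneg fun _ _ => abs_nonneg _

lemma abs_entry_le_l1 (X : Matrix (Fin a) (Fin b) ℝ) (i : Fin a) (k : Fin b) : |X i k| ≤ l1 X :=
  (Finset.single_le_sum (f := fun k => |X i k|) (fun _ _ => abs_nonneg _) (Finset.mem_univ k)).trans
    (Finset.single_le_sum (f := fun i => ∑ k, |X i k|)
      (fun _ _ => Finset.sum_nonneg fun _ _ => abs_nonneg _) (Finset.mem_univ i))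

lemma l1_zero : l1 (0 : Matrix (Fin a) (Fin b) ℝ) = 0 := by simp [l1]

lemma l1_add_le (X Y : Matrix (Fin a) (Fin b) ℝ) : l1 (X + Y) ≤ l1 X + l1 Y := by
  simp only [l1, ← Finset.sum_add_distrib]
  exact Finset.sum_le_sum fun i _ => Finset.sum_le_sum fun k _ => abs_add_le _ _

lemma l1_neg (X : Matrix (Fin a) (Fin b) ℝ) : l1 (-X) = l1 X := by simp [l1]

lemma l1_sub_le (X Y : Matrix (Fin a) (Fin b) ℝ) : l1 (X - Y) ≤ l1 X + l1 Y := by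
  rw [sub_eq_add_neg, ← l1_neg Y]; exact l1_add_le _ _

lemma l1_sub_comm (X Y : Matrix (Fin a) (Fin b) ℝ) : l1 (X - Y) = l1 (Y - X) := by
  rw [← l1_neg, neg_sub]

lemma l1_smul (r : ℝ) (X : Matrix (Fin a) (Fin b) ℝ) : l1 (r • X) = |r| * l1 X := by
  simp [l1, abs_mul, Finset.mul_sum]

lemma l1_transpose (X : Matrix (Fin a) (Fin b) ℝ) : l1 Xᵀ = l1 X := by
  simp only [l1, Matrix.transpose_apply]; exact Finset.sum_comm

lemma l1_sum_le {ι : Type*} (s : Finset ι) (F : ι → Matrix (Fin a) (Fin b) ℝ) :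
    l1 (∑ i ∈ s, F i) ≤ ∑ i ∈ s, l1 (F i) := by
  classical
  induction s using Finset.induction_on with
  | empty => simp [l1_zero]
  | insert i s hi ih =>
    rw [Finset.sum_insert hi, Finset.sum_insert hi]
    exact (l1_add_le _ _).trans (by gcongr)

lemma l1_mul_le (X : Matrix (Fin a) (Fin b) ℝ) (Y : Matrix (Fin b) (Fin c) ℝ) :
    l1 (X * Y) ≤ l1 X * l1 Y := by
  have h : ∀ i k, |(X * Y) i k| ≤ ∑ j, |X i j| * |Y j k| := fun i k => by
    rw [Matrix.mul_apply]
    exact (Finset.abs_sum_le_sum_abs _ _).trans (le_of_eq (by simp [abs_mul]))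
  calc l1 (X * Y) ≤ ∑ i, ∑ k, ∑ j, |X i j| * |Y j k| :=
        Finset.sum_le_sum fun i _ => Finset.sum_le_sum fun k _ => h i k
    _ = ∑ i, ∑ j, |X i j| * ∑ k, |Y j k| := by
        refine Finset.sum_congr rfl fun i _ => ?_
        rw [Finset.sum_comm]; simp [Finset.mul_sum]
    _ ≤ ∑ i, ∑ j, |X i j| * l1 Y := by
        refine Finset.sum_le_sum fun i _ => Finset.sum_le_sum fun j _ => ?_
        exact mul_le_mul_of_nonneg_left
          (Finset.single_le_sum (f := fun j => ∑ k, |Y j k|)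
            (fun _ _ => Finset.sum_nonneg fun _ _ => abs_nonneg _) (Finset.mem_univ j)) (abs_nonneg _)
    _ = l1 X * l1 Y := by simp [l1, Finset.sum_mul]

lemma eq_zero_of_l1_le_zero {X : Matrix (Fin a) (Fin b) ℝ} (h : l1 X ≤ 0) : X = 0 := by
  ext i k
  exact abs_nonpos_iff.1 ((abs_entry_le_l1 X i k).trans h)

lemma continuous_l1 : Continuous (l1 : Matrix (Fin a) (Fin b) ℝ → ℝ) := by
  unfold l1
  exact continuous_finsetSum _ fun i _ => continuous_finsetSum _ fun k _ =>
    (continuous_id.matrix_elem i k).abs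

lemma continuous_qf (x : Fin n → ℝ) : Continuous fun X : Matrix (Fin n) (Fin n) ℝ => qf X x := by
  unfold qf
  exact continuous_const.dotProduct (continuous_id.matrix_mulVec continuous_const)

lemma qf_add (X Y : Matrix (Fin n) (Fin n) ℝ) (x : Fin n → ℝ) : qf (X + Y) x = qf X x + qf Y x := by
  simp [qf, Matrix.add_mulVec]

lemma qf_sub (X Y : Matrix (Fin n) (Fin n) ℝ) (x : Fin n → ℝ) : qf (X - Y) x = qf X x - qf Y x := by
  simp [qf, Matrix.sub_mulVec]

lemma qf_neg (X : Matrix (Fin n) (Fin n) ℝ) (x : Fin n → ℝ) : qf (-X) x = -qf X x := by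
  simp [qf, Matrix.neg_mulVec]

lemma qf_smul (r : ℝ) (X : Matrix (Fin n) (Fin n) ℝ) (x : Fin n → ℝ) :
    qf (r • X) x = r * qf X x := by
  simp [qf, Matrix.smul_mulVec]

lemma qf_sum {ι : Type*} (s : Finset ι) (F : ι → Matrix (Fin n) (Fin n) ℝ) (x : Fin n → ℝ) :
    qf (∑ i ∈ s, F i) x = ∑ i ∈ s, qf (F i) x := by
  classical
  induction s using Finset.induction_on with
  | empty => simp [qf]
  | insert i s hi ih => rw [Finset.sum_insert hi, Finset.sum_insert hi, qf_add, ih]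

lemma qf_one (x : Fin n → ℝ) : qf 1 x = x ⬝ᵥ x := by simp [qf]

lemma qf_transpose (X : Matrix (Fin n) (Fin n) ℝ) (x : Fin n → ℝ) : qf Xᵀ x = qf X x := by
  rw [qf, qf, Matrix.mulVec_transpose, dotProduct_comm, Matrix.dotProduct_mulVec]

lemma qf_conj (X : Matrix (Fin n) (Fin n) ℝ) (B : Matrix (Fin n) (Fin n) ℝ) (x : Fin n → ℝ) :
    qf (B * X * Bᵀ) x = qf X (Bᵀ *ᵥ x) := by
  rw [qf, qf, ← Matrix.mulVec_mulVec, ← Matrix.mulVec_mulVec, Matrix.dotProduct_mulVec,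
    ← Matrix.mulVec_transpose]

lemma qf_eq_sum (X : Matrix (Fin n) (Fin n) ℝ) (x : Fin n → ℝ) :
    qf X x = ∑ i, ∑ k, x i * X i k * x k := by
  simp [qf, dotProduct, Matrix.mulVec, Finset.mul_sum, mul_assoc]

lemma abs_le_one_of_dotProduct {x : Fin n → ℝ} (hx : x ⬝ᵥ x = 1) (i : Fin n) : |x i| ≤ 1 := by
  have : x i * x i ≤ x ⬝ᵥ x :=
    Finset.single_le_sum (f := fun i => x i * x i) (fun _ _ => mul_self_nonneg _) (Finset.mem_univ i)
  rw [hx] at this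
  exact abs_le_one_iff_mul_self_le_one.2 this

lemma abs_bilin_le {X : Matrix (Fin a) (Fin b) ℝ} {x : Fin a → ℝ} {y : Fin b → ℝ} {r s : ℝ}
    (hr : 0 ≤ r) (hx : ∀ i, |x i| ≤ r) (hy : ∀ i, |y i| ≤ s) : |x ⬝ᵥ (X *ᵥ y)| ≤ r * s * l1 X := by
  have : x ⬝ᵥ (X *ᵥ y) = ∑ i, ∑ k, x i * X i k * y k := by
    simp [dotProduct, Matrix.mulVec, Finset.mul_sum, mul_assoc]
  rw [this, l1, Finset.mul_sum]
  refine (Finset.abs_sum_le_sum_abs _ _).trans (Finset.sum_le_sum fun i _ => ?_)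
  rw [Finset.mul_sum]
  refine (Finset.abs_sum_le_sum_abs _ _).trans (Finset.sum_le_sum fun k _ => ?_)
  rw [abs_mul, abs_mul]
  calc |x i| * |X i k| * |y k| ≤ r * |X i k| * s := by gcongr; exacts [hx i, hy k]
    _ = r * s * |X i k| := by ring

lemma abs_qf_le {X : Matrix (Fin n) (Fin n) ℝ} {x : Fin n → ℝ} (hx : x ⬝ᵥ x = 1) :
    |qf X x| ≤ l1 X := by
  have := abs_bilin_le (X := X) zero_le_one (abs_le_one_of_dotProduct hx)
    (abs_le_one_of_dotProduct hx)
  simpa [qf] using this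

/-! ### Positive semidefinite matrices -/

lemma posSemidef_iff_qf {X : Matrix (Fin n) (Fin n) ℝ} :
    X.PosSemidef ↔ Xᵀ = X ∧ ∀ x, 0 ≤ qf X x := by
  rw [Matrix.posSemidef_iff_dotProduct_mulVec]
  simp [Matrix.IsHermitian, qf, Matrix.conjTranspose_eq_transpose_of_trivial]

lemma _root_.Matrix.PosSemidef.qf_nonneg {X : Matrix (Fin n) (Fin n) ℝ} (h : X.PosSemidef)
    (x : Fin n → ℝ) : 0 ≤ qf X x := (posSemidef_iff_qf.1 h).2 x

lemma _root_.Matrix.PosSemidef.transpose_eq {X : Matrix (Fin n) (Fin n) ℝ} (h : X.PosSemidef) :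
    Xᵀ = X := (posSemidef_iff_qf.1 h).1

lemma _root_.Matrix.PosDef.transpose_eq {X : Matrix (Fin n) (Fin n) ℝ} (h : X.PosDef) :
    Xᵀ = X := h.posSemidef.transpose_eq

/-- Nonnegativity of a quadratic form may be tested on unit vectors. -/
lemma posSemidef_of_unit {X : Matrix (Fin n) (Fin n) ℝ} (hX : Xᵀ = X)
    (h : ∀ x, x ⬝ᵥ x = 1 → 0 ≤ qf X x) : X.PosSemidef := by
  refine posSemidef_iff_qf.2 ⟨hX, fun x => ?_⟩
  by_cases hx : x = 0
  · simp [hx, qf]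
  have hpos : 0 < x ⬝ᵥ x := by
    have h0 : x ⬝ᵥ x ≠ 0 := fun h => hx (dotProduct_self_eq_zero.1 h)
    exact lt_of_le_of_ne (Finset.sum_nonneg fun i _ => mul_self_nonneg _) h0.symm
  set r := Real.sqrt (x ⬝ᵥ x)
  have hr : 0 < r := Real.sqrt_pos.2 hpos
  have hrr : r * r = x ⬝ᵥ x := Real.mul_self_sqrt hpos.le
  have h1 := h (r⁻¹ • x) (by
    rw [smul_dotProduct, dotProduct_smul, smul_eq_mul, smul_eq_mul, ← hrr]; field_simp)
  have h2 : qf X (r⁻¹ • x) = r⁻¹ * (r⁻¹ * qf X x) := by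
    simp [qf, Matrix.mulVec_smul]
  rw [h2] at h1
  have h3 : qf X x = r * r * (r⁻¹ * (r⁻¹ * qf X x)) := by field_simp
  rw [h3]; positivity

lemma isClosed_posSemidef : IsClosed {X : Matrix (Fin n) (Fin n) ℝ | X.PosSemidef} := by
  have : {X : Matrix (Fin n) (Fin n) ℝ | X.PosSemidef} =
      {X | Xᵀ = X} ∩ ⋂ x, {X | 0 ≤ qf X x} := by
    ext X; simp [posSemidef_iff_qf]
  rw [this]
  exact (isClosed_eq continuous_id.matrix_transpose continuous_id).inter
    (isClosed_iInter fun x => isClosed_le continuous_const (continuous_qf x))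

lemma qf_add_single (X : Matrix (Fin n) (Fin n) ℝ) (hX : Xᵀ = X) (x : Fin n → ℝ) (i : Fin n)
    (r : ℝ) : qf X (x + r • Pi.single i 1) = qf X x + 2 * r * (X *ᵥ x) i + r * r * X i i := by
  have h1 : x ⬝ᵥ (X *ᵥ Pi.single i 1) = (X *ᵥ x) i := by
    rw [Matrix.dotProduct_mulVec, ← Matrix.mulVec_transpose, hX, dotProduct_single, mul_one]
  have h2 : (Pi.single i (1 : ℝ)) ⬝ᵥ (X *ᵥ x) = (X *ᵥ x) i := by simp
  have h3 : (Pi.single i (1 : ℝ)) ⬝ᵥ (X *ᵥ Pi.single i 1) = X i i := by simp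
  simp only [qf, Matrix.mulVec_add, Matrix.mulVec_smul, add_dotProduct, dotProduct_add,
    smul_dotProduct, dotProduct_smul, smul_eq_mul, h1, h2, h3]
  ring

/-- A weighted Cauchy–Schwarz inequality for a positive semidefinite form. -/
lemma _root_.Matrix.PosSemidef.two_mul_abs_mulVec_le {X : Matrix (Fin n) (Fin n) ℝ}
    (h : X.PosSemidef) (x : Fin n → ℝ) (i : Fin n) (r : ℝ) :
    2 * r * |(X *ᵥ x) i| ≤ qf X x + r * r * X i i := by
  have h1 := h.qf_nonneg (x + r • Pi.single i 1)
  have h2 := h.qf_nonneg (x + (-r) • Pi.single i 1)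
  rw [qf_add_single X h.transpose_eq] at h1 h2
  rcases abs_cases ((X *ᵥ x) i) with ⟨h3, _⟩ | ⟨h3, _⟩ <;> rw [h3] <;> nlinarith

/-- Cauchy–Schwarz bounds an entry by the average of two diagonal entries. The trace is linear, so
Grönwall estimates can be run on it and then converted to the norm. -/
lemma _root_.Matrix.PosSemidef.l1_le_trace {X : Matrix (Fin n) (Fin n) ℝ} (h : X.PosSemidef) :
    l1 X ≤ n * X.trace := by
  have key : ∀ i k, |X i k| ≤ (X k k + X i i) / 2 := fun i k => by
    have := h.two_mul_abs_mulVec_le (Pi.single k 1) i 1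
    have h1 : (X *ᵥ Pi.single k 1) i = X i k := by simp
    have h2 : qf X (Pi.single k 1) = X k k := by simp [qf]
    rw [h1, h2] at this
    linarith
  calc l1 X ≤ ∑ i, ∑ k, (X k k + X i i) / 2 :=
        Finset.sum_le_sum fun i _ => Finset.sum_le_sum fun k _ => key i k
    _ = n * X.trace := by
        simp only [← Finset.sum_div, Finset.sum_add_distrib, Finset.sum_const, Finset.card_univ,
          Fintype.card_fin, nsmul_eq_mul, Matrix.trace, Matrix.diag, ← Finset.mul_sum]
        ring

lemma trace_le_l1 (X : Matrix (Fin n) (Fin n) ℝ) : X.trace ≤ l1 X :=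
  Finset.sum_le_sum fun i _ => (le_abs_self _).trans
    (Finset.single_le_sum (f := fun k => |X i k|) (fun _ _ => abs_nonneg _) (Finset.mem_univ i))

/-! ### The correction term of a measurement -/

/-- `P Hᵀ (H P Hᵀ + R)⁻¹ H P`. -/
def corr (H : Matrix (Fin p) (Fin n) ℝ) (R : Matrix (Fin p) (Fin p) ℝ)
    (P : Matrix (Fin n) (Fin n) ℝ) : Matrix (Fin n) (Fin n) ℝ :=
  P * Hᵀ * (H * P * Hᵀ + R)⁻¹ * H * P

/-- The affine minorant of `corr H R` given by the gain `K`. -/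
def gainForm (H : Matrix (Fin p) (Fin n) ℝ) (R : Matrix (Fin p) (Fin p) ℝ)
    (K : Matrix (Fin n) (Fin p) ℝ) (P : Matrix (Fin n) (Fin n) ℝ) : Matrix (Fin n) (Fin n) ℝ :=
  K * H * P + P * (K * H)ᵀ - K * (H * P * Hᵀ + R) * Kᵀ

variable {H : Matrix (Fin p) (Fin n) ℝ} {R : Matrix (Fin p) (Fin p) ℝ}
  {P : Matrix (Fin n) (Fin n) ℝ}

lemma innovation_posDef (hR : R.PosDef) (hP : P.PosSemidef) : (H * P * Hᵀ + R).PosDef := by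
  have := hP.mul_mul_conjTranspose_same H
  rw [Matrix.conjTranspose_eq_transpose_of_trivial] at this
  exact Matrix.PosDef.posSemidef_add this hR

lemma corr_posSemidef (hR : R.PosDef) (hP : P.PosSemidef) : (corr H R P).PosSemidef := by
  have := (innovation_posDef (H := H) hR hP).inv.posSemidef.mul_mul_conjTranspose_same (P * Hᵀ)
  rwa [Matrix.conjTranspose_eq_transpose_of_trivial, Matrix.transpose_mul,
    Matrix.transpose_transpose, hP.transpose_eq, ← Matrix.mul_assoc] at this

/-- Completing the square: with B = HPHᵀ + R the difference equals (K - K₀)B(K - K₀)ᵀ for the Kalman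
gain K₀ = PHᵀB⁻¹. Hence `corr H R` is a supremum of affine maps on the positive semidefinite cone,
which replaces Jensen's inequality below. -/
lemma corr_sub_gainForm (hR : R.PosDef) (hP : P.PosSemidef) (K : Matrix (Fin n) (Fin p) ℝ) :
    (corr H R P - gainForm H R K P).PosSemidef := by
  have hB := innovation_posDef (H := H) hR hP
  set B := H * P * Hᵀ + R with hBdef
  have hu : IsUnit B.det := (Matrix.isUnit_iff_isUnit_det B).1 hB.isUnit
  have hBt : Bᵀ = B := hB.transpose_eq
  have hBit : (B⁻¹)ᵀ = B⁻¹ := hB.inv.transpose_eq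
  have h := hB.posSemidef.mul_mul_conjTranspose_same (K - P * Hᵀ * B⁻¹)
  convert h using 1
  rw [Matrix.conjTranspose_eq_transpose_of_trivial, Matrix.transpose_sub, Matrix.transpose_mul,
    Matrix.transpose_mul, Matrix.transpose_transpose, hP.transpose_eq, hBit, corr, gainForm,
    ← hBdef, Matrix.sub_mul, Matrix.mul_sub, Matrix.sub_mul, Matrix.mul_assoc _ B⁻¹ B,
    Matrix.nonsing_inv_mul _ hu, Matrix.mul_one, Matrix.transpose_mul]
  have e : K * B * (B⁻¹ * (H * P)) = K * H * P := by
    rw [Matrix.mul_assoc K, ← Matrix.mul_assoc B, Matrix.mul_nonsing_inv _ hu, Matrix.one_mul,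
      Matrix.mul_assoc]
  have e' : (K * B - P * Hᵀ) * (B⁻¹ * (H * P)) = K * H * P - P * Hᵀ * B⁻¹ * H * P := by
    rw [Matrix.sub_mul, e]
    simp only [Matrix.mul_assoc]
  rw [e']
  simp only [Matrix.mul_assoc]
  abel

/-- At the Kalman gain the completed square vanishes, so the supremum is attained. -/
lemma gainForm_optimal (hR : R.PosDef) (hP : P.PosSemidef) :
    gainForm H R (P * Hᵀ * (H * P * Hᵀ + R)⁻¹) P = corr H R P := by
  have hB := innovation_posDef (H := H) hR hP
  rw [gainForm, corr]
  set B := H * P * Hᵀ + R with hBdef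
  have hu : IsUnit B.det := (Matrix.isUnit_iff_isUnit_det B).1 hB.isUnit
  have hBit : (B⁻¹)ᵀ = B⁻¹ := hB.inv.transpose_eq
  simp only [Matrix.transpose_mul, Matrix.transpose_transpose, hP.transpose_eq, hBit]
  rw [Matrix.mul_assoc _ B⁻¹ B, Matrix.nonsing_inv_mul _ hu]
  simp only [Matrix.mul_assoc, Matrix.one_mul]
  abel

lemma corr_transpose (hR : Rᵀ = R) (P : Matrix (Fin n) (Fin n) ℝ) :
    corr H R Pᵀ = (corr H R P)ᵀ := by
  simp only [corr, Matrix.transpose_mul, Matrix.transpose_transpose, Matrix.transpose_nonsing_inv,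
    Matrix.transpose_add, hR, Matrix.mul_assoc]

/-- Woodbury: a measurement adds `Hᵀ R⁻¹ H` to the information matrix. -/
lemma inv_sub_corr (hR : R.PosDef) (hP : P.PosDef) :
    (P - corr H R P)⁻¹ = P⁻¹ + Hᵀ * R⁻¹ * H := by
  have hPu : IsUnit P.det := (Matrix.isUnit_iff_isUnit_det P).1 hP.isUnit
  have hRu : IsUnit R.det := (Matrix.isUnit_iff_isUnit_det R).1 hR.isUnit
  have h := Matrix.add_mul_mul_inv_eq_sub P⁻¹ Hᵀ R⁻¹ H hP.inv.isUnit hR.inv.isUnit (by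
    rw [Matrix.nonsing_inv_nonsing_inv _ hPu, Matrix.nonsing_inv_nonsing_inv _ hRu, add_comm]
    exact (innovation_posDef (H := H) hR hP.posSemidef).isUnit)
  rw [Matrix.nonsing_inv_nonsing_inv _ hPu, Matrix.nonsing_inv_nonsing_inv _ hRu,
    add_comm R] at h
  rw [corr, ← h, Matrix.nonsing_inv_nonsing_inv]
  rw [← Matrix.isUnit_iff_isUnit_det]
  have hS := hR.inv.posSemidef.conjTranspose_mul_mul_same H
  rw [Matrix.conjTranspose_eq_transpose_of_trivial] at hS
  exact (hP.inv.add_posSemidef hS).isUnit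

/-- Used at jump times: a left limit of positive definite matrices is a priori only semidefinite,
but the value after the jump is definite. -/
lemma posDef_of_sub_corr (hR : R.PosDef) (hP : P.PosSemidef) (h : (P - corr H R P).PosDef) :
    P.PosDef := by
  have := h.add_posSemidef (corr_posSemidef (H := H) hR hP)
  rwa [sub_add_cancel] at this

/-- Antitonicity of the inverse. With y = B⁻¹z and w = R⁻¹z, expanding the R-form of y - w gives 2
y·z ≤ w·z + yᵀRy, and yᵀRy ≤ yᵀBy = y·z. -/
lemma qf_inv_le (hR : R.PosDef) {B : Matrix (Fin p) (Fin p) ℝ} (hB : B.PosDef)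
    (h : (B - R).PosSemidef) (z : Fin p → ℝ) : qf B⁻¹ z ≤ qf R⁻¹ z := by
  have hBu : IsUnit B.det := (Matrix.isUnit_iff_isUnit_det B).1 hB.isUnit
  have hRu : IsUnit R.det := (Matrix.isUnit_iff_isUnit_det R).1 hR.isUnit
  set y := B⁻¹ *ᵥ z
  set w := R⁻¹ *ᵥ z
  have hBy : B *ᵥ y = z := by
    simp [y, Matrix.mulVec_mulVec, Matrix.mul_nonsing_inv _ hBu]
  have hRw : R *ᵥ w = z := by
    simp [w, Matrix.mulVec_mulVec, Matrix.mul_nonsing_inv _ hRu]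
  have h1 := h.qf_nonneg y
  have h2 := hR.posSemidef.qf_nonneg (y - w)
  have h3 : w ⬝ᵥ (R *ᵥ y) = y ⬝ᵥ (R *ᵥ w) := by
    rw [Matrix.dotProduct_mulVec, ← Matrix.mulVec_transpose, hR.transpose_eq,
      dotProduct_comm]
  rw [qf_sub] at h1
  simp only [qf, Matrix.mulVec_sub, sub_dotProduct, dotProduct_sub] at h1 h2
  rw [h3, hRw] at h2
  rw [hBy] at h1
  have e1 : qf B⁻¹ z = y ⬝ᵥ z := dotProduct_comm _ _
  have e2 : qf R⁻¹ z = w ⬝ᵥ z := dotProduct_comm _ _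
  rw [e1, e2]
  linarith

/-- The bound does not depend on P, since HPHᵀ + R dominates R. On positive semidefinite matrices
the size and Lipschitz constant of the correction are thus controlled by a bound on P alone. -/
lemma l1_innovation_inv_le (hR : R.PosDef) (hP : P.PosSemidef) :
    l1 (H * P * Hᵀ + R)⁻¹ ≤ p * (R⁻¹).trace := by
  have hB := innovation_posDef (H := H) hR hP
  refine hB.inv.posSemidef.l1_le_trace.trans ?_
  gcongr
  refine Finset.sum_le_sum fun i _ => ?_
  have hS := hP.mul_mul_conjTranspose_same H
  rw [Matrix.conjTranspose_eq_transpose_of_trivial] at hS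
  have := qf_inv_le hR hB (by rwa [add_sub_cancel_right]) (Pi.single i 1)
  simpa [qf] using this

lemma l1_mul_le_of_le {X : Matrix (Fin a) (Fin b) ℝ} {Y : Matrix (Fin b) (Fin c) ℝ} {u v : ℝ}
    (h1 : l1 X ≤ u) (h2 : l1 Y ≤ v) : l1 (X * Y) ≤ u * v :=
  (l1_mul_le X Y).trans (mul_le_mul h1 h2 (l1_nonneg _) ((l1_nonneg _).trans h1))

lemma l1_corr_le {β c : ℝ} (hβ : l1 (H * P * Hᵀ + R)⁻¹ ≤ β) (hc : l1 P ≤ c) :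
    l1 (corr H R P) ≤ c * l1 H * β * l1 H * c :=
  l1_mul_le_of_le (l1_mul_le_of_le (l1_mul_le_of_le (l1_mul_le_of_le hc (l1_transpose H).le) hβ)
    le_rfl) hc

/-- A local Lipschitz estimate for `corr`. -/
lemma l1_corr_sub_le {P' : Matrix (Fin n) (Fin n) ℝ} {β c : ℝ}
    (hu : IsUnit (H * P * Hᵀ + R)) (hu' : IsUnit (H * P' * Hᵀ + R))
    (hβ : l1 (H * P * Hᵀ + R)⁻¹ ≤ β) (hβ' : l1 (H * P' * Hᵀ + R)⁻¹ ≤ β)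
    (hc : l1 P ≤ c) (hc' : l1 P' ≤ c) :
    l1 (corr H R P - corr H R P') ≤
      (2 * (c * l1 H * β * l1 H) + c * l1 H * β * l1 H * l1 H * β * l1 H * c) * l1 (P - P') := by
  have hc0 := (l1_nonneg _).trans hc
  have hβ0 := (l1_nonneg _).trans hβ
  have hH := l1_nonneg H
  have hD := l1_nonneg (P - P')
  set B := H * P * Hᵀ + R
  set B' := H * P' * Hᵀ + R
  have hBu : IsUnit B.det := (Matrix.isUnit_iff_isUnit_det B).1 hu
  have hBu' : IsUnit B'.det := (Matrix.isUnit_iff_isUnit_det B').1 hu'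
  have hdiff : B' - B = -(H * (P - P') * Hᵀ) := by
    simp only [B, B', Matrix.mul_sub, Matrix.sub_mul]; abel
  have hinv : B⁻¹ - B'⁻¹ = -(B⁻¹ * (H * (P - P') * Hᵀ) * B'⁻¹) := by
    have : B⁻¹ * (B' - B) * B'⁻¹ = B⁻¹ - B'⁻¹ := by
      rw [Matrix.mul_sub, Matrix.sub_mul, Matrix.nonsing_inv_mul _ hBu, Matrix.mul_assoc,
        Matrix.mul_nonsing_inv _ hBu', Matrix.mul_one, Matrix.one_mul]
    rw [← this, hdiff]; simp
  -- The factors are exchanged one at a time; the resolvent identity `hinv` turns the difference of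
  -- inverses into the last term.
  have key : corr H R P - corr H R P' =
      (P - P') * Hᵀ * B⁻¹ * H * P + P' * Hᵀ * B'⁻¹ * H * (P - P')
        - P' * Hᵀ * B⁻¹ * H * (P - P') * Hᵀ * B'⁻¹ * H * P := by
    have e : P' * Hᵀ * B⁻¹ * H * (P - P') * Hᵀ * B'⁻¹ * H * P
        = -(P' * Hᵀ * (B⁻¹ - B'⁻¹) * H * P) := by
      rw [hinv]; simp only [Matrix.mul_assoc, Matrix.neg_mul, Matrix.mul_neg, neg_neg]
    rw [e]
    simp only [corr, Matrix.mul_sub, Matrix.sub_mul, B, B']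
    abel
  have hHt : l1 Hᵀ ≤ l1 H := (l1_transpose H).le
  have t1 : l1 ((P - P') * Hᵀ * B⁻¹ * H * P) ≤ l1 (P - P') * l1 H * β * l1 H * c :=
    l1_mul_le_of_le (l1_mul_le_of_le (l1_mul_le_of_le (l1_mul_le_of_le le_rfl hHt) hβ) le_rfl) hc
  have t2 : l1 (P' * Hᵀ * B'⁻¹ * H * (P - P')) ≤ c * l1 H * β * l1 H * l1 (P - P') :=
    l1_mul_le_of_le (l1_mul_le_of_le (l1_mul_le_of_le (l1_mul_le_of_le hc' hHt) hβ') le_rfl) le_rfl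
  have t3 : l1 (P' * Hᵀ * B⁻¹ * H * (P - P') * Hᵀ * B'⁻¹ * H * P) ≤
      c * l1 H * β * l1 H * l1 (P - P') * l1 H * β * l1 H * c :=
    l1_mul_le_of_le (l1_mul_le_of_le (l1_mul_le_of_le (l1_mul_le_of_le (l1_mul_le_of_le (l1_mul_le_of_le (l1_mul_le_of_le
      (l1_mul_le_of_le hc' hHt) hβ) le_rfl) le_rfl) hHt) hβ') le_rfl) hc
  rw [key]
  refine (l1_sub_le _ _).trans ((add_le_add (l1_add_le _ _) le_rfl).trans ?_)
  linarith

/-- If `B` is invertible, so is every matrix close to `B`, with a uniformly bounded inverse. -/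
lemma isUnit_of_l1_sub_le {B B' : Matrix (Fin p) (Fin p) ℝ} (hB : IsUnit B) {β : ℝ}
    (hβ : l1 B⁻¹ ≤ β) (h : l1 (B' - B) * β ≤ 1 / 2) : IsUnit B' ∧ l1 B'⁻¹ ≤ 2 * β := by
  have hBu : IsUnit B.det := (Matrix.isUnit_iff_isUnit_det B).1 hB
  have hβ0 := (l1_nonneg _).trans hβ
  -- Write B⁻¹B' = 1 + B⁻¹(B' - B); the perturbation halves the norm. A kernel vector Z then has
  -- norm at most half its own, and the norm of B'⁻¹ is at most β plus half of itself.
  have hsmall : ∀ {r : ℕ} (Z : Matrix (Fin p) (Fin r) ℝ),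
      l1 (B⁻¹ * (B' - B) * Z) ≤ 1 / 2 * l1 Z := fun Z => by
    refine (l1_mul_le _ _).trans (mul_le_mul_of_nonneg_right ?_ (l1_nonneg _))
    refine (l1_mul_le _ _).trans (le_trans ?_ h)
    rw [mul_comm]
    exact mul_le_mul_of_nonneg_left hβ (l1_nonneg _)
  have hexp : ∀ {r : ℕ} (Z : Matrix (Fin p) (Fin r) ℝ),
      B⁻¹ * (B' - B) * Z = B⁻¹ * (B' * Z) - Z := fun Z => by
    rw [Matrix.mul_sub, Matrix.nonsing_inv_mul _ hBu, Matrix.sub_mul, Matrix.one_mul,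
      Matrix.mul_assoc]
  have hunit : IsUnit B' := by
    rw [← Matrix.mulVec_injective_iff_isUnit]
    intro v w hvw
    set Z : Matrix (Fin p) (Fin 1) ℝ := Matrix.of fun i _ => v i - w i
    have hZ : B' * Z = 0 := by
      ext i k
      have := congrFun hvw i
      simp only [Matrix.mulVec, dotProduct] at this
      simp [Matrix.mul_apply, Z, mul_sub, Finset.sum_sub_distrib, this]
    have h1 := hsmall Z
    rw [hexp, hZ, Matrix.mul_zero, zero_sub, l1_neg] at h1
    have h2 : Z = 0 := eq_zero_of_l1_le_zero (by linarith)
    ext i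
    have := congrFun (congrFun h2 i) 0
    simpa [Z, sub_eq_zero] using this
  have hBu' : IsUnit B'.det := (Matrix.isUnit_iff_isUnit_det B').1 hunit
  refine ⟨hunit, ?_⟩
  have h1 := hsmall B'⁻¹
  have h2 := hexp B'⁻¹
  rw [Matrix.mul_nonsing_inv _ hBu', Matrix.mul_one] at h2
  have h3 : B'⁻¹ = B⁻¹ - B⁻¹ * (B' - B) * B'⁻¹ := by rw [h2]; abel
  have h4 : l1 B'⁻¹ ≤ l1 B⁻¹ + l1 (B⁻¹ * (B' - B) * B'⁻¹) := by
    conv_lhs => rw [h3]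
    exact l1_sub_le _ _
  linarith

end CDKF

end

noncomputable section

namespace CDKF

variable {n : ℕ}

/-! ### Integral inequalities -/

lemma hasDerivWithinAt_integral_of_right {f : ℝ → ℝ} {s T t : ℝ} (hf : IntegrableOn f (Set.Icc s T))
    (ht : t ∈ Set.Ico s T) (hc : ContinuousWithinAt f (Set.Ici t) t) :
    HasDerivWithinAt (fun u => ∫ v in s..u, f v) (f t) (Set.Ici t) t := by
  have hi : IntervalIntegrable f volume s t :=
    (intervalIntegrable_iff_integrableOn_Icc_of_le ht.1).2
      (hf.mono_set (Set.Icc_subset_Icc_right ht.2.le))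
  refine intervalIntegral.integral_hasDerivWithinAt_right hi (t := Set.Ioi t) ?_
    (hc.mono Set.Ioi_subset_Ici_self)
  refine ⟨Set.Ioc t T, Ioc_mem_nhdsGT ht.2, ?_⟩
  exact (hf.mono_set fun u hu => ⟨ht.1.trans hu.1.le, hu.2⟩).aestronglyMeasurable

lemma integral_primitive_continuousOn {f : ℝ → ℝ} {s T : ℝ} (hf : IntegrableOn f (Set.Icc s T)) :
    ContinuousOn (fun t => ∫ u in s..t, f u) (Set.Icc s T) := by
  by_cases h : s ≤ T
  · rw [← Set.uIcc_of_le h] at hf ⊢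
    exact intervalIntegral.continuousOn_primitive_interval hf
  · rw [Set.Icc_eq_empty h]; exact continuousOn_empty _

/-- Grönwall's inequality in integral form, for an integrable function. -/
lemma gronwall_integral {f : ℝ → ℝ} {s T A C : ℝ} (hC : 0 ≤ C)
    (hf : IntegrableOn f (Set.Icc s T))
    (h : ∀ t ∈ Set.Icc s T, f t ≤ A + C * ∫ u in s..t, f u) :
    ∀ t ∈ Set.Icc s T, f t ≤ A * Real.exp (C * (t - s)) := by
  intro t ht
  -- The function f may jump, but its majorant F is continuous. The primitive G of F satisfies G' =
  -- F ≤ C G + A, to which the differential form of Grönwall applies.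
  set F : ℝ → ℝ := fun t => A + C * ∫ u in s..t, f u with hF
  have hFc : ContinuousOn F (Set.Icc s T) :=
    continuousOn_const.add (continuousOn_const.mul (integral_primitive_continuousOn hf))
  have hFi : IntegrableOn F (Set.Icc s T) := hFc.integrableOn_Icc
  set G : ℝ → ℝ := fun t => ∫ u in s..t, F u with hG
  have hint : ∀ {g : ℝ → ℝ}, IntegrableOn g (Set.Icc s T) → ∀ x ∈ Set.Icc s T,
      IntervalIntegrable g volume s x := fun hg x hx =>
    (intervalIntegrable_iff_integrableOn_Icc_of_le hx.1).2
      (hg.mono_set (Set.Icc_subset_Icc_right hx.2))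
  have hFG : ∀ x ∈ Set.Icc s T, F x ≤ C * G x + A := fun x hx => by
    have : ∫ u in s..x, f u ≤ ∫ u in s..x, F u :=
      intervalIntegral.integral_mono_on hx.1 (hint hf x hx) (hint hFi x hx)
        fun u hu => h u ⟨hu.1, hu.2.trans hx.2⟩
    have := mul_le_mul_of_nonneg_left this hC
    simp only [hF, hG] at this ⊢
    linarith
  have hGd : ∀ x ∈ Set.Ico s T, HasDerivWithinAt G (F x) (Set.Ici x) x := fun x hx =>
    hasDerivWithinAt_integral_of_right hFi hx
      ((hFc x ⟨hx.1, hx.2.le⟩).mono_of_mem_nhdsWithin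
        (Filter.mem_of_superset (Icc_mem_nhdsGE hx.2) (Set.Icc_subset_Icc_left hx.1)))
  have hb := le_gronwallBound_of_liminf_deriv_right_le (f := G) (f' := F) (δ := 0) (K := C)
    (ε := A) (integral_primitive_continuousOn hFi)
    (fun x hx r hr => (hGd x hx).liminf_right_slope_le hr) (by simp [hG])
    (fun x hx => hFG x ⟨hx.1, hx.2.le⟩) t ht
  refine (h t ht).trans ((hFG t ht).trans ?_)
  -- The closed form of the Grönwall bound divides by C.
  rcases hC.eq_or_lt with h0 | h0
  · simp [← h0]
  · have := mul_le_mul_of_nonneg_left hb hC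
    rw [gronwallBound_of_K_ne_0 h0.ne'] at this
    have e : C * (0 * Real.exp (C * (t - s)) + A / C * (Real.exp (C * (t - s)) - 1)) + A
        = A * Real.exp (C * (t - s)) := by field_simp; ring
    linarith

/-! ### Càdlàg functions -/

/-- A real function that is right-continuous with left limits on `[0,T]`. -/
structure CadlagOn (T : ℝ) (f : ℝ → ℝ) : Prop where
  right : ∀ t ∈ Set.Ico 0 T, ContinuousWithinAt f (Set.Ici t) t
  left : ∀ t ∈ Set.Ioc 0 T, ∃ L, Filter.Tendsto f (nhdsWithin t (Set.Iio t)) (nhds L)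

/-- The one-sided limits bound the function near each point of the compact interval; finitely many
such neighbourhoods suffice. -/
lemma CadlagOn.bounded {T : ℝ} {f : ℝ → ℝ} (h : CadlagOn T f) :
    ∃ C, ∀ t ∈ Set.Icc 0 T, |f t| ≤ C := by
  refine isCompact_Icc.induction_on (p := fun s => ∃ C, ∀ t ∈ s, |f t| ≤ C) ⟨0, by simp⟩
    (fun s t hst ⟨C, hC⟩ => ⟨C, fun u hu => hC u (hst hu)⟩)
    (fun s t ⟨C, hC⟩ ⟨C', hC'⟩ => ⟨max C C', fun u hu => hu.elim
      (fun hu => (hC u hu).trans (le_max_left _ _)) fun hu => (hC' u hu).trans (le_max_right _ _)⟩)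
    fun t ht => ?_
  have bdd : ∀ {l : Filter ℝ} {L : ℝ}, Filter.Tendsto f l (nhds L) →
      ∀ᶠ u in l, |f u| ≤ |L| + 1 := fun {l L} hl => by
    have := hl.abs.eventually (Iio_mem_nhds (lt_add_one |L|))
    exact this.mono fun u hu => le_of_lt hu
  have hl : ∃ L, ∀ᶠ u in nhdsWithin t (Set.Iio t), u ∈ Set.Icc 0 T → |f u| ≤ L := by
    rcases ht.1.eq_or_lt with h0 | h0
    · refine ⟨0, eventually_nhdsWithin_of_forall fun u hu hu' => ?_⟩
      rw [← h0] at hu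
      exact absurd hu'.1 (not_le.2 hu)
    · obtain ⟨L, hL⟩ := h.left t ⟨h0, ht.2⟩
      exact ⟨_, (bdd hL).mono fun u hu _ => hu⟩
  have hr : ∃ L, ∀ᶠ u in nhdsWithin t (Set.Ici t), u ∈ Set.Icc 0 T → |f u| ≤ L := by
    rcases ht.2.eq_or_lt with h0 | h0
    · refine ⟨|f t|, eventually_nhdsWithin_of_forall fun u hu hu' => ?_⟩
      rw [le_antisymm (hu'.2.trans h0.ge) hu]
    · exact ⟨_, (bdd (h.right t ⟨ht.1, h0⟩)).mono fun u hu _ => hu⟩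
  obtain ⟨L, hL⟩ := hl
  obtain ⟨L', hL'⟩ := hr
  have : ∀ᶠ u in nhds t, u ∈ Set.Icc 0 T → |f u| ≤ max L L' := by
    rw [← nhdsLT_sup_nhdsGE, Filter.eventually_sup]
    exact ⟨hL.mono fun u hu h => (hu h).trans (le_max_left _ _),
      hL'.mono fun u hu h => (hu h).trans (le_max_right _ _)⟩
  exact ⟨{u | |f u| ≤ max L L'}, mem_nhdsWithin_iff_eventually.2 this, max L L', fun u hu => hu⟩

/-- By right continuity f is the pointwise limit of its values at the next grid point to the right,
capped at T. These approximations factor through a floor function, so they are measurable for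
arbitrary f. -/
lemma CadlagOn.aestronglyMeasurable {T : ℝ} {f : ℝ → ℝ} (h : CadlagOn T f) :
    AEStronglyMeasurable f (volume.restrict (Set.Icc 0 T)) := by
  set g : ℕ → ℝ → ℝ := fun k t => min T ((⌊t * (k + 1)⌋ + 1) / (k + 1)) with hg
  refine aestronglyMeasurable_of_tendsto_ae Filter.atTop (f := fun k t => f (g k t))
    (fun k => ?_) ?_
  · have : (fun t => f (g k t)) =
        (fun z : ℤ => f (min T ((z + 1) / (k + 1)))) ∘ fun t : ℝ => ⌊t * (k + 1)⌋ := rfl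
    rw [this]
    exact ((measurable_from_top).comp
      (Int.measurable_floor.comp (measurable_id.mul_const _))).aestronglyMeasurable
  · refine (ae_restrict_iff' measurableSet_Icc).2 (Filter.Eventually.of_forall fun t ht => ?_)
    have hlow : ∀ k : ℕ, t < (⌊t * (k + 1)⌋ + 1) / ((k : ℝ) + 1) := fun k => by
      rw [lt_div_iff₀ (by positivity)]; exact Int.lt_floor_add_one _
    have hup : ∀ k : ℕ, (⌊t * (k + 1)⌋ + 1) / ((k : ℝ) + 1) ≤ t + 1 / ((k : ℝ) + 1) := fun k => by
      have h1 := Int.floor_le (t * ((k : ℝ) + 1))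
      have h2 : (t + 1 / ((k : ℝ) + 1)) * (k + 1) = t * (k + 1) + 1 := by field_simp
      rw [div_le_iff₀ (by positivity), h2]
      linarith
    rcases ht.2.eq_or_lt with h0 | h0
    · have : ∀ k, g k t = t := fun k => by
        simp only [hg]; rw [min_eq_left]; exacts [h0.symm, h0 ▸ (hlow k).le]
      simp [this]
    · refine (h.right t ⟨ht.1, h0⟩).tendsto.comp (tendsto_nhdsWithin_iff.2 ⟨?_, ?_⟩)
      · have h1 : Filter.Tendsto (fun k : ℕ => t + 1 / ((k : ℝ) + 1)) Filter.atTop (nhds t) := by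
          simpa using tendsto_const_nhds.add (tendsto_one_div_add_atTop_nhds_zero_nat (𝕜 := ℝ))
        exact tendsto_of_tendsto_of_tendsto_of_le_of_le tendsto_const_nhds h1
          (fun k => le_min h0.le (hlow k).le) fun k => (min_le_right _ _).trans (hup k)
      · exact Filter.Eventually.of_forall fun k => le_min h0.le (hlow k).le

lemma CadlagOn.integrableOn {T : ℝ} {f : ℝ → ℝ} (h : CadlagOn T f) :
    IntegrableOn f (Set.Icc 0 T) := by
  obtain ⟨C, hC⟩ := h.bounded
  refine Integrable.of_bound h.aestronglyMeasurable C ?_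
  exact (ae_restrict_iff' measurableSet_Icc).2 (Filter.Eventually.of_forall hC)

/-! ### Entrywise integrals of matrices -/

/-- The entrywise integral of a matrix-valued function over `[s,t]`. -/
def matInt (F : ℝ → Matrix (Fin n) (Fin n) ℝ) (s t : ℝ) : Matrix (Fin n) (Fin n) ℝ :=
  Matrix.of fun i k => ∫ u in s..t, F u i k

/-- Entrywise integrability on `[a,b]`. -/
def MatIntegrableOn (F : ℝ → Matrix (Fin n) (Fin n) ℝ) (a b : ℝ) : Prop :=
  ∀ i k, IntegrableOn (fun u => F u i k) (Set.Icc a b)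

lemma MatIntegrableOn.mono {F : ℝ → Matrix (Fin n) (Fin n) ℝ} {a b s t : ℝ}
    (h : MatIntegrableOn F a b) (hs : a ≤ s) (ht : t ≤ b) : MatIntegrableOn F s t :=
  fun i k => (h i k).mono_set (Set.Icc_subset_Icc hs ht)

lemma MatIntegrableOn.interval {F : ℝ → Matrix (Fin n) (Fin n) ℝ} {s t : ℝ}
    (h : MatIntegrableOn F s t) (hst : s ≤ t) (i k : Fin n) :
    IntervalIntegrable (fun u => F u i k) volume s t :=
  (intervalIntegrable_iff_integrableOn_Icc_of_le hst).2 (h i k)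

lemma MatIntegrableOn.add {F G : ℝ → Matrix (Fin n) (Fin n) ℝ} {a b : ℝ}
    (hF : MatIntegrableOn F a b) (hG : MatIntegrableOn G a b) :
    MatIntegrableOn (fun u => F u + G u) a b := fun i k => (hF i k).add (hG i k)

lemma MatIntegrableOn.sub {F G : ℝ → Matrix (Fin n) (Fin n) ℝ} {a b : ℝ}
    (hF : MatIntegrableOn F a b) (hG : MatIntegrableOn G a b) :
    MatIntegrableOn (fun u => F u - G u) a b := fun i k => (hF i k).sub (hG i k)

lemma matIntegrableOn_const (X : Matrix (Fin n) (Fin n) ℝ) (a b : ℝ) :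
    MatIntegrableOn (fun _ => X) a b := fun i k => by
  simp [integrableOn_const_iff]

lemma MatIntegrableOn.transpose {F : ℝ → Matrix (Fin n) (Fin n) ℝ} {a b : ℝ}
    (hF : MatIntegrableOn F a b) : MatIntegrableOn (fun u => (F u)ᵀ) a b := fun i k => hF k i

lemma matInt_split {F : ℝ → Matrix (Fin n) (Fin n) ℝ} {a s t : ℝ} (h : MatIntegrableOn F a t)
    (has : a ≤ s) (hst : s ≤ t) : matInt F a t - matInt F a s = matInt F s t := by
  ext i k
  simp only [matInt, Matrix.sub_apply, Matrix.of_apply]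
  exact intervalIntegral.integral_interval_sub_left (h.interval (has.trans hst) i k)
    ((h.mono le_rfl hst).interval has i k)

lemma matInt_sub {F G : ℝ → Matrix (Fin n) (Fin n) ℝ} {s t : ℝ} (hst : s ≤ t)
    (hF : MatIntegrableOn F s t) (hG : MatIntegrableOn G s t) :
    matInt (fun u => F u - G u) s t = matInt F s t - matInt G s t := by
  ext i k
  exact intervalIntegral.integral_sub (hF.interval hst i k) (hG.interval hst i k)

lemma matInt_const (X : Matrix (Fin n) (Fin n) ℝ) (s t : ℝ) :
    matInt (fun _ => X) s t = (t - s) • X := by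
  ext i k; simp [matInt]

lemma matInt_transpose (F : ℝ → Matrix (Fin n) (Fin n) ℝ) (s t : ℝ) :
    (matInt F s t)ᵀ = matInt (fun u => (F u)ᵀ) s t := rfl

lemma MatIntegrableOn.l1_integrableOn {F : ℝ → Matrix (Fin n) (Fin n) ℝ} {a b : ℝ}
    (h : MatIntegrableOn F a b) : IntegrableOn (fun u => l1 (F u)) (Set.Icc a b) :=
  integrable_finsetSum _ fun i _ => integrable_finsetSum _ fun k _ => (h i k).abs

lemma l1_matInt_le_integral {F : ℝ → Matrix (Fin n) (Fin n) ℝ} {s t : ℝ} (hst : s ≤ t)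
    (h : MatIntegrableOn F s t) : l1 (matInt F s t) ≤ ∫ u in s..t, l1 (F u) := by
  have hi := fun i k => (h.interval hst i k).abs
  have : ∫ u in s..t, l1 (F u) = ∑ i, ∑ k, ∫ u in s..t, |F u i k| := by
    unfold l1
    rw [intervalIntegral.integral_finsetSum fun i _ => ?_]
    · exact Finset.sum_congr rfl fun i _ => intervalIntegral.integral_finsetSum fun k _ => hi i k
    · exact (intervalIntegrable_iff_integrableOn_Icc_of_le hst).2
        (integrable_finsetSum _ fun k _ => (h i k).abs)
  rw [this]
  exact Finset.sum_le_sum fun i _ => Finset.sum_le_sum fun k _ =>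
    intervalIntegral.abs_integral_le_integral_abs hst

lemma l1_matInt_le {F : ℝ → Matrix (Fin n) (Fin n) ℝ} {s t : ℝ} (hst : s ≤ t)
    (h : MatIntegrableOn F s t) {φ : ℝ → ℝ} (hφ : IntervalIntegrable φ volume s t)
    (hle : ∀ᵐ u ∂(volume.restrict (Set.Icc s t)), l1 (F u) ≤ φ u) :
    l1 (matInt F s t) ≤ ∫ u in s..t, φ u :=
  (l1_matInt_le_integral hst h).trans
    (intervalIntegral.integral_mono_ae_restrict hst
      ((intervalIntegrable_iff_integrableOn_Icc_of_le hst).2 h.l1_integrableOn) hφ hle)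

lemma l1_matInt_le_const {F : ℝ → Matrix (Fin n) (Fin n) ℝ} {s t : ℝ} (hst : s ≤ t)
    (h : MatIntegrableOn F s t) {c : ℝ}
    (hle : ∀ᵐ u ∂(volume.restrict (Set.Icc s t)), l1 (F u) ≤ c) :
    l1 (matInt F s t) ≤ c * (t - s) := by
  refine (l1_matInt_le hst h (φ := fun _ => c) (by simp) hle).trans ?_
  simp [mul_comm]

lemma trace_matInt {F : ℝ → Matrix (Fin n) (Fin n) ℝ} {s t : ℝ} (hst : s ≤ t)
    (h : MatIntegrableOn F s t) : (matInt F s t).trace = ∫ u in s..t, (F u).trace := by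
  simp only [Matrix.trace, Matrix.diag, matInt, Matrix.of_apply]
  rw [intervalIntegral.integral_finsetSum fun i _ => h.interval hst i i]

lemma qf_matInt {F : ℝ → Matrix (Fin n) (Fin n) ℝ} {s t : ℝ} (hst : s ≤ t)
    (h : MatIntegrableOn F s t) (x : Fin n → ℝ) :
    qf (matInt F s t) x = ∫ u in s..t, qf (F u) x := by
  have hi : ∀ i k, IntervalIntegrable (fun u => x i * F u i k * x k) volume s t := fun i k =>
    ((h.interval hst i k).const_mul _).mul_const _
  simp only [qf_eq_sum]
  rw [intervalIntegral.integral_finsetSum fun i _ => ?_]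
  · refine Finset.sum_congr rfl fun i _ => ?_
    rw [intervalIntegral.integral_finsetSum fun k _ => hi i k]
    refine Finset.sum_congr rfl fun k _ => ?_
    simp [matInt]
  · exact (intervalIntegrable_iff_integrableOn_Icc_of_le hst).2
      (integrable_finsetSum _ fun k _ => ((h i k).const_mul _).mul_const _)

lemma MatIntegrableOn.const_mul {F : ℝ → Matrix (Fin n) (Fin n) ℝ} {a b : ℝ}
    (h : MatIntegrableOn F a b) (X : Matrix (Fin n) (Fin n) ℝ) :
    MatIntegrableOn (fun u => X * F u) a b := fun i k => by
  simp only [Matrix.mul_apply]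
  exact integrable_finsetSum _ fun j _ => (h j k).const_mul _

lemma MatIntegrableOn.mul_const {F : ℝ → Matrix (Fin n) (Fin n) ℝ} {a b : ℝ}
    (h : MatIntegrableOn F a b) (X : Matrix (Fin n) (Fin n) ℝ) :
    MatIntegrableOn (fun u => F u * X) a b := fun i k => by
  simp only [Matrix.mul_apply]
  exact integrable_finsetSum _ fun j _ => (h i j).mul_const _

/-! ### A comparison principle -/

/-- A continuous symmetric matrix path that is almost positive semidefinite at the start stays so
if its increments over short intervals are bounded below, up to a quadratic error, in terms of the
negative part of the path and of the size of the path on the vector at hand. -/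
theorem comparison {a b C C' ε : ℝ} {D : ℝ → Matrix (Fin n) (Fin n) ℝ}
    (hD : ContinuousOn D (Set.Icc a b)) (hsym : ∀ t ∈ Set.Icc a b, (D t)ᵀ = D t)
    (hC : 0 ≤ C) (hC' : 0 ≤ C') (hε : 0 < ε) (h0 : (D a + ε • 1).PosSemidef)
    (hstep : ∀ s ∈ Set.Icc a b, ∀ t ∈ Set.Icc a b, s < t → ∀ δ, 0 ≤ δ →
      (D s + δ • 1).PosSemidef → ∀ x, x ⬝ᵥ x = 1 → ∀ η, 0 ≤ η → (∀ i, |(D s *ᵥ x) i| ≤ η) →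
      -(C * (t - s) * (η + δ)) - C' * (t - s) ^ 2 ≤ qf (D t) x - qf (D s) x) :
    ∀ t ∈ Set.Icc a b, (D t + (ε * Real.exp ((2 * C + 1) * (t - a))) • 1).PosSemidef := by
  -- The exponent 2C + 1 is what one step needs. The hypothesis `hstep` is applied with δ = e(s) and
  -- with an η containing another e(s), which costs 2C e(s)h; the remaining e(s)h pays for the
  -- quadratic errors.
  set e : ℝ → ℝ := fun t => ε * Real.exp ((2 * C + 1) * (t - a)) with he
  have hepos : ∀ t, 0 < e t := fun t => by positivity
  set E : ℝ → Matrix (Fin n) (Fin n) ℝ := fun t => D t + e t • 1 with hE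
  have hEc : ContinuousOn E (Set.Icc a b) := by
    refine hD.add (Continuous.continuousOn ?_)
    simp only [he]; fun_prop
  have hEt : ∀ t ∈ Set.Icc a b, (E t)ᵀ = E t := fun t ht => by
    simp [hE, Matrix.transpose_add, Matrix.transpose_smul, hsym t ht]
  refine IsClosed.Icc_subset_of_forall_exists_gt (s := {t | (E t).PosSemidef}) ?_ ?_ ?_
  · rw [Set.inter_comm]
    exact hEc.preimage_isClosed_of_isClosed isClosed_Icc isClosed_posSemidef
  · simpa [hE, he] using h0
  rintro s ⟨hs, hsab⟩ y hy
  have hs' : s ∈ Set.Icc a b := ⟨hsab.1, hsab.2.le⟩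
  -- Collects the quadratic errors: C'h² from the hypothesis and (Ch)² times the trace from
  -- Cauchy–Schwarz. The choice h C₃ ≤ e(s) makes the margin e(s)h cover them.
  set C₃ := C' + C * C * (E s).trace + 1
  have htr : 0 ≤ (E s).trace := Matrix.PosSemidef.trace_nonneg hs
  have hC₃ : 0 < C₃ := by positivity
  set h := min (min (b - s) (y - s)) (e s / C₃) with hh
  have hhpos : 0 < h := lt_min (lt_min (sub_pos.2 hsab.2) (sub_pos.2 hy)) (div_pos (hepos s) hC₃)
  have h1 : h ≤ b - s := (min_le_left _ _).trans (min_le_left _ _)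
  have h2 : h ≤ y - s := (min_le_left _ _).trans (min_le_right _ _)
  have h3 : h * C₃ ≤ e s := (le_div_iff₀ hC₃).1 (min_le_right _ _)
  have ht : s + h ∈ Set.Icc a b := ⟨by linarith [hsab.1], by linarith⟩
  refine ⟨s + h, ?_, by constructor <;> linarith⟩
  refine posSemidef_of_unit (hEt _ ht) fun x hx => ?_
  have hne : Nonempty (Fin n) := by
    by_contra hne
    rw [not_nonempty_iff] at hne
    simp [dotProduct] at hx
  obtain ⟨i₀, hi₀⟩ := Finite.exists_max fun i => |(E s *ᵥ x) i|
  have hDE : D s = E s - e s • 1 := by simp [hE]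
  have hDx : ∀ i, |(D s *ᵥ x) i| ≤ |(E s *ᵥ x) i₀| + e s := fun i => by
    have e1 : (D s *ᵥ x) i = (E s *ᵥ x) i - e s * x i := by
      rw [hDE, Matrix.sub_mulVec, Matrix.smul_mulVec, Matrix.one_mulVec]; rfl
    rw [e1]
    refine (abs_sub _ _).trans (add_le_add (hi₀ i) ?_)
    rw [abs_mul, abs_of_pos (hepos s)]
    exact mul_le_of_le_one_right (hepos s).le (abs_le_one_of_dotProduct hx i)
  have hst := hstep s hs' (s + h) ht (by linarith) (e s) (hepos s).le hs x hx _
    (add_nonneg (abs_nonneg _) (hepos s).le) hDx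
  rw [add_sub_cancel_left] at hst
  -- The error linear in the size of E(s)x is absorbed by half of the form of E(s) at x, up to
  -- O(h²). A first-order error is harmless exactly because E(s)x is small where the form of E(s) is
  -- small.
  have hcs := Matrix.PosSemidef.two_mul_abs_mulVec_le hs x i₀ (C * h)
  have hii : (E s) i₀ i₀ ≤ (E s).trace :=
    Finset.single_le_sum (f := fun i => E s i i) (fun i _ => Matrix.PosSemidef.diag_nonneg hs)
      (Finset.mem_univ i₀)
  have hqE : 0 ≤ qf (E s) x := Matrix.PosSemidef.qf_nonneg hs x
  have hq1 : qf (D s) x = qf (E s) x - e s := by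
    rw [hDE, qf_sub, qf_smul, qf_one, hx, mul_one]
  have hq2 : qf (E (s + h)) x = qf (D (s + h)) x + e (s + h) := by
    simp only [hE]; rw [qf_add, qf_smul, qf_one, hx, mul_one]
  have hexp : e s * (1 + (2 * C + 1) * h) ≤ e (s + h) := by
    have : e (s + h) = e s * Real.exp ((2 * C + 1) * h) := by
      simp only [he]; rw [mul_assoc, ← Real.exp_add]; ring_nf
    rw [this]
    refine mul_le_mul_of_nonneg_left ?_ (hepos s).le
    linarith [Real.add_one_le_exp ((2 * C + 1) * h)]
  have h4 : C * h * (C * h) * E s i₀ i₀ ≤ C * h * (C * h) * (E s).trace :=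
    mul_le_mul_of_nonneg_left hii (by positivity)
  have h5 : 0 ≤ h * (e s - h * C₃) := mul_nonneg hhpos.le (by linarith)
  have h6 : C₃ = C' + C * C * (E s).trace + 1 := rfl
  rw [h6] at h5
  rw [hq2]
  have h7 : 0 ≤ C * h * (C * h) * (E s).trace := by positivity
  nlinarith [hst, hcs, hexp, h4, h5, hq1, hqE, h7, sq_nonneg h]

end CDKF

end

noncomputable section

namespace CDKF

variable {n M : ℕ}

/-! ### Schedules -/

/-- The accumulated intensity of a sensor over `[s,t]`. -/
def acc (lam : Fin M → ℝ → ℝ) (j : Fin M) (s t : ℝ) : ℝ := ∫ u in s..t, lam j u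

lemma IsSchedule.exists_bound {T : ℝ} {lam : Fin M → ℝ → ℝ} (h : IsSchedule T lam) :
    ∃ B, 0 ≤ B ∧ ∀ᵐ t ∂(volume.restrict (Set.Icc 0 T)), ∀ j, 0 ≤ lam j t ∧ lam j t ≤ B := by
  obtain ⟨B, hB⟩ := h.bounded
  refine ⟨max B 0, le_max_right _ _, ae_all_iff.2 fun j => ?_⟩
  filter_upwards [hB j, h.nonneg j] with t h1 h2 using ⟨h2, h1.trans (le_max_left _ _)⟩

lemma IsSchedule.integrableOn {T : ℝ} {lam : Fin M → ℝ → ℝ} (h : IsSchedule T lam) (j : Fin M) :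
    IntegrableOn (lam j) (Set.Icc 0 T) := by
  obtain ⟨B, -, hB⟩ := h.exists_bound
  refine Integrable.of_bound (h.aemeasurable j).aestronglyMeasurable B ?_
  filter_upwards [hB] with t ht
  rw [Real.norm_eq_abs, abs_of_nonneg (ht j).1]; exact (ht j).2

lemma IsSchedule.intervalIntegrable {T : ℝ} {lam : Fin M → ℝ → ℝ} (h : IsSchedule T lam)
    (j : Fin M) {s t : ℝ} (hs : 0 ≤ s) (hst : s ≤ t) (ht : t ≤ T) :
    IntervalIntegrable (lam j) volume s t :=
  (intervalIntegrable_iff_integrableOn_Icc_of_le hst).2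
    ((h.integrableOn j).mono_set (Set.Icc_subset_Icc hs ht))

/-- `B` bounds the rates of the schedule almost everywhere. -/
def RateBound (T : ℝ) (lam : Fin M → ℝ → ℝ) (B : ℝ) : Prop :=
  ∀ᵐ t ∂(volume.restrict (Set.Icc 0 T)), ∀ j, 0 ≤ lam j t ∧ lam j t ≤ B

lemma RateBound.mono {T B : ℝ} {lam : Fin M → ℝ → ℝ} (h : RateBound T lam B) {s t : ℝ}
    (hs : 0 ≤ s) (ht : t ≤ T) :
    ∀ᵐ t ∂(volume.restrict (Set.Icc s t)), ∀ j, 0 ≤ lam j t ∧ lam j t ≤ B :=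
  ae_restrict_of_ae_restrict_of_subset (Set.Icc_subset_Icc hs ht) h

lemma acc_mem {T B : ℝ} {lam : Fin M → ℝ → ℝ} (h : IsSchedule T lam) (hB : RateBound T lam B)
    (j : Fin M) {s t : ℝ} (hs : 0 ≤ s) (hst : s ≤ t) (ht : t ≤ T) :
    0 ≤ acc lam j s t ∧ acc lam j s t ≤ B * (t - s) := by
  have hb := hB.mono hs ht
  have hi := h.intervalIntegrable j hs hst ht
  constructor
  · exact intervalIntegral.integral_nonneg_of_ae_restrict hst (hb.mono fun u hu => (hu j).1)
  · have := intervalIntegral.integral_mono_ae_restrict hst hi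
      (intervalIntegrable_const (c := B)) (hb.mono fun u hu => (hu j).2)
    simpa [acc, mul_comm] using this

/-! ### Carathéodory solutions of fields that are affine in the rates -/

variable {lam : Fin M → ℝ → ℝ} {f₀ : Matrix (Fin n) (Fin n) ℝ → Matrix (Fin n) (Fin n) ℝ}
  {f : Fin M → Matrix (Fin n) (Fin n) ℝ → Matrix (Fin n) (Fin n) ℝ}
  {X : ℝ → Matrix (Fin n) (Fin n) ℝ}

/-- The field `f₀ + ∑ j, λ_j f_j`. -/
def rateField (lam : Fin M → ℝ → ℝ)
    (f₀ : Matrix (Fin n) (Fin n) ℝ → Matrix (Fin n) (Fin n) ℝ)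
    (f : Fin M → Matrix (Fin n) (Fin n) ℝ → Matrix (Fin n) (Fin n) ℝ) (t : ℝ)
    (X : Matrix (Fin n) (Fin n) ℝ) : Matrix (Fin n) (Fin n) ℝ :=
  f₀ X + ∑ j, lam j t • f j X

/-- `X` is an integral curve of a time-dependent field on `[a,b]`. -/
structure IsCurve (F : ℝ → Matrix (Fin n) (Fin n) ℝ → Matrix (Fin n) (Fin n) ℝ)
    (X : ℝ → Matrix (Fin n) (Fin n) ℝ) (a b : ℝ) : Prop where
  continuousOn : ContinuousOn X (Set.Icc a b)
  integrable : MatIntegrableOn (fun u => F u (X u)) a b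
  sub_eq : ∀ s ∈ Set.Icc a b, ∀ t ∈ Set.Icc a b, s ≤ t →
    X t - X s = matInt (fun u => F u (X u)) s t

lemma IsCurve.mono {F : ℝ → Matrix (Fin n) (Fin n) ℝ → Matrix (Fin n) (Fin n) ℝ} {a b a' b' : ℝ}
    (h : IsCurve F X a b) (ha : a ≤ a') (hb : b' ≤ b) : IsCurve F X a' b' where
  continuousOn := h.continuousOn.mono (Set.Icc_subset_Icc ha hb)
  integrable := h.integrable.mono ha hb
  sub_eq s hs t ht hst := h.sub_eq s (Set.Icc_subset_Icc ha hb hs) t (Set.Icc_subset_Icc ha hb ht) hst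

lemma IsSolution.isCurve {T : ℝ} {F : ℝ → Matrix (Fin n) (Fin n) ℝ → Matrix (Fin n) (Fin n) ℝ}
    (h : IsSolution T F X) : IsCurve F X 0 T where
  continuousOn := h.continuousOn
  integrable := h.integrable
  sub_eq s hs t ht hst := by
    have hi : MatIntegrableOn (fun u => F u (X u)) 0 T := h.integrable
    rw [← matInt_split (hi.mono le_rfl ht.2) hs.1 hst, h.eq_integral t ht, h.eq_integral s hs]
    change _ = matInt _ 0 t - matInt _ 0 s
    change X 0 + matInt _ 0 t - (X 0 + matInt _ 0 s) = _
    abel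

lemma l1_rateField_le {B K t : ℝ} {Y : Matrix (Fin n) (Fin n) ℝ}
    (hB : ∀ j, 0 ≤ lam j t ∧ lam j t ≤ B) (h0 : l1 (f₀ Y) ≤ K) (h1 : ∀ j, l1 (f j Y) ≤ K) :
    l1 (rateField lam f₀ f t Y) ≤ K * (1 + M * B) := by
  refine (l1_add_le _ _).trans ?_
  have : l1 (∑ j, lam j t • f j Y) ≤ ∑ _j : Fin M, B * K := by
    refine (l1_sum_le _ _).trans (Finset.sum_le_sum fun j _ => ?_)
    rw [l1_smul, abs_of_nonneg (hB j).1]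
    exact mul_le_mul (hB j).2 (h1 j) (l1_nonneg _) ((hB j).1.trans (hB j).2)
  simp only [Finset.sum_const, Finset.card_univ, Fintype.card_fin, nsmul_eq_mul] at this
  linarith

lemma l1_rateField_sub_le {B L t r : ℝ} {Y Y' : Matrix (Fin n) (Fin n) ℝ}
    (hB : ∀ j, 0 ≤ lam j t ∧ lam j t ≤ B) (h0 : l1 (f₀ Y - f₀ Y') ≤ L * r)
    (h1 : ∀ j, l1 (f j Y - f j Y') ≤ L * r) :
    l1 (rateField lam f₀ f t Y - rateField lam f₀ f t Y') ≤ L * (1 + M * B) * r := by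
  have h := l1_rateField_le (lam := lam) (f₀ := fun _ => f₀ Y - f₀ Y')
    (f := fun j _ => f j Y - f j Y') (Y := Y) hB h0 h1
  have e : rateField lam f₀ f t Y - rateField lam f₀ f t Y' =
      rateField lam (fun _ => f₀ Y - f₀ Y') (fun j _ => f j Y - f j Y') t Y := by
    simp only [rateField, smul_sub, Finset.sum_sub_distrib]; abel
  rw [e]; linarith

lemma l1_increment_le {T B K a b : ℝ} (hB : RateBound T lam B) (ha : 0 ≤ a)
    (hb : b ≤ T) (hX : IsCurve (rateField lam f₀ f) X a b)
    (h0 : ∀ u ∈ Set.Icc a b, l1 (f₀ (X u)) ≤ K) (h1 : ∀ j, ∀ u ∈ Set.Icc a b, l1 (f j (X u)) ≤ K)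
    {s t : ℝ} (hs : s ∈ Set.Icc a b) (ht : t ∈ Set.Icc a b) (hst : s ≤ t) :
    l1 (X t - X s) ≤ K * (1 + M * B) * (t - s) := by
  rw [hX.sub_eq s hs t ht hst]
  refine l1_matInt_le_const hst (hX.integrable.mono hs.1 ht.2) ?_
  filter_upwards [hB.mono (ha.trans hs.1) (ht.2.trans hb), ae_restrict_mem measurableSet_Icc]
    with u hu hmem
  have hu' : u ∈ Set.Icc a b := ⟨hs.1.trans hmem.1, hmem.2.trans ht.2⟩
  exact l1_rateField_le hu (h0 u hu') fun j => h1 j u hu'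

/-- With the state frozen, the rates enter only through their accumulated intensities. These are
also the means of the Poisson increments, so curves and means are compared without any regularity of
the rates in time. -/
lemma matInt_rateField_const {T : ℝ} (hlam : IsSchedule T lam) (Y : Matrix (Fin n) (Fin n) ℝ)
    {s t : ℝ} (hs : 0 ≤ s) (hst : s ≤ t) (ht : t ≤ T) :
    MatIntegrableOn (fun u => rateField lam f₀ f u Y) s t ∧
    matInt (fun u => rateField lam f₀ f u Y) s t =
      (t - s) • f₀ Y + ∑ j, acc lam j s t • f j Y := by
  have hi : ∀ j, IntegrableOn (lam j) (Set.Icc s t) := fun j =>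
    (hlam.integrableOn j).mono_set (Set.Icc_subset_Icc hs ht)
  have hii : ∀ j, IntervalIntegrable (lam j) volume s t := fun j =>
    hlam.intervalIntegrable j hs hst ht
  have e : ∀ i k, (fun u => rateField lam f₀ f u Y i k) =
      fun u => f₀ Y i k + ∑ j, lam j u * f j Y i k := fun i k => by
    ext u; simp [rateField, Matrix.sum_apply]
  constructor
  · intro i k
    rw [e]
    exact (integrableOn_const (by simp)).add
      (integrable_finsetSum _ fun j _ => (hi j).mul_const _)
  · ext i k
    simp only [matInt, Matrix.of_apply, e]
    have hsum : IntervalIntegrable (fun u => ∑ j, lam j u * f j Y i k) volume s t :=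
      (intervalIntegrable_iff_integrableOn_Icc_of_le hst).2
        (integrable_finsetSum _ fun j _ => (hi j).mul_const _)
    rw [intervalIntegral.integral_add (by simp) hsum,
      intervalIntegral.integral_finsetSum fun j _ => (hii j).mul_const _]
    simp [acc, Matrix.sum_apply]

/-- The first-order expansion of a curve, with a quadratic error. -/
lemma l1_expansion_le {T B K L a b : ℝ} (hlam : IsSchedule T lam) (hB : RateBound T lam B)
    (hB0 : 0 ≤ B) (ha : 0 ≤ a)
    (hb : b ≤ T) (hX : IsCurve (rateField lam f₀ f) X a b) (hK : 0 ≤ K) (hL : 0 ≤ L)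
    (h0 : ∀ u ∈ Set.Icc a b, l1 (f₀ (X u)) ≤ K) (h1 : ∀ j, ∀ u ∈ Set.Icc a b, l1 (f j (X u)) ≤ K)
    (h2 : ∀ u ∈ Set.Icc a b, ∀ v ∈ Set.Icc a b, l1 (f₀ (X u) - f₀ (X v)) ≤ L * l1 (X u - X v))
    (h3 : ∀ j, ∀ u ∈ Set.Icc a b, ∀ v ∈ Set.Icc a b,
      l1 (f j (X u) - f j (X v)) ≤ L * l1 (X u - X v))
    {s t : ℝ} (hs : s ∈ Set.Icc a b) (ht : t ∈ Set.Icc a b) (hst : s ≤ t) :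
    l1 (X t - X s - ((t - s) • f₀ (X s) + ∑ j, acc lam j s t • f j (X s))) ≤
      L * (1 + M * B) * (K * (1 + M * B)) * (t - s) ^ 2 := by
  obtain ⟨hi, he⟩ := matInt_rateField_const (f₀ := f₀) (f := f) hlam (X s) (ha.trans hs.1) hst
    (ht.2.trans hb)
  have hXi := hX.integrable.mono hs.1 ht.2
  rw [hX.sub_eq s hs t ht hst, ← he, ← matInt_sub hst hXi hi]
  have : L * (1 + M * B) * (K * (1 + M * B)) * (t - s) ^ 2 =
      L * (1 + M * B) * (K * (1 + M * B) * (t - s)) * (t - s) := by ring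
  rw [this]
  refine l1_matInt_le_const hst (hXi.sub hi) ?_
  filter_upwards [hB.mono (ha.trans hs.1) (ht.2.trans hb), ae_restrict_mem measurableSet_Icc]
    with u hu hmem
  have hu' : u ∈ Set.Icc a b := ⟨hs.1.trans hmem.1, hmem.2.trans ht.2⟩
  have hinc := l1_increment_le hB ha hb hX h0 h1 hs hu' hmem.1
  have hle : l1 (X u - X s) ≤ K * (1 + M * B) * (t - s) := hinc.trans
    (mul_le_mul_of_nonneg_left (by linarith [hmem.2]) (by positivity))
  exact l1_rateField_sub_le hu
    ((h2 u hu' s hs).trans (mul_le_mul_of_nonneg_left hle hL))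
    fun j => (h3 j u hu' s hs).trans (mul_le_mul_of_nonneg_left hle hL)

/-- A curve that starts symmetric stays symmetric if the field commutes with transposition. -/
lemma IsCurve.transpose_eq {T B L a b : ℝ} (hB : RateBound T lam B) (hB0 : 0 ≤ B) (ha : 0 ≤ a)
    (hb : b ≤ T) (hX : IsCurve (rateField lam f₀ f) X a b) (hL : 0 ≤ L) (hXa : (X a)ᵀ = X a)
    (ht0 : ∀ Y, f₀ Yᵀ = (f₀ Y)ᵀ) (ht1 : ∀ j Y, f j Yᵀ = (f j Y)ᵀ)
    (h2 : ∀ u ∈ Set.Icc a b, l1 (f₀ (X u) - f₀ (X u)ᵀ) ≤ L * l1 (X u - (X u)ᵀ))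
    (h3 : ∀ j, ∀ u ∈ Set.Icc a b, l1 (f j (X u) - f j (X u)ᵀ) ≤ L * l1 (X u - (X u)ᵀ)) :
    ∀ t ∈ Set.Icc a b, (X t)ᵀ = X t := by
  set φ : ℝ → ℝ := fun u => l1 (X u - (X u)ᵀ)
  have hφc : ContinuousOn φ (Set.Icc a b) :=
    continuous_l1.comp_continuousOn (hX.continuousOn.sub
      (continuous_id.matrix_transpose.comp_continuousOn hX.continuousOn))
  have hT : ∀ u Y, (rateField lam f₀ f u Y)ᵀ = rateField lam f₀ f u Yᵀ := fun u Y => by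
    simp [rateField, Matrix.transpose_sum, Matrix.transpose_smul, ht0, ht1]
  intro t ht
  -- The transpose solves the same equation from the same initial value; Grönwall applied to the
  -- distance, with initial value zero, forces equality.
  have hle : φ t ≤ 0 * Real.exp (L * (1 + M * B) * (t - a)) := by
    refine gronwall_integral (by positivity) hφc.integrableOn_Icc (fun t ht => ?_) t ht
    have ha' : a ∈ Set.Icc a b := ⟨le_rfl, ht.1.trans ht.2⟩
    have h := hX.sub_eq a ha' t ht ht.1
    have hXi := hX.integrable.mono le_rfl ht.2
    have e : X t - (X t)ᵀ = matInt (fun u => rateField lam f₀ f u (X u) -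
        rateField lam f₀ f u (X u)ᵀ) a t := by
      have h' : (X t)ᵀ - (X a)ᵀ = matInt (fun u => rateField lam f₀ f u (X u)ᵀ) a t := by
        rw [← Matrix.transpose_sub, h, matInt_transpose]; simp only [hT]
      have hti := hXi.transpose
      simp only [hT] at hti
      rw [matInt_sub ht.1 hXi hti, ← h, ← h', hXa]; abel
    have hti := hXi.transpose
    simp only [hT] at hti
    simp only [φ]
    rw [zero_add, e, ← intervalIntegral.integral_const_mul]
    refine l1_matInt_le ht.1 (hXi.sub hti) ?_ ?_
    · refine IntervalIntegrable.const_mul ?_ _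
      exact (intervalIntegrable_iff_integrableOn_Icc_of_le ht.1).2
        (hφc.mono (Set.Icc_subset_Icc_right ht.2)).integrableOn_Icc
    · filter_upwards [hB.mono ha (ht.2.trans hb), ae_restrict_mem measurableSet_Icc] with u hu hmem
      have hu' : u ∈ Set.Icc a b := ⟨hmem.1, hmem.2.trans ht.2⟩
      exact l1_rateField_sub_le hu (h2 u hu') fun j => h3 j u hu'
  rw [zero_mul] at hle
  exact (sub_eq_zero.1 (eq_zero_of_l1_le_zero hle)).symm

lemma exists_l1_bound {a b : ℝ} (h : ContinuousOn X (Set.Icc a b)) :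
    ∃ c, 0 ≤ c ∧ ∀ t ∈ Set.Icc a b, l1 (X t) ≤ c := by
  obtain ⟨c, hc⟩ := isCompact_Icc.exists_bound_of_continuousOn (continuous_l1.comp_continuousOn h)
  exact ⟨max c 0, le_max_right _ _, fun t ht =>
    ((le_abs_self _).trans (hc t ht)).trans (le_max_left _ _)⟩

lemma posSemidef_of_forall_add {Y : Matrix (Fin n) (Fin n) ℝ} {c : ℝ}
    (h : ∀ ε, 0 < ε → (Y + (ε * c) • 1).PosSemidef) : Y.PosSemidef := by
  have hlim : Filter.Tendsto (fun ε : ℝ => Y + (ε * c) • (1 : Matrix (Fin n) (Fin n) ℝ))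
      (nhdsWithin 0 (Set.Ioi 0)) (nhds Y) := by
    have : Continuous fun ε : ℝ => Y + (ε * c) • (1 : Matrix (Fin n) (Fin n) ℝ) := by fun_prop
    have h0 := this.tendsto 0
    simp only [zero_mul, zero_smul, add_zero] at h0
    exact h0.mono_left nhdsWithin_le_nhds
  exact isClosed_posSemidef.mem_of_tendsto hlim (eventually_nhdsWithin_of_forall fun ε hε => h ε hε)

/-! ### The information-form field -/

namespace Model

variable (m : Model n M)

/-- The drift of the information process. -/
def infoDrift (Y : Matrix (Fin n) (Fin n) ℝ) : Matrix (Fin n) (Fin n) ℝ :=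
  -(Y * m.A) - m.Aᵀ * Y - Y * m.Q * Y

/-- The drift of the covariance process. -/
def covDrift (P : Matrix (Fin n) (Fin n) ℝ) : Matrix (Fin n) (Fin n) ℝ :=
  m.A * P + P * m.Aᵀ + m.Q

lemma infoField_eq (lam : Fin M → ℝ → ℝ) :
    m.infoField lam = rateField lam m.infoDrift (fun j _ => m.S j) := rfl

lemma covField_eq (lam : Fin M → ℝ → ℝ) :
    m.covField lam = rateField lam m.covDrift (fun j P => -m.g j P) := by
  ext t P : 2
  simp [covField, rateField, covDrift, sub_eq_add_neg]

lemma g_eq_corr (j : Fin M) : m.g j = corr (m.H j) (m.R j) := rfl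

lemma Q_transpose : m.Qᵀ = m.Q := m.Q_posSemidef.transpose_eq

lemma S_posSemidef (j : Fin M) : (m.S j).PosSemidef := by
  have := (m.R_posDef j).inv.posSemidef.conjTranspose_mul_mul_same (m.H j)
  rwa [Matrix.conjTranspose_eq_transpose_of_trivial] at this

lemma infoDrift_transpose (Y : Matrix (Fin n) (Fin n) ℝ) :
    m.infoDrift Yᵀ = (m.infoDrift Y)ᵀ := by
  simp only [infoDrift, Matrix.transpose_sub, Matrix.transpose_neg, Matrix.transpose_mul,
    Matrix.transpose_transpose, Q_transpose, Matrix.mul_assoc]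
  abel

lemma covDrift_transpose (Y : Matrix (Fin n) (Fin n) ℝ) :
    m.covDrift Yᵀ = (m.covDrift Y)ᵀ := by
  simp only [covDrift, Matrix.transpose_add, Matrix.transpose_mul,
    Matrix.transpose_transpose, Q_transpose]
  abel

lemma l1_infoDrift_le {c : ℝ} {Y : Matrix (Fin n) (Fin n) ℝ} (h : l1 Y ≤ c) :
    l1 (m.infoDrift Y) ≤ 2 * l1 m.A * c + c * l1 m.Q * c := by
  have h1 : l1 (Y * m.A) ≤ c * l1 m.A := l1_mul_le_of_le h le_rfl
  have h2 : l1 (m.Aᵀ * Y) ≤ l1 m.A * c := l1_mul_le_of_le (l1_transpose _).le h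
  have h3 : l1 (Y * m.Q * Y) ≤ c * l1 m.Q * c := l1_mul_le_of_le (l1_mul_le_of_le h le_rfl) h
  have h4 := l1_sub_le (-(Y * m.A) - m.Aᵀ * Y) (Y * m.Q * Y)
  have h5 := l1_sub_le (-(Y * m.A)) (m.Aᵀ * Y)
  rw [l1_neg] at h5
  unfold infoDrift
  linarith

lemma l1_infoDrift_sub_le {c : ℝ} {Y Y' : Matrix (Fin n) (Fin n) ℝ} (h : l1 Y ≤ c)
    (h' : l1 Y' ≤ c) :
    l1 (m.infoDrift Y - m.infoDrift Y') ≤ (2 * l1 m.A + 2 * c * l1 m.Q) * l1 (Y - Y') := by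
  have e : m.infoDrift Y - m.infoDrift Y' = -((Y - Y') * m.A) - m.Aᵀ * (Y - Y')
      - ((Y - Y') * m.Q * Y + Y' * m.Q * (Y - Y')) := by
    simp only [infoDrift, Matrix.sub_mul, Matrix.mul_sub]; abel
  have h1 : l1 ((Y - Y') * m.A) ≤ l1 (Y - Y') * l1 m.A := l1_mul_le _ _
  have h2 : l1 (m.Aᵀ * (Y - Y')) ≤ l1 m.A * l1 (Y - Y') :=
    l1_mul_le_of_le (l1_transpose _).le le_rfl
  have h3 : l1 ((Y - Y') * m.Q * Y) ≤ l1 (Y - Y') * l1 m.Q * c :=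
    l1_mul_le_of_le (l1_mul_le _ _) h
  have h3' : l1 (Y' * m.Q * (Y - Y')) ≤ c * l1 m.Q * l1 (Y - Y') :=
    l1_mul_le_of_le (l1_mul_le_of_le h' le_rfl) le_rfl
  have h4 := l1_sub_le (-((Y - Y') * m.A) - m.Aᵀ * (Y - Y'))
    ((Y - Y') * m.Q * Y + Y' * m.Q * (Y - Y'))
  have h5 := l1_sub_le (-((Y - Y') * m.A)) (m.Aᵀ * (Y - Y'))
  have h6 := l1_add_le ((Y - Y') * m.Q * Y) (Y' * m.Q * (Y - Y'))
  rw [l1_neg] at h5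
  rw [e]
  linarith

lemma l1_covDrift_le {c : ℝ} {P : Matrix (Fin n) (Fin n) ℝ} (h : l1 P ≤ c) :
    l1 (m.covDrift P) ≤ 2 * l1 m.A * c + l1 m.Q := by
  have h1 : l1 (m.A * P) ≤ l1 m.A * c := l1_mul_le_of_le le_rfl h
  have h2 : l1 (P * m.Aᵀ) ≤ c * l1 m.A := l1_mul_le_of_le h (l1_transpose _).le
  have h4 := l1_add_le (m.A * P + P * m.Aᵀ) m.Q
  have h5 := l1_add_le (m.A * P) (P * m.Aᵀ)
  unfold covDrift
  linarith

lemma l1_covDrift_sub_le (P P' : Matrix (Fin n) (Fin n) ℝ) :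
    l1 (m.covDrift P - m.covDrift P') ≤ 2 * l1 m.A * l1 (P - P') := by
  have e : m.covDrift P - m.covDrift P' = m.A * (P - P') + (P - P') * m.Aᵀ := by
    simp only [covDrift, Matrix.sub_mul, Matrix.mul_sub]; abel
  have h1 : l1 (m.A * (P - P')) ≤ l1 m.A * l1 (P - P') := l1_mul_le _ _
  have h2 : l1 ((P - P') * m.Aᵀ) ≤ l1 (P - P') * l1 m.A :=
    l1_mul_le_of_le le_rfl (l1_transpose _).le
  have h5 := l1_add_le (m.A * (P - P')) ((P - P') * m.Aᵀ)
  rw [e]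
  linarith

/-- The matrices bounded by `c` whose innovation matrices are boundedly invertible. -/
def dom (β c : ℝ) : Set (Matrix (Fin n) (Fin n) ℝ) :=
  {P | l1 P ≤ c ∧ ∀ j, IsUnit (m.H j * P * (m.H j)ᵀ + m.R j) ∧
    l1 (m.H j * P * (m.H j)ᵀ + m.R j)⁻¹ ≤ β}

/-- Allows the Lipschitz estimates to compare a curve with its transpose before symmetry is known;
`dom` requires neither symmetry nor positivity. -/
lemma transpose_mem_dom {β c : ℝ} {P : Matrix (Fin n) (Fin n) ℝ} (h : P ∈ m.dom β c) :
    Pᵀ ∈ m.dom β c := by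
  refine ⟨(l1_transpose P).le.trans h.1, fun j => ?_⟩
  have e : m.H j * Pᵀ * (m.H j)ᵀ + m.R j = (m.H j * P * (m.H j)ᵀ + m.R j)ᵀ := by
    simp only [Matrix.transpose_add, Matrix.transpose_mul, Matrix.transpose_transpose,
      (m.R_posDef j).transpose_eq, Matrix.mul_assoc]
  rw [e, ← Matrix.transpose_nonsing_inv, l1_transpose, Matrix.isUnit_transpose]
  exact (h.2 j)

lemma exists_dom_bounds (β c : ℝ) : ∃ K L, 0 ≤ K ∧ 0 ≤ L ∧
    (∀ P ∈ m.dom β c, l1 (m.covDrift P) ≤ K ∧ ∀ j, l1 (m.g j P) ≤ K) ∧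
    (∀ P ∈ m.dom β c, ∀ P' ∈ m.dom β c,
      l1 (m.covDrift P - m.covDrift P') ≤ L * l1 (P - P') ∧
      ∀ j, l1 (m.g j P - m.g j P') ≤ L * l1 (P - P')) := by
  obtain ⟨K, hK⟩ := Finite.exists_le fun j => c * l1 (m.H j) * β * l1 (m.H j) * c
  obtain ⟨L, hL⟩ := Finite.exists_le fun j => 2 * (c * l1 (m.H j) * β * l1 (m.H j)) +
    c * l1 (m.H j) * β * l1 (m.H j) * l1 (m.H j) * β * l1 (m.H j) * c
  refine ⟨max (max K (2 * l1 m.A * c + l1 m.Q)) 0, max (max L (2 * l1 m.A)) 0,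
    le_max_right _ _, le_max_right _ _, fun P hP => ⟨?_, fun j => ?_⟩,
    fun P hP P' hP' => ⟨?_, fun j => ?_⟩⟩
  · exact (m.l1_covDrift_le hP.1).trans ((le_max_right _ _).trans (le_max_left _ _))
  · exact (l1_corr_le (hP.2 j).2 hP.1).trans
      ((hK j).trans ((le_max_left _ _).trans (le_max_left _ _)))
  · exact (m.l1_covDrift_sub_le P P').trans (mul_le_mul_of_nonneg_right
      ((le_max_right _ _).trans (le_max_left _ _)) (l1_nonneg _))
  · exact (l1_corr_sub_le (hP.2 j).1 (hP'.2 j).1 (hP.2 j).2 (hP'.2 j).2 hP.1 hP'.1).trans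
      (mul_le_mul_of_nonneg_right
        ((hL j).trans ((le_max_left _ _).trans (le_max_left _ _))) (l1_nonneg _))

/-- The innovation matrices of positive semidefinite matrices are uniformly invertible. -/
lemma exists_dom : ∃ β, 0 ≤ β ∧ ∀ (P : Matrix (Fin n) (Fin n) ℝ) (c : ℝ), P.PosSemidef →
    l1 P ≤ c → P ∈ m.dom β c := by
  obtain ⟨β, hβ⟩ := Finite.exists_le fun j => (m.p j) * ((m.R j)⁻¹).trace
  exact ⟨max β 0, le_max_right _ _, fun P c hP hc => ⟨hc, fun j =>
    ⟨(innovation_posDef (m.R_posDef j) hP).isUnit, (l1_innovation_inv_le (m.R_posDef j) hP).trans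
      ((hβ j).trans (le_max_left _ _))⟩⟩⟩

/-- Near a matrix of the domain the innovation matrices remain invertible, with slightly worse
constants. This lets a positivity argument be continued past a time at which positivity is known. -/
lemma eventually_mem_dom {β c : ℝ} {P : Matrix (Fin n) (Fin n) ℝ} (hP : P ∈ m.dom β c) :
    ∀ᶠ P' in nhds P, P' ∈ m.dom (2 * β) (c + 1) := by
  have h1 : ∀ᶠ P' in nhds P, l1 P' < c + 1 :=
    continuous_l1.continuousAt.eventually (Iio_mem_nhds (hP.1.trans_lt (lt_add_one c)))
  have h2 : ∀ j, ∀ᶠ P' in nhds P, l1 ((m.H j * P' * (m.H j)ᵀ + m.R j) -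
      (m.H j * P * (m.H j)ᵀ + m.R j)) * β < 1 / 2 := fun j => by
    have hc : Continuous fun P' : Matrix (Fin n) (Fin n) ℝ =>
        l1 ((m.H j * P' * (m.H j)ᵀ + m.R j) - (m.H j * P * (m.H j)ᵀ + m.R j)) * β := by
      refine (continuous_l1.comp ?_).mul continuous_const
      fun_prop
    exact hc.continuousAt.eventually (Iio_mem_nhds (by simp [l1_zero]))
  filter_upwards [h1, Filter.eventually_all.2 h2] with P' h1 h2
  exact ⟨h1.le, fun j => isUnit_of_l1_sub_le (hP.2 j).1 (hP.2 j).2 (h2 j).le⟩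

end Model

end CDKF

end

/-! ### Positivity of covariance-form curves -/

noncomputable section

namespace CDKF

variable {n M : ℕ}

lemma abs_mulVec_le {a b : ℕ} {X : Matrix (Fin a) (Fin b) ℝ} {x : Fin b → ℝ} {r : ℝ}
    (hx : ∀ i, |x i| ≤ r) (i : Fin a) : |(X *ᵥ x) i| ≤ l1 X * r := by
  have h := abs_bilin_le (X := X) (x := Pi.single i 1) zero_le_one (fun k => by
    by_cases hk : k = i
    · subst hk; simp
    · simp [hk]) hx
  rw [single_one_dotProduct] at h
  linarith

lemma qf_mul_add_mul_transpose {X Y : Matrix (Fin n) (Fin n) ℝ} (hX : Xᵀ = X) (x : Fin n → ℝ) :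
    qf (Y * X + X * Yᵀ) x = 2 * (x ⬝ᵥ (Y *ᵥ (X *ᵥ x))) := by
  have h : qf (X * Yᵀ) x = qf (Y * X) x := by
    rw [← qf_transpose, Matrix.transpose_mul, Matrix.transpose_transpose, hX]
  rw [qf_add, h, qf, ← Matrix.mulVec_mulVec]; ring

/-- A Lyapunov term is small on x as soon as Xx is small; this is the form of error that
`comparison` tolerates. -/
lemma abs_qf_mul_add_mul_transpose_le {X Y : Matrix (Fin n) (Fin n) ℝ} (hX : Xᵀ = X)
    {x : Fin n → ℝ} (hx : x ⬝ᵥ x = 1) {η : ℝ} (hη : ∀ i, |(X *ᵥ x) i| ≤ η) :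
    |qf (Y * X + X * Yᵀ) x| ≤ 2 * l1 Y * η := by
  rw [qf_mul_add_mul_transpose hX, abs_mul, abs_two]
  have := abs_bilin_le (X := Y) zero_le_one (abs_le_one_of_dotProduct hx) hη
  linarith

lemma dotProduct_self_le {x : Fin n → ℝ} {r : ℝ} (hx : ∀ i, |x i| ≤ r) : x ⬝ᵥ x ≤ n * (r * r) := by
  refine (Finset.sum_le_sum (g := fun _ => r * r) fun i _ => ?_).trans (by simp)
  exact (le_abs_self _).trans (by
    rw [abs_mul]; exact mul_le_mul (hx i) (hx i) (abs_nonneg _) ((abs_nonneg _).trans (hx i)))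

lemma qf_ge_of_posSemidef_add {D : Matrix (Fin n) (Fin n) ℝ} {δ : ℝ}
    (h : (D + δ • 1).PosSemidef) (y : Fin n → ℝ) : -(δ * (y ⬝ᵥ y)) ≤ qf D y := by
  have := h.qf_nonneg y
  rw [qf_add, qf_smul, qf_one] at this
  linarith

namespace Model

variable (m : Model n M) {lam : Fin M → ℝ → ℝ} {X : ℝ → Matrix (Fin n) (Fin n) ℝ}

/-- For symmetric P the correction is PWP, so its form is bilinear in Px. One factor is bounded by η
and the other by c, which keeps the estimate linear in η. -/
lemma abs_qf_g_le {β c η : ℝ} {P : Matrix (Fin n) (Fin n) ℝ} (hP : P ∈ m.dom β c) (hPt : Pᵀ = P)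
    {x : Fin n → ℝ} (hx : x ⬝ᵥ x = 1) (hη0 : 0 ≤ η) (hη : ∀ i, |(P *ᵥ x) i| ≤ η) (j : Fin M) :
    |qf (m.g j P) x| ≤ c * (l1 (m.H j) * β * l1 (m.H j)) * η := by
  set W := (m.H j)ᵀ * (m.H j * P * (m.H j)ᵀ + m.R j)⁻¹ * m.H j
  have e : m.g j P = P * W * Pᵀ := by
    rw [hPt]; simp only [g, W, Matrix.mul_assoc]
  have hc : ∀ i, |(P *ᵥ x) i| ≤ c := fun i => by
    have := abs_mulVec_le (X := P) (abs_le_one_of_dotProduct hx) i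
    linarith [hP.1]
  have hW : l1 W ≤ l1 (m.H j) * β * l1 (m.H j) :=
    l1_mul_le_of_le (l1_mul_le_of_le (l1_transpose _).le (hP.2 j).2) le_rfl
  rw [e, qf_conj, hPt, qf]
  refine (abs_bilin_le hη0 hη hc).trans ?_
  have hc0 : 0 ≤ c := (l1_nonneg _).trans hP.1
  calc η * c * l1 W ≤ η * c * (l1 (m.H j) * β * l1 (m.H j)) := by gcongr
    _ = _ := by ring

/-- A covariance-form curve that stays in the domain of the field preserves positivity. -/
lemma posSemidef_of_mem_dom {T B β c a b : ℝ} (hlam : IsSchedule T lam) (hB : RateBound T lam B)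
    (hB0 : 0 ≤ B) (ha : 0 ≤ a) (hb : b ≤ T)
    (hX : IsCurve (rateField lam m.covDrift fun j P => -m.g j P) X a b)
    (hdom : ∀ u ∈ Set.Icc a b, X u ∈ m.dom β c) (hXa : (X a).PosSemidef) :
    ∀ t ∈ Set.Icc a b, (X t).PosSemidef := by
  obtain ⟨K, L, hK, hL, hK', hL'⟩ := m.exists_dom_bounds β c
  have hsym := hX.transpose_eq hB hB0 ha hb hL hXa.transpose_eq m.covDrift_transpose
    (fun j Y => by
      rw [m.g_eq_corr, corr_transpose (m.R_posDef j).transpose_eq, Matrix.transpose_neg])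
    (fun u hu => (hL' _ (hdom u hu) _ (m.transpose_mem_dom (hdom u hu))).1)
    (fun j u hu => by
      rw [neg_sub_neg, l1_sub_comm]
      exact (hL' _ (hdom u hu) _ (m.transpose_mem_dom (hdom u hu))).2 j)
  intro t ht
  have hab : a ≤ b := ht.1.trans ht.2
  have hc0 : 0 ≤ c := (l1_nonneg _).trans (hdom a ⟨le_rfl, hab⟩).1
  set γ : Fin M → ℝ := fun j => c * (l1 (m.H j) * β * l1 (m.H j)) with hγ
  have hγ0 : ∀ j, 0 ≤ γ j := fun j => by
    have hβ := (l1_nonneg _).trans ((hdom a ⟨le_rfl, hab⟩).2 j).2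
    have := l1_nonneg (m.H j)
    positivity
  -- The rate, per unit of η, at which the Lyapunov part of the drift and the corrections can lower
  -- the form of X; the noise term Q only raises it.
  set C := 2 * l1 m.A + ∑ j, B * γ j with hC
  have hC0 : 0 ≤ C := add_nonneg (mul_nonneg zero_le_two (l1_nonneg _))
    (Finset.sum_nonneg fun j _ => mul_nonneg hB0 (hγ0 j))
  refine posSemidef_of_forall_add (c := Real.exp ((2 * C + 1) * (t - a))) fun ε hε =>
    comparison (C := C) (C' := L * (1 + M * B) * (K * (1 + M * B))) hX.continuousOn hsym hC0
      (by positivity) hε (hXa.add (Matrix.PosSemidef.one.smul hε.le)) ?_ t ht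
  intro s hs t ht hst δ hδ _ x hx η hη0 hη
  have hexp := l1_expansion_le hlam hB hB0 ha hb hX hK hL (fun u hu => (hK' _ (hdom u hu)).1)
    (fun j u hu => by rw [l1_neg]; exact (hK' _ (hdom u hu)).2 j)
    (fun u hu v hv => (hL' _ (hdom u hu) _ (hdom v hv)).1)
    (fun j u hu v hv => by
      rw [neg_sub_neg, l1_sub_comm]; exact (hL' _ (hdom u hu) _ (hdom v hv)).2 j) hs ht hst.le
  have h1 := (abs_le.1 ((abs_qf_le hx).trans hexp)).1
  have h2 : -(2 * l1 m.A * η) ≤ qf (m.covDrift (X s)) x := by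
    have e := (abs_le.1 (abs_qf_mul_add_mul_transpose_le (Y := m.A) (hsym s hs) hx hη)).1
    rw [covDrift, qf_add]
    linarith [m.Q_posSemidef.qf_nonneg x]
  have h3 : ∀ j, -(B * (t - s) * (γ j * η)) ≤ acc lam j s t * qf (-m.g j (X s)) x := fun j => by
    have e := m.abs_qf_g_le (hdom s hs) (hsym s hs) hx hη0 hη j
    have e2 := acc_mem hlam hB j (ha.trans hs.1) hst.le (ht.2.trans hb)
    refine (abs_le.1 ?_).1
    rw [abs_mul, qf_neg, abs_neg, abs_of_nonneg e2.1]
    exact mul_le_mul e2.2 e (abs_nonneg _) (e2.1.trans e2.2)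
  rw [qf_sub, qf_sub, qf_add, qf_smul, qf_sum] at h1
  simp only [qf_smul] at h1
  have h4 := Finset.sum_le_sum fun j (_ : j ∈ Finset.univ) => h3 j
  have h5 : ∑ j, -(B * (t - s) * (γ j * η)) = -((∑ j, B * γ j) * (t - s) * η) := by
    rw [Finset.sum_neg_distrib, Finset.sum_mul, Finset.sum_mul]
    exact congrArg _ (Finset.sum_congr rfl fun j _ => by ring)
  have h6 := mul_le_mul_of_nonneg_left h2 (sub_nonneg.2 hst.le)
  have h7 : 0 ≤ C * (t - s) * δ := by have := sub_nonneg.2 hst.le; positivity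
  have h8 : C * (t - s) * (η + δ) = 2 * l1 m.A * η * (t - s) +
    (∑ j, B * γ j) * (t - s) * η + C * (t - s) * δ := by rw [hC]; ring
  rw [h8]
  linarith

/-- A covariance-form curve that starts positive semidefinite stays so. -/
theorem posSemidef_of_isCurve {T B : ℝ} (hlam : IsSchedule T lam) (hB : RateBound T lam B)
    (hB0 : 0 ≤ B) (hX : IsCurve (m.covField lam) X 0 T) (hX0 : (X 0).PosSemidef) :
    ∀ t ∈ Set.Icc 0 T, (X t).PosSemidef := by
  rw [m.covField_eq] at hX
  refine IsClosed.Icc_subset_of_forall_exists_gt (s := {t | (X t).PosSemidef}) ?_ hX0 ?_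
  · rw [Set.inter_comm]
    exact hX.continuousOn.preimage_isClosed_of_isClosed isClosed_Icc isClosed_posSemidef
  rintro t ⟨ht, htT⟩ y hy
  obtain ⟨β, -, hβ⟩ := m.exists_dom
  -- Right after t positivity is not yet known, but continuity keeps the curve in a domain where the
  -- field is bounded and Lipschitz. The local result then gives positivity a little further.
  have hev : ∀ᶠ u in nhdsWithin t (Set.Ici t), X u ∈ m.dom (2 * β) (l1 (X t) + 1) :=
    ((hX.continuousOn t ⟨htT.1, htT.2.le⟩).mono_of_mem_nhdsWithin
      (Filter.mem_of_superset (Icc_mem_nhdsGE htT.2)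
        (Set.Icc_subset_Icc_left htT.1))).eventually (m.eventually_mem_dom (hβ _ _ ht le_rfl))
  obtain ⟨u, hu, hsub⟩ := mem_nhdsGE_iff_exists_Icc_subset.1 hev
  have hu' : t < u := hu
  have hy' : t < y := hy
  have hb : t < min (min u y) T := lt_min (lt_min hu' hy') htT.2
  refine ⟨min (min u y) T, ?_, hb, (min_le_left _ _).trans (min_le_right _ _)⟩
  exact m.posSemidef_of_mem_dom hlam hB hB0 htT.1 (min_le_right _ _)
    (hX.mono htT.1 (min_le_right _ _)) (fun v hv => hsub ⟨hv.1, hv.2.trans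
      ((min_le_left _ _).trans (min_le_left _ _))⟩) ht _ ⟨hb.le, le_rfl⟩

/-! ### Comparison of the surrogates with sub- and supersolutions -/

/-- The linearization at `Z` of the drift of the information process. -/
def linDrift (Z Y : Matrix (Fin n) (Fin n) ℝ) : Matrix (Fin n) (Fin n) ℝ :=
  -(Y * (m.A + m.Q * Z)) - (m.A + m.Q * Z)ᵀ * Y + Z * m.Q * Z

lemma linDrift_self {Z : Matrix (Fin n) (Fin n) ℝ} (hZ : Zᵀ = Z) :
    m.linDrift Z Z = m.infoDrift Z := by
  simp only [linDrift, infoDrift, Matrix.transpose_add, Matrix.transpose_mul, hZ, Q_transpose,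
    Matrix.mul_add, Matrix.add_mul, Matrix.mul_assoc]
  abel

/-- Concavity of the Riccati drift: the gap to the tangent at Z is (Y - Z)Q(Y - Z). -/
lemma linDrift_sub_infoDrift {Z Y : Matrix (Fin n) (Fin n) ℝ} (hZ : Zᵀ = Z) (hY : Yᵀ = Y) :
    (m.linDrift Z Y - m.infoDrift Y).PosSemidef := by
  have h := m.Q_posSemidef.mul_mul_conjTranspose_same (Y - Z)
  convert h using 1
  simp only [linDrift, infoDrift, Matrix.conjTranspose_eq_transpose_of_trivial,
    Matrix.transpose_sub, Matrix.transpose_add, Matrix.transpose_mul, hZ, hY, Q_transpose,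
    Matrix.mul_add, Matrix.add_mul, Matrix.mul_sub, Matrix.sub_mul, Matrix.mul_assoc]
  abel

lemma linDrift_sub_linDrift (Z Y Y' : Matrix (Fin n) (Fin n) ℝ) :
    m.linDrift Z Y - m.linDrift Z Y' =
      -((m.A + m.Q * Z)ᵀ * (Y - Y') + (Y - Y') * (m.A + m.Q * Z)ᵀᵀ) := by
  simp only [linDrift, Matrix.transpose_transpose, Matrix.mul_sub, Matrix.sub_mul]
  abel

/-- A mean path that is a subsolution of the information-form surrogate stays below it. -/
theorem info_comparison {T B b : ℝ} (hlam : IsSchedule T lam) (hB : RateBound T lam B)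
    (hB0 : 0 ≤ B) (hX : IsCurve (m.infoField lam) X 0 T) (hX0 : (X 0)ᵀ = X 0)
    (hXb : ∀ t ∈ Set.Icc 0 T, l1 (X t) ≤ b) {Y : ℝ → Matrix (Fin n) (Fin n) ℝ}
    (hYc : ContinuousOn Y (Set.Icc 0 T)) (hYt : ∀ t ∈ Set.Icc 0 T, (Y t)ᵀ = Y t) {C' : ℝ}
    (hC' : 0 ≤ C')
    (hY : ∀ s ∈ Set.Icc 0 T, ∀ t ∈ Set.Icc 0 T, s < t → ∀ Z, Zᵀ = Z → l1 Z ≤ b → ∀ x,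
      x ⬝ᵥ x = 1 → qf (Y t) x - qf (Y s) x ≤ (t - s) * qf (m.linDrift Z (Y s)) x +
        ∑ j, acc lam j s t * qf (m.S j) x + C' * (t - s) ^ 2)
    {ε : ℝ} (hε : 0 < ε) (h0 : (X 0 - Y 0 + ε • 1).PosSemidef) :
    ∀ t ∈ Set.Icc 0 T, (X t - Y t + (ε * Real.exp
      ((2 * (2 * (l1 m.A + l1 m.Q * b)) + 1) * (t - 0))) • 1).PosSemidef := by
  intro t ht
  have hT : (0 : ℝ) ≤ T := ht.1.trans ht.2
  have hb : 0 ≤ b := (l1_nonneg _).trans (hXb 0 ⟨le_rfl, hT⟩)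
  rw [m.infoField_eq] at hX
  set L := 2 * l1 m.A + 2 * b * l1 m.Q with hL
  have hA := l1_nonneg m.A
  have hQ := l1_nonneg m.Q
  have hL0 : 0 ≤ L := by positivity
  obtain ⟨K, hK⟩ := Finite.exists_le fun j => l1 (m.S j)
  set K' := max (max K (2 * l1 m.A * b + b * l1 m.Q * b)) 0
  have hXt := hX.transpose_eq hB hB0 le_rfl le_rfl hL0 hX0 m.infoDrift_transpose
    (fun j _ => (m.S_posSemidef j).transpose_eq.symm)
    (fun u hu => m.l1_infoDrift_sub_le (hXb u hu) ((l1_transpose _).le.trans (hXb u hu)))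
    (fun j u hu => by rw [sub_self, l1_zero]; exact mul_nonneg hL0 (l1_nonneg _))
  refine comparison (D := fun t => X t - Y t) (C' := L * (1 + M * B) * (K' * (1 + M * B)) + C')
    (hX.continuousOn.sub hYc)
    (fun t ht => by rw [Matrix.transpose_sub, hXt t ht, hYt t ht]) (by positivity)
    (add_nonneg (mul_nonneg (by positivity) (mul_nonneg (le_max_right _ _) (by positivity))) hC')
    hε h0 ?_ t ht
  intro s hs t ht hst δ hδ _ x hx η hη0 hη
  have hexp := l1_expansion_le hlam hB hB0 le_rfl le_rfl hX (K := K') (le_max_right _ _) hL0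
    (fun u hu => (m.l1_infoDrift_le (hXb u hu)).trans ((le_max_right _ _).trans (le_max_left _ _)))
    (fun j u hu => (hK j).trans ((le_max_left _ _).trans (le_max_left _ _)))
    (fun u hu v hv => m.l1_infoDrift_sub_le (hXb u hu) (hXb v hv))
    (fun j u hu v hv => by rw [sub_self, l1_zero]; exact mul_nonneg hL0 (l1_nonneg _)) hs ht hst.le
  have h1 := (abs_le.1 ((abs_qf_le hx).trans hexp)).1
  -- Linearizing at the surrogate makes the tangent exact there. The terms with `S j` cancel, and
  -- the difference of the drifts is a Lyapunov term in X - Y.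
  have h2 := hY s hs t ht hst (X s) (hXt s hs) (hXb s hs) x hx
  have hDt : (X s - Y s)ᵀ = X s - Y s := by rw [Matrix.transpose_sub, hXt s hs, hYt s hs]
  have h3 : -(2 * (l1 m.A + l1 m.Q * b) * η) ≤
      qf (m.infoDrift (X s)) x - qf (m.linDrift (X s) (Y s)) x := by
    rw [← m.linDrift_self (hXt s hs), ← qf_sub, linDrift_sub_linDrift, qf_neg, neg_le_neg_iff]
    refine (le_abs_self _).trans ((abs_qf_mul_add_mul_transpose_le hDt hx hη).trans ?_)
    gcongr
    rw [l1_transpose]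
    exact (l1_add_le _ _).trans (add_le_add le_rfl (l1_mul_le_of_le le_rfl (hXb s hs)))
  rw [qf_sub, qf_sub, qf_add, qf_smul, qf_sum] at h1
  simp only [qf_smul] at h1
  have h6 := mul_le_mul_of_nonneg_left h3 (sub_nonneg.2 hst.le)
  have h7 : 0 ≤ 2 * (l1 m.A + l1 m.Q * b) * (t - s) * δ := by
    have := sub_nonneg.2 hst.le; positivity
  simp only [qf_sub]
  linarith

/-- A mean path that is a subsolution of the covariance-form surrogate stays below it. -/
theorem exists_cov_comparison {T B b : ℝ} (hlam : IsSchedule T lam) (hB : RateBound T lam B)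
    (hB0 : 0 ≤ B) : ∃ κ, 0 ≤ κ ∧ ∀ X Y : ℝ → Matrix (Fin n) (Fin n) ℝ,
    IsCurve (m.covField lam) X 0 T → (X 0).PosSemidef → (∀ t ∈ Set.Icc 0 T, l1 (X t) ≤ b) →
    ContinuousOn Y (Set.Icc 0 T) → (∀ t ∈ Set.Icc 0 T, (Y t)ᵀ = Y t) → ∀ C', 0 ≤ C' →
    (∀ s ∈ Set.Icc 0 T, ∀ t ∈ Set.Icc 0 T, s < t →
      ∀ K : (j : Fin M) → Matrix (Fin n) (Fin (m.p j)) ℝ, ∀ x, x ⬝ᵥ x = 1 →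
      qf (Y t) x - qf (Y s) x ≤ (t - s) * qf (m.covDrift (Y s)) x -
        ∑ j, acc lam j s t * qf (gainForm (m.H j) (m.R j) (K j) (Y s)) x + C' * (t - s) ^ 2) →
    ∀ ε, 0 < ε → (X 0 - Y 0 + ε • 1).PosSemidef →
    ∀ t ∈ Set.Icc 0 T, (X t - Y t + (ε * Real.exp (κ * (t - 0))) • 1).PosSemidef := by
  obtain ⟨β, hβ0, hβ⟩ := m.exists_dom
  set γ : Fin M → ℝ := fun j => |b| * l1 (m.H j) * β * l1 (m.H j) with hγ
  have hγ0 : ∀ j, 0 ≤ γ j := fun j => by have := l1_nonneg (m.H j); positivity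
  -- Here γ j bounds the gain times `H j`. The part 2γ comes from the Lyapunov terms and nγ² from
  -- the conjugation by gain times `H j`.
  set C := 2 * l1 m.A + ∑ j, B * (2 * γ j + n * (γ j * γ j)) with hC
  have hC0 : 0 ≤ C := add_nonneg (mul_nonneg zero_le_two (l1_nonneg _))
    (Finset.sum_nonneg fun j _ => mul_nonneg hB0 (by have := hγ0 j; positivity))
  -- The rate is fixed before the paths are given: in the application the mean path varies with the
  -- conditioning cell while the rate must not.
  refine ⟨2 * C + 1, by positivity, fun X Y hX hX0 hXb hYc hYt C' hC' hY ε hε h0 t ht => ?_⟩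
  have hpsd := m.posSemidef_of_isCurve hlam hB hB0 hX hX0
  rw [m.covField_eq] at hX
  obtain ⟨K, L, hK, hL, hK', hL'⟩ := m.exists_dom_bounds β b
  have hdom : ∀ u ∈ Set.Icc 0 T, X u ∈ m.dom β b := fun u hu => hβ _ _ (hpsd u hu) (hXb u hu)
  refine comparison (D := fun t => X t - Y t) (C' := L * (1 + M * B) * (K * (1 + M * B)) + C')
    (hX.continuousOn.sub hYc)
    (fun t ht => by rw [Matrix.transpose_sub, (hpsd t ht).transpose_eq, hYt t ht]) hC0
    (by positivity) hε h0 ?_ t ht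
  intro s hs t ht hst δ hδ hD x hx η hη0 hη
  have hexp := l1_expansion_le hlam hB hB0 le_rfl le_rfl hX hK hL
    (fun u hu => (hK' _ (hdom u hu)).1)
    (fun j u hu => by rw [l1_neg]; exact (hK' _ (hdom u hu)).2 j)
    (fun u hu v hv => (hL' _ (hdom u hu) _ (hdom v hv)).1)
    (fun j u hu v hv => by
      rw [neg_sub_neg, l1_sub_comm]; exact (hL' _ (hdom u hu) _ (hdom v hv)).2 j) hs ht hst.le
  have h1 := (abs_le.1 ((abs_qf_le hx).trans hexp)).1
  -- The Kalman gain of the surrogate. The affine minorant with this gain agrees with `g j` at X s,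
  -- so the two corrections differ by an expression linear in X - Y.
  set G : (j : Fin M) → Matrix (Fin n) (Fin (m.p j)) ℝ := fun j =>
    X s * (m.H j)ᵀ * (m.H j * X s * (m.H j)ᵀ + m.R j)⁻¹ with hG
  have h2 := hY s hs t ht hst G x hx
  have hDt : (X s - Y s)ᵀ = X s - Y s := by
    rw [Matrix.transpose_sub, (hpsd s hs).transpose_eq, hYt s hs]
  have h3 : -(2 * l1 m.A * η) ≤ qf (m.covDrift (X s)) x - qf (m.covDrift (Y s)) x := by
    have e : m.covDrift (X s) - m.covDrift (Y s) = m.A * (X s - Y s) + (X s - Y s) * m.Aᵀ := by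
      simp only [covDrift, Matrix.sub_mul, Matrix.mul_sub]; abel
    rw [← qf_sub, e]
    exact (abs_le.1 (abs_qf_mul_add_mul_transpose_le hDt hx hη)).1
  have h4 : ∀ j, acc lam j s t * (qf (m.g j (X s)) x -
      qf (gainForm (m.H j) (m.R j) (G j) (Y s)) x) ≤
      B * (2 * γ j + n * (γ j * γ j)) * ((t - s) * (η + δ)) := fun j => by
    have e0 := acc_mem hlam hB j hs.1 hst.le ht.2
    have hGH : l1 (G j * m.H j) ≤ γ j :=
      l1_mul_le_of_le (l1_mul_le_of_le (l1_mul_le_of_le ((hXb s hs).trans (le_abs_self b))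
        (l1_transpose _).le) ((hdom s hs).2 j).2) le_rfl
    have e : m.g j (X s) - gainForm (m.H j) (m.R j) (G j) (Y s) =
        (G j * m.H j) * (X s - Y s) + (X s - Y s) * (G j * m.H j)ᵀ -
          (G j * m.H j) * (X s - Y s) * (G j * m.H j)ᵀ := by
      rw [m.g_eq_corr, ← gainForm_optimal (m.R_posDef j) (hpsd s hs)]
      simp only [gainForm, hG, Matrix.transpose_mul, Matrix.mul_add, Matrix.add_mul,
        Matrix.mul_sub, Matrix.sub_mul, Matrix.mul_assoc]
      abel
    have e1 : qf ((G j * m.H j) * (X s - Y s) + (X s - Y s) * (G j * m.H j)ᵀ) x ≤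
        2 * γ j * η := by
      refine (le_abs_self _).trans ((abs_qf_mul_add_mul_transpose_le hDt hx hη).trans ?_)
      gcongr
    -- The conjugation term enters D with a favourable sign but is not small where Dx is small. Only
    -- the negative part of D, at most δ, can make it harmful.
    have e2 : -(δ * (n * (γ j * γ j))) ≤
        qf ((G j * m.H j) * (X s - Y s) * (G j * m.H j)ᵀ) x := by
      rw [qf_conj]
      refine le_trans ?_ (qf_ge_of_posSemidef_add hD _)
      rw [neg_le_neg_iff]
      refine mul_le_mul_of_nonneg_left (dotProduct_self_le fun i => ?_) hδ
      refine (abs_mulVec_le (abs_le_one_of_dotProduct hx) i).trans ?_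
      rw [l1_transpose, mul_one]; exact hGH
    have e3 : qf (m.g j (X s)) x - qf (gainForm (m.H j) (m.R j) (G j) (Y s)) x ≤
        (2 * γ j + n * (γ j * γ j)) * (η + δ) := by
      rw [← qf_sub, e, qf_sub]
      have h5 : 0 ≤ 2 * γ j * δ := mul_nonneg (mul_nonneg zero_le_two (hγ0 j)) hδ
      have h6 : 0 ≤ n * (γ j * γ j) * η :=
        mul_nonneg (mul_nonneg (Nat.cast_nonneg _) (mul_self_nonneg _)) hη0
      nlinarith
    have h7 : 0 ≤ (2 * γ j + n * (γ j * γ j)) * (η + δ) := by have := hγ0 j; positivity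
    calc _ ≤ acc lam j s t * ((2 * γ j + n * (γ j * γ j)) * (η + δ)) :=
          mul_le_mul_of_nonneg_left e3 e0.1
      _ ≤ B * (t - s) * ((2 * γ j + n * (γ j * γ j)) * (η + δ)) :=
          mul_le_mul_of_nonneg_right e0.2 h7
      _ = _ := by ring
  have h5 := Finset.sum_le_sum fun j (_ : j ∈ Finset.univ) => h4 j
  simp only [mul_sub, Finset.sum_sub_distrib] at h5
  rw [← Finset.sum_mul] at h5
  rw [qf_sub, qf_sub, qf_add, qf_smul, qf_sum] at h1
  simp only [qf_smul, qf_neg, mul_neg, Finset.sum_neg_distrib] at h1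
  have h6 := mul_le_mul_of_nonneg_left h3 (sub_nonneg.2 hst.le)
  have h7 : 0 ≤ 2 * l1 m.A * (t - s) * δ := by
    have := sub_nonneg.2 hst.le; have := l1_nonneg m.A; positivity
  have h8 : C * (t - s) * (η + δ) = 2 * l1 m.A * (t - s) * η + 2 * l1 m.A * (t - s) * δ +
    (∑ j, B * (2 * γ j + n * (γ j * γ j))) * ((t - s) * (η + δ)) := by rw [hC]; ring
  rw [h8]
  simp only [qf_sub]
  linarith

end Model

end CDKF

end

noncomputable section

namespace CDKF

variable {n M : ℕ}

/-- A function with left limits equal to its values and vanishing right derivatives is constant. -/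
lemma eq_of_right_deriv_zero {f : ℝ → ℝ} {T : ℝ}
    (hr : ∀ t ∈ Set.Ico 0 T, HasDerivWithinAt f 0 (Set.Ici t) t)
    (hl : ∀ t ∈ Set.Ioc 0 T, Filter.Tendsto f (nhdsWithin t (Set.Iio t)) (nhds (f t))) :
    ∀ t ∈ Set.Icc 0 T, f t = f 0 := by
  refine constant_of_has_deriv_right_zero (fun t ht => ?_) hr
  have h1 : ContinuousWithinAt f (Set.Icc 0 T ∩ Set.Iio t) t := by
    rcases ht.1.eq_or_lt with h0 | h0
    · have : Set.Icc 0 T ∩ Set.Iio t = ∅ := by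
        ext u; simp only [Set.mem_inter_iff, Set.mem_Icc, Set.mem_Iio, Set.mem_empty_iff_false,
          iff_false]; rintro ⟨⟨h1, -⟩, h2⟩; linarith
      rw [this]; simp [ContinuousWithinAt]
    · exact (hl t ⟨h0, ht.2⟩).mono_left (nhdsWithin_mono _ Set.inter_subset_right)
  have h2 : ContinuousWithinAt f (Set.Icc 0 T ∩ Set.Ici t) t := by
    rcases ht.2.eq_or_lt with h0 | h0
    · have : Set.Icc 0 T ∩ Set.Ici t ⊆ {t} := fun u hu => by
        have h1 := hu.1.2; have h2 : t ≤ u := hu.2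
        exact le_antisymm (h1.trans h0.ge) h2
      exact continuousWithinAt_singleton.mono this
    · exact (hr t ⟨ht.1, h0⟩).continuousWithinAt.mono Set.inter_subset_right
  have h3 := h1.union h2
  rwa [← Set.inter_union_distrib_left, Set.Iio_union_Ici, Set.inter_univ] at h3

/-! ### Counting paths -/

/-- A right-continuous nondecreasing path of counts with unit jumps. -/
structure CountingPath (T : ℝ) (N : ℝ → ℕ) : Prop where
  zero : N 0 = 0
  mono : MonotoneOn N (Set.Icc 0 T)
  right : ∀ t ∈ Set.Ico 0 T, ContinuousWithinAt N (Set.Ici t) t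
  unit : ∀ t ∈ Set.Ioc 0 T, N t ≤ Function.leftLim N t + 1

/-- The size of the jump of a counting path. -/
def jump (N : ℝ → ℕ) (t : ℝ) : ℝ := (N t : ℝ) - ((Function.leftLim N t : ℕ) : ℝ)

namespace CountingPath

variable {T : ℝ} {N : ℝ → ℕ}

lemma eventually_right (h : CountingPath T N) {t : ℝ} (ht : t ∈ Set.Ico 0 T) :
    ∀ᶠ s in nhdsWithin t (Set.Ici t), N s = N t :=
  (h.right t ht).tendsto.eventually ((isOpen_discrete {N t}).mem_nhds rfl)

/-- The counts before t are bounded by N T, so their supremum is attained at some s₀ < t, and by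
monotonicity the path is constant on (s₀, t). -/
lemma eventually_left (h : CountingPath T N) {t : ℝ} (ht : t ∈ Set.Ioc 0 T) :
    ∀ᶠ s in nhdsWithin t (Set.Iio t), N s = Function.leftLim N t := by
  have hbdd : BddAbove (N '' Set.Ico 0 t) := by
    refine ⟨N T, ?_⟩
    rintro _ ⟨s, hs, rfl⟩
    exact h.mono ⟨hs.1, hs.2.le.trans ht.2⟩ ⟨ht.1.le.trans ht.2, le_rfl⟩ (hs.2.le.trans ht.2)
  obtain ⟨s₀, hs₀, hk⟩ := Nat.sSup_mem (s := N '' Set.Ico 0 t) ⟨N 0, 0, ⟨le_rfl, ht.1⟩, rfl⟩ hbdd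
  have hev : ∀ᶠ s in nhdsWithin t (Set.Iio t), N s = N s₀ := by
    filter_upwards [Ioo_mem_nhdsLT hs₀.2] with s hs
    refine le_antisymm (hk ▸ le_csSup hbdd ⟨s, ⟨hs₀.1.trans hs.1.le, hs.2⟩, rfl⟩) ?_
    exact h.mono ⟨hs₀.1, hs₀.2.le.trans ht.2⟩
      ⟨hs₀.1.trans hs.1.le, hs.2.le.trans ht.2⟩ hs.1.le
  have hlim : Function.leftLim N t = N s₀ :=
    leftLim_eq_of_tendsto (tendsto_const_nhds.congr' (hev.mono fun s hs => hs.symm))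
  rw [hlim]; exact hev

lemma le_leftLim (h : CountingPath T N) {s t : ℝ} (hs : 0 ≤ s) (hst : s < t) (ht : t ≤ T) :
    N s ≤ Function.leftLim N t := by
  obtain ⟨u, hu, hu'⟩ := ((h.eventually_left ⟨hs.trans_lt hst, ht⟩).and (Ioo_mem_nhdsLT hst)).exists
  rw [← hu]
  exact h.mono ⟨hs, hst.le.trans ht⟩ ⟨hs.trans hu'.1.le, hu'.2.le.trans ht⟩ hu'.1.le

lemma leftLim_le (h : CountingPath T N) {t : ℝ} (ht : t ∈ Set.Ioc 0 T) :
    Function.leftLim N t ≤ N t := by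
  obtain ⟨u, hu, hu'⟩ := ((h.eventually_left ht).and (Ioo_mem_nhdsLT ht.1)).exists
  rw [← hu]
  exact h.mono ⟨hu'.1.le, hu'.2.le.trans ht.2⟩ ⟨ht.1.le, ht.2⟩ hu'.2.le

lemma jump_nonneg (h : CountingPath T N) {t : ℝ} (ht : t ∈ Set.Ioc 0 T) : 0 ≤ jump N t :=
  sub_nonneg.2 (Nat.cast_le.2 (h.leftLim_le ht))

/-- The set of jump times of a counting path. -/
def jumpSet (T : ℝ) (N : ℝ → ℕ) : Set ℝ := {t ∈ Set.Ioc 0 T | N t ≠ Function.leftLim N t}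

/-- The count strictly increases from one jump time to the next, so N maps the jump times
injectively into the integers up to N T. -/
lemma finite_jumpSet (h : CountingPath T N) : (jumpSet T N).Finite := by
  refine Set.Finite.of_injOn (f := N) (t := Set.Iic (N T)) (fun t ht => ?_) ?_ (Set.finite_Iic _)
  · exact h.mono ⟨ht.1.1.le, ht.1.2⟩ ⟨ht.1.1.le.trans ht.1.2, le_rfl⟩ ht.1.2
  · have key : ∀ u ∈ jumpSet T N, ∀ v ∈ jumpSet T N, u < v → N u < N v := fun u hu v hv huv =>
      (h.le_leftLim hu.1.1.le huv hv.1.2).trans_lt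
        (lt_of_le_of_ne (h.leftLim_le hv.1) hv.2.symm)
    intro u hu v hv huv
    by_contra hne
    rcases lt_or_gt_of_ne hne with hlt | hlt
    · exact absurd huv (key u hu v hv hlt).ne
    · exact absurd huv (key v hv u hu hlt).ne'

/-- The jump times of a counting path, as a finite set. -/
def jumps (h : CountingPath T N) : Finset ℝ := h.finite_jumpSet.toFinset

lemma mem_jumps (h : CountingPath T N) {t : ℝ} :
    t ∈ h.jumps ↔ t ∈ Set.Ioc 0 T ∧ N t ≠ Function.leftLim N t := by
  rw [jumps, Set.Finite.mem_toFinset]; rfl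

lemma jump_eq_zero (h : CountingPath T N) {t : ℝ} (ht : t ∈ Set.Ioc 0 T) (hJ : t ∉ h.jumps) :
    jump N t = 0 := by
  rw [h.mem_jumps] at hJ
  have : N t = Function.leftLim N t := by by_contra hne; exact hJ ⟨ht, hne⟩
  rw [jump, ← this, sub_self]

lemma jump_eq_one (h : CountingPath T N) {t : ℝ} (hJ : t ∈ h.jumps) : jump N t = 1 := by
  obtain ⟨ht, hne⟩ := h.mem_jumps.1 hJ
  have h1 := h.unit t ht
  have h2 := h.leftLim_le ht
  have h3 : N t = Function.leftLim N t + 1 := by omega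
  rw [jump, h3]; push_cast; ring

/-- Finiteness of the jump set ensures that the `finsum` is a genuine sum and not the default value
zero. -/
lemma jumpIntegral_eq (h : CountingPath T N) (F : ℝ → Matrix (Fin n) (Fin n) ℝ) {t : ℝ}
    (ht : t ≤ T) : jumpIntegral N F t = ∑ u ∈ h.jumps with u ≤ t, jump N u • F u := by
  refine finsum_mem_eq_sum_of_inter_support_eq _ ?_
  ext u
  simp only [Set.mem_inter_iff, Set.mem_Ioc, Function.mem_support, Finset.coe_filter,
    Set.mem_ofPred_eq, h.mem_jumps]
  constructor
  · rintro ⟨⟨h1, h2⟩, h3⟩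
    refine ⟨⟨⟨⟨h1, h2.trans ht⟩, fun h4 => h3 ?_⟩, h2⟩, h3⟩
    rw [← h4, sub_self, zero_smul]
  · rintro ⟨⟨⟨⟨h1, _⟩, _⟩, h2⟩, h3⟩
    exact ⟨⟨h1, h2⟩, h3⟩

end CountingPath

lemma eventually_le_iff_right (J : Finset ℝ) (t : ℝ) :
    ∀ᶠ s in nhdsWithin t (Set.Ici t), ∀ u ∈ J, (u ≤ s ↔ u ≤ t) := by
  rw [Filter.eventually_all_finset]
  intro u _
  rcases le_or_gt u t with h | h
  · filter_upwards [self_mem_nhdsWithin] with s hs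
    exact ⟨fun _ => h, fun _ => h.trans hs⟩
  · filter_upwards [Ico_mem_nhdsGE h] with s hs
    exact ⟨fun h' => absurd hs.2 (not_lt.2 h'), fun h' => absurd h (not_lt.2 h')⟩

lemma eventually_le_iff_left (J : Finset ℝ) (t : ℝ) :
    ∀ᶠ s in nhdsWithin t (Set.Iio t), ∀ u ∈ J, (u ≤ s ↔ u < t) := by
  rw [Filter.eventually_all_finset]
  intro u _
  rcases lt_or_ge u t with h | h
  · filter_upwards [Ioo_mem_nhdsLT h] with s hs
    exact ⟨fun _ => h, fun _ => hs.1.le⟩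
  · filter_upwards [self_mem_nhdsWithin] with s hs
    exact ⟨fun h' => absurd (h'.trans_lt hs) (not_lt.2 h), fun h' => absurd h' (not_lt.2 h)⟩

lemma sum_filter_le_eq {E : Type*} [AddCommGroup E] (J : Finset ℝ) (w : ℝ → E) (t : ℝ)
    (hw : t ∉ J → w t = 0) :
    ∑ u ∈ J with u ≤ t, w u = ∑ u ∈ J with u < t, w u + w t := by
  by_cases h : t ∈ J
  · have : J.filter (· ≤ t) = insert t (J.filter (· < t)) := by
      ext u
      simp only [Finset.mem_filter, Finset.mem_insert]
      constructor
      · rintro ⟨h1, h2⟩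
        rcases h2.eq_or_lt with h3 | h3
        · exact Or.inl h3
        · exact Or.inr ⟨h1, h3⟩
      · rintro (rfl | ⟨h1, h2⟩)
        · exact ⟨h, le_rfl⟩
        · exact ⟨h1, h2.le⟩
    rw [this, Finset.sum_insert (by simp), add_comm]
  · rw [hw h, add_zero]
    refine Finset.sum_congr (Finset.filter_congr fun u hu => ?_) fun _ _ => rfl
    exact ⟨fun h' => lt_of_le_of_ne h' fun e => h (e ▸ hu), le_of_lt⟩

lemma sum_filter_sub {E : Type*} [AddCommGroup E] (J : Finset ℝ) (w : ℝ → E) {s t : ℝ}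
    (hst : s ≤ t) : ∑ u ∈ J with u ≤ t, w u - ∑ u ∈ J with u ≤ s, w u =
      ∑ u ∈ J with s < u ∧ u ≤ t, w u := by
  rw [sub_eq_iff_eq_add, ← Finset.sum_union]
  · refine Finset.sum_congr ?_ fun _ _ => rfl
    ext u
    simp only [Finset.mem_filter, Finset.mem_union]
    constructor
    · rintro ⟨h1, h2⟩
      rcases lt_or_ge s u with h3 | h3
      · exact Or.inl ⟨h1, h3, h2⟩
      · exact Or.inr ⟨h1, h3⟩
    · rintro (⟨h1, _, h2⟩ | ⟨h1, h2⟩)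
      · exact ⟨h1, h2⟩
      · exact ⟨h1, h2.trans hst⟩
  · rw [Finset.disjoint_filter]
    exact fun u _ h1 h2 => absurd h1.1 (not_lt.2 h2)

namespace CountingPath

variable {T : ℝ} {N : ℝ → ℕ}

/-- The difference of the two sides is constant just to the right of every time, and its left limits
equal its values, so it is constant. -/
lemma eq_sum_jumps (h : CountingPath T N) {t : ℝ} (ht : t ∈ Set.Icc 0 T) :
    (N t : ℝ) = ∑ u ∈ h.jumps with u ≤ t, jump N u := by
  have key := eq_of_right_deriv_zero (T := T)
    (f := fun t => (N t : ℝ) - ∑ u ∈ h.jumps with u ≤ t, jump N u) ?_ ?_ t ht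
  · have h0 : (h.jumps.filter fun u => u ≤ 0) = ∅ := by
      refine Finset.filter_eq_empty_iff.2 fun u hu => not_le.2 (h.mem_jumps.1 hu).1.1
    simp only [h0, h.zero, Finset.sum_empty, Nat.cast_zero, sub_zero] at key
    linarith
  · intro t ht
    refine (hasDerivWithinAt_const t _ ((N t : ℝ) - ∑ u ∈ h.jumps with u ≤ t, jump N u)
      ).congr_of_eventuallyEq ?_ rfl
    filter_upwards [h.eventually_right ht, eventually_le_iff_right h.jumps t] with s h1 h2
    rw [h1, Finset.filter_congr h2]
  · intro t ht
    refine tendsto_const_nhds.congr' ?_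
    filter_upwards [h.eventually_left ht, eventually_le_iff_left h.jumps t] with s h1 h2
    rw [h1, Finset.filter_congr h2, sum_filter_le_eq _ _ t (h.jump_eq_zero ht)]
    simp only [jump]; ring

lemma sub_eq_sum_jumps (h : CountingPath T N) {s t : ℝ} (hs : s ∈ Set.Icc 0 T)
    (ht : t ∈ Set.Icc 0 T) (hst : s ≤ t) :
    (N t : ℝ) - N s = ∑ u ∈ h.jumps with s < u ∧ u ≤ t, jump N u := by
  rw [h.eq_sum_jumps hs, h.eq_sum_jumps ht, sum_filter_sub _ _ hst]

lemma sub_nonneg (h : CountingPath T N) {s t : ℝ} (hs : s ∈ Set.Icc 0 T)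
    (ht : t ∈ Set.Icc 0 T) (hst : s ≤ t) : 0 ≤ (N t : ℝ) - N s :=
  _root_.sub_nonneg.2 (Nat.cast_le.2 (h.mono hs ht hst))

end CountingPath

/-! ### Paths of the covariance process -/

/-- A path of the covariance process. -/
structure CovPath (m : Model n M) (T : ℝ) (N : Fin M → ℝ → ℕ)
    (P : ℝ → Matrix (Fin n) (Fin n) ℝ) : Prop where
  counting : ∀ j, CountingPath T (N j)
  posDef : ∀ t ∈ Set.Icc 0 T, (P t).PosDef
  right : ∀ t ∈ Set.Ico 0 T, ContinuousWithinAt P (Set.Ici t) t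
  left : ∀ t ∈ Set.Ioc 0 T, ∃ L, Filter.Tendsto P (nhdsWithin t (Set.Iio t)) (nhds L)
  sde : ∀ t ∈ Set.Icc 0 T, P t = P 0 + matInt (fun s => m.covDrift (P s)) 0 t -
    ∑ j, jumpIntegral (N j) (fun s => m.g j (Function.leftLim P s)) t

/-- The total number of counts in `(s,t]`. -/
def counts (N : Fin M → ℝ → ℕ) (s t : ℝ) : ℝ := ∑ j, ((N j t : ℝ) - N j s)

namespace CovPath

variable {m : Model n M} {T : ℝ} {N : Fin M → ℝ → ℕ} {P : ℝ → Matrix (Fin n) (Fin n) ℝ}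

lemma cadlagOn (h : CovPath m T N P) (i k : Fin n) : CadlagOn T fun t => P t i k where
  right t ht := (continuous_id.matrix_elem i k).continuousAt.comp_continuousWithinAt (h.right t ht)
  left t ht := by
    obtain ⟨L, hL⟩ := h.left t ht
    exact ⟨L i k, ((continuous_id.matrix_elem i k).tendsto L).comp hL⟩

lemma matIntegrableOn (h : CovPath m T N P) : MatIntegrableOn P 0 T := fun i k =>
  (h.cadlagOn i k).integrableOn

lemma drift_integrableOn (h : CovPath m T N P) :
    MatIntegrableOn (fun t => m.covDrift (P t)) 0 T :=
  ((h.matIntegrableOn.const_mul _).add (h.matIntegrableOn.mul_const _)).add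
    (matIntegrableOn_const _ _ _)

lemma tendsto_left (h : CovPath m T N P) {t : ℝ} (ht : t ∈ Set.Ioc 0 T) :
    Filter.Tendsto P (nhdsWithin t (Set.Iio t)) (nhds (Function.leftLim P t)) := by
  obtain ⟨L, hL⟩ := h.left t ht
  rwa [leftLim_eq_of_tendsto hL]

lemma leftLim_posSemidef (h : CovPath m T N P) {t : ℝ} (ht : t ∈ Set.Ioc 0 T) :
    (Function.leftLim P t).PosSemidef := by
  refine isClosed_posSemidef.mem_of_tendsto (h.tendsto_left ht) ?_
  filter_upwards [Ioo_mem_nhdsLT ht.1] with s hs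
  exact (h.posDef s ⟨hs.1.le, hs.2.le.trans ht.2⟩).posSemidef

lemma sde' (h : CovPath m T N P) {t : ℝ} (ht : t ∈ Set.Icc 0 T) :
    P t = P 0 + matInt (fun s => m.covDrift (P s)) 0 t -
      ∑ j, ∑ u ∈ (h.counting j).jumps with u ≤ t,
        jump (N j) u • m.g j (Function.leftLim P u) := by
  rw [h.sde t ht]
  congr 1
  exact Finset.sum_congr rfl fun j _ => (h.counting j).jumpIntegral_eq _ ht.2

lemma increment (h : CovPath m T N P) {s t : ℝ} (hs : s ∈ Set.Icc 0 T) (ht : t ∈ Set.Icc 0 T)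
    (hst : s ≤ t) : P t - P s = matInt (fun u => m.covDrift (P u)) s t -
      ∑ j, ∑ u ∈ (h.counting j).jumps with s < u ∧ u ≤ t,
        jump (N j) u • m.g j (Function.leftLim P u) := by
  rw [← matInt_split (h.drift_integrableOn.mono le_rfl ht.2) hs.1 hst]
  simp only [← sum_filter_sub _ _ hst, Finset.sum_sub_distrib]
  rw [h.sde' ht, h.sde' hs]
  abel

lemma mem_Ioc_of_mem_jumps (h : CovPath m T N P) {j : Fin M} {u : ℝ}
    (hu : u ∈ (h.counting j).jumps) : u ∈ Set.Ioc 0 T := ((h.counting j).mem_jumps.1 hu).1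

/-- Every measurement lowers the trace, because the correction is positive semidefinite. Only the
drift contributes to the Grönwall estimate, and the bound is independent of the counts. -/
lemma trace_le (h : CovPath m T N P) {t : ℝ} (ht : t ∈ Set.Icc 0 T) :
    (P t).trace ≤ ((P 0).trace + T * m.Q.trace) * Real.exp (2 * (l1 m.A * n) * (t - 0)) := by
  have hA := l1_nonneg m.A
  have htrQ : 0 ≤ m.Q.trace := m.Q_posSemidef.trace_nonneg
  refine gronwall_integral (f := fun t => (P t).trace) (T := T) (by positivity) ?_
    (fun t ht => ?_) t ht
  · exact integrable_finsetSum _ fun i _ => h.matIntegrableOn i i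
  have h0 : (0 : ℝ) ∈ Set.Icc 0 T := ⟨le_rfl, ht.1.trans ht.2⟩
  have hinc := congrArg Matrix.trace (h.increment h0 ht ht.1)
  have hi := h.drift_integrableOn.mono le_rfl ht.2
  rw [Matrix.trace_sub, Matrix.trace_sub, trace_matInt ht.1 hi, Matrix.trace_sum] at hinc
  have hj : 0 ≤ ∑ j, Matrix.trace (∑ u ∈ (h.counting j).jumps with 0 < u ∧ u ≤ t,
        jump (N j) u • m.g j (Function.leftLim P u)) := by
    refine Finset.sum_nonneg fun j _ => ?_
    rw [Matrix.trace_sum]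
    refine Finset.sum_nonneg fun u hu => ?_
    have hu' := h.mem_Ioc_of_mem_jumps (Finset.mem_filter.1 hu).1
    rw [Matrix.trace_smul]
    exact mul_nonneg ((h.counting j).jump_nonneg hu')
      (corr_posSemidef (m.R_posDef j) (h.leftLim_posSemidef hu')).trace_nonneg
  have hPi : IntervalIntegrable (fun u => (P u).trace) volume 0 t :=
    (intervalIntegrable_iff_integrableOn_Icc_of_le ht.1).2
      (integrable_finsetSum _ fun i _ => (h.matIntegrableOn.mono le_rfl ht.2) i i)
  have hbound : ∫ u in (0 : ℝ)..t, (m.covDrift (P u)).trace ≤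
      ∫ u in (0 : ℝ)..t, (2 * (l1 m.A * n) * (P u).trace + m.Q.trace) := by
    refine intervalIntegral.integral_mono_on ht.1 ?_ ?_ fun u hu => ?_
    · exact (intervalIntegrable_iff_integrableOn_Icc_of_le ht.1).2
        (integrable_finsetSum _ fun i _ => hi i i)
    · exact (hPi.const_mul _).add (by simp)
    · have hP := (h.posDef u ⟨hu.1, hu.2.trans ht.2⟩).posSemidef
      have e : (P u * m.Aᵀ).trace = (m.A * P u).trace := by
        rw [← Matrix.trace_transpose, Matrix.transpose_mul, Matrix.transpose_transpose,
          hP.transpose_eq]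
      have e2 : (m.A * P u).trace ≤ l1 m.A * (n * (P u).trace) :=
        (trace_le_l1 _).trans (l1_mul_le_of_le le_rfl hP.l1_le_trace)
      rw [Model.covDrift, Matrix.trace_add, Matrix.trace_add, e]
      linarith
  rw [intervalIntegral.integral_add (hPi.const_mul _) (by simp),
    intervalIntegral.integral_const_mul] at hbound
  simp only [intervalIntegral.integral_const, smul_eq_mul, sub_zero] at hbound
  have hmono := mul_le_mul_of_nonneg_right ht.2 htrQ
  linarith

end CovPath

namespace Model

variable (m : Model n M)

/-- A bound for the covariance paths in terms of a bound for the initial value. -/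
lemma exists_covPath_bound (T c₀ : ℝ) : ∃ c, 0 ≤ c ∧ ∀ (N : Fin M → ℝ → ℕ)
    (P : ℝ → Matrix (Fin n) (Fin n) ℝ), CovPath m T N P → l1 (P 0) ≤ c₀ →
    ∀ t ∈ Set.Icc 0 T, l1 (P t) ≤ c := by
  refine ⟨|n * ((c₀ + T * m.Q.trace) * Real.exp (2 * (l1 m.A * n) * T))|, abs_nonneg _,
    fun N P h hc t ht => le_trans ?_ (le_abs_self _)⟩
  have hA := l1_nonneg m.A
  have htrQ : 0 ≤ m.Q.trace := m.Q_posSemidef.trace_nonneg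
  have hT := ht.1.trans ht.2
  have hP0 := (h.posDef 0 ⟨le_rfl, hT⟩).posSemidef.trace_nonneg
  refine (h.posDef t ht).posSemidef.l1_le_trace.trans ?_
  refine mul_le_mul_of_nonneg_left ((h.trace_le ht).trans ?_) (Nat.cast_nonneg _)
  have hTQ := mul_nonneg hT htrQ
  refine mul_le_mul (by linarith [trace_le_l1 (P 0)]) ?_ (Real.exp_pos _).le
    (by linarith [trace_le_l1 (P 0)])
  rw [sub_zero]
  gcongr
  exact ht.2

/-- The increments of a covariance path, and their expansion with an error that is quadratic
in the mean. -/
lemma exists_covPath_expansion (T c₀ : ℝ) : ∃ C, 0 ≤ C ∧ ∀ (N : Fin M → ℝ → ℕ)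
    (P : ℝ → Matrix (Fin n) (Fin n) ℝ), CovPath m T N P → l1 (P 0) ≤ c₀ →
    ∀ s ∈ Set.Icc 0 T, ∀ t ∈ Set.Icc 0 T, s ≤ t →
    l1 (P t - P s) ≤ C * ((t - s) + counts N s t) ∧
    l1 (P t - P s - ((t - s) • m.covDrift (P s) - ∑ j, ((N j t : ℝ) - N j s) • m.g j (P s))) ≤
      C * ((t - s) ^ 2 + (t - s) * counts N s t + counts N s t * (counts N s t - 1)) := by
  obtain ⟨c, hc0, hc⟩ := m.exists_covPath_bound T c₀
  obtain ⟨β, hβ0, hβ⟩ := m.exists_dom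
  obtain ⟨K, L, hK, hL, hK', hL'⟩ := m.exists_dom_bounds β c
  -- K serves the increment bound. In the expansion the drift and the jumps each contribute L K (t -
  -- s) times the counts, hence the factor 2.
  refine ⟨max K (2 * L * K), le_max_of_le_left hK, fun N P h hP0 => ?_⟩
  have hcP := hc N P h hP0
  have hdom : ∀ t ∈ Set.Icc 0 T, P t ∈ m.dom β c := fun t ht =>
    hβ _ _ (h.posDef t ht).posSemidef (hcP t ht)
  have hdoml : ∀ t ∈ Set.Ioc 0 T, Function.leftLim P t ∈ m.dom β c := fun t ht => by
    refine hβ _ _ (h.leftLim_posSemidef ht) ?_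
    refine le_of_tendsto ((continuous_l1.tendsto _).comp (h.tendsto_left ht)) ?_
    filter_upwards [Ioo_mem_nhdsLT ht.1] with s hs
    exact hcP s ⟨hs.1.le, hs.2.le.trans ht.2⟩
  have hcounts : ∀ s ∈ Set.Icc 0 T, ∀ t ∈ Set.Icc 0 T, s ≤ t → 0 ≤ counts N s t :=
    fun s hs t ht hst => Finset.sum_nonneg fun j _ => (h.counting j).sub_nonneg hs ht hst
  have hinc : ∀ s ∈ Set.Icc 0 T, ∀ t ∈ Set.Icc 0 T, s ≤ t →
      l1 (P t - P s) ≤ K * ((t - s) + counts N s t) := fun s hs t ht hst => by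
    rw [h.increment hs ht hst]
    have h1 : l1 (matInt (fun u => m.covDrift (P u)) s t) ≤ K * (t - s) := by
      refine l1_matInt_le_const hst (h.drift_integrableOn.mono hs.1 ht.2) ?_
      refine (ae_restrict_iff' measurableSet_Icc).2 (Filter.Eventually.of_forall fun u hu => ?_)
      exact (hK' _ (hdom u ⟨hs.1.trans hu.1, hu.2.trans ht.2⟩)).1
    have h2 : l1 (∑ j, ∑ u ∈ (h.counting j).jumps with s < u ∧ u ≤ t,
        jump (N j) u • m.g j (Function.leftLim P u)) ≤ K * counts N s t := by
      rw [counts, Finset.mul_sum]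
      refine (l1_sum_le _ _).trans (Finset.sum_le_sum fun j _ => ?_)
      rw [(h.counting j).sub_eq_sum_jumps hs ht hst, Finset.mul_sum]
      refine (l1_sum_le _ _).trans (Finset.sum_le_sum fun u hu => ?_)
      have hu' := h.mem_Ioc_of_mem_jumps (Finset.mem_filter.1 hu).1
      have hj := (h.counting j).jump_nonneg hu'
      rw [l1_smul, abs_of_nonneg hj, mul_comm]
      exact mul_le_mul_of_nonneg_right ((hK' _ (hdoml u hu')).2 j) hj
    have := l1_sub_le (matInt (fun u => m.covDrift (P u)) s t)
      (∑ j, ∑ u ∈ (h.counting j).jumps with s < u ∧ u ≤ t,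
        jump (N j) u • m.g j (Function.leftLim P u))
    linarith
  intro s hs t ht hst
  have hΔ := hcounts s hs t ht hst
  have hh : 0 ≤ t - s := sub_nonneg.2 hst
  refine ⟨(hinc s hs t ht hst).trans (mul_le_mul_of_nonneg_right (le_max_left _ _)
    (by positivity)), ?_⟩
  -- The jump at u is itself not yet counted before u, so the left limit has seen at most the counts
  -- minus one. The jump error becomes counts·(counts - 1), whose Poisson mean is of second order;
  -- the mean of counts² would be of first order.
  have hleft : ∀ j, ∀ u ∈ (h.counting j).jumps, s < u → u ≤ t →
      l1 (Function.leftLim P u - P s) ≤ K * ((t - s) + (counts N s t - 1)) := by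
    intro j u hu hsu hut
    have hu' := h.mem_Ioc_of_mem_jumps hu
    have hev : ∀ᶠ r in nhdsWithin u (Set.Iio u),
        l1 (P r - P s) ≤ K * ((t - s) + (counts N s t - 1)) := by
      filter_upwards [(h.counting j).eventually_left hu', Ioo_mem_nhdsLT hsu] with r hr hr'
      have hrI : r ∈ Set.Icc 0 T := ⟨hs.1.trans hr'.1.le, hr'.2.le.trans hu'.2⟩
      refine (hinc s hs r hrI hr'.1.le).trans (mul_le_mul_of_nonneg_left ?_ hK)
      have hrt : r ≤ t := hr'.2.le.trans hut
      have h1 : counts N s r ≤ counts N s t - 1 := by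
        have h2 : counts N s t - counts N s r = ∑ i, ((N i t : ℝ) - N i r) := by
          simp only [counts, ← Finset.sum_sub_distrib]
          exact Finset.sum_congr rfl fun i _ => by ring
        have h3 : (N j t : ℝ) - N j r ≤ ∑ i, ((N i t : ℝ) - N i r) :=
          Finset.single_le_sum (f := fun i => (N i t : ℝ) - N i r)
            (fun i _ => (h.counting i).sub_nonneg hrI ht hrt) (Finset.mem_univ j)
        have h4 : (N j r : ℝ) + 1 ≤ N j t := by
          have h5 := (h.counting j).jump_eq_one hu
          have h6 : (N j u : ℝ) ≤ N j t :=
            Nat.cast_le.2 ((h.counting j).mono ⟨hu'.1.le, hu'.2⟩ ht hut)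
          rw [jump, ← hr] at h5
          linarith
        linarith
      linarith
    refine le_of_tendsto ((continuous_l1.tendsto _).comp ((h.tendsto_left hu').sub_const _)) hev
  have hi := h.drift_integrableOn.mono hs.1 ht.2
  -- The error splits into the variation of the drift along the path and that of the corrections
  -- between s and the left limits at the jumps.
  have e : P t - P s - ((t - s) • m.covDrift (P s) - ∑ j, ((N j t : ℝ) - N j s) • m.g j (P s)) =
      matInt (fun u => m.covDrift (P u) - m.covDrift (P s)) s t -
      ∑ j, ∑ u ∈ (h.counting j).jumps with s < u ∧ u ≤ t,
        jump (N j) u • (m.g j (Function.leftLim P u) - m.g j (P s)) := by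
    have hN : ∑ j, ((N j t : ℝ) - N j s) • m.g j (P s) =
        ∑ j, (∑ u ∈ (h.counting j).jumps with s < u ∧ u ≤ t, jump (N j) u) • m.g j (P s) :=
      Finset.sum_congr rfl fun j _ => by rw [(h.counting j).sub_eq_sum_jumps hs ht hst]
    rw [matInt_sub hst hi (matIntegrableOn_const _ _ _), matInt_const, h.increment hs ht hst, hN]
    simp only [smul_sub, Finset.sum_sub_distrib, ← Finset.sum_smul]
    abel
  have h1 : l1 (matInt (fun u => m.covDrift (P u) - m.covDrift (P s)) s t) ≤
      L * (K * ((t - s) + counts N s t)) * (t - s) := by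
    refine l1_matInt_le_const hst (hi.sub (matIntegrableOn_const _ _ _)) ?_
    refine (ae_restrict_iff' measurableSet_Icc).2 (Filter.Eventually.of_forall fun u hu => ?_)
    have hu' : u ∈ Set.Icc 0 T := ⟨hs.1.trans hu.1, hu.2.trans ht.2⟩
    refine ((hL' _ (hdom u hu') _ (hdom s hs)).1).trans (mul_le_mul_of_nonneg_left ?_ hL)
    refine (hinc s hs u hu' hu.1).trans (mul_le_mul_of_nonneg_left ?_ hK)
    refine add_le_add (by linarith [hu.2]) (Finset.sum_le_sum fun j _ => ?_)
    have := (h.counting j).sub_nonneg hu' ht hu.2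
    linarith
  have h2 : l1 (∑ j, ∑ u ∈ (h.counting j).jumps with s < u ∧ u ≤ t,
      jump (N j) u • (m.g j (Function.leftLim P u) - m.g j (P s))) ≤
      L * (K * ((t - s) + (counts N s t - 1))) * counts N s t := by
    conv_rhs => rw [counts]
    rw [Finset.mul_sum]
    refine (l1_sum_le _ _).trans (Finset.sum_le_sum fun j _ => ?_)
    rw [(h.counting j).sub_eq_sum_jumps hs ht hst, Finset.mul_sum]
    refine (l1_sum_le _ _).trans (Finset.sum_le_sum fun u hu => ?_)
    obtain ⟨hu, hsu, hut⟩ := Finset.mem_filter.1 hu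
    have hu' := h.mem_Ioc_of_mem_jumps hu
    have hj := (h.counting j).jump_nonneg hu'
    rw [l1_smul, abs_of_nonneg hj, mul_comm]
    refine mul_le_mul_of_nonneg_right ?_ hj
    exact ((hL' _ (hdoml u hu') _ (hdom s hs)).2 j).trans
      (mul_le_mul_of_nonneg_left (hleft j u hu hsu hut) hL)
  -- Integrality matters: k(k - 1) is negative for real k strictly between 0 and 1.
  have h3 : 0 ≤ counts N s t * (counts N s t - 1) := by
    obtain ⟨k, hk⟩ : ∃ k : ℕ, counts N s t = k := by
      refine ⟨∑ j, (N j t - N j s), ?_⟩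
      rw [counts, Nat.cast_sum]
      exact Finset.sum_congr rfl fun j _ => (Nat.cast_sub ((h.counting j).mono hs ht hst)).symm
    rw [hk]
    rcases k with _ | k
    · simp
    · push_cast; simp only [add_sub_cancel_right]; positivity
  rw [e]
  refine (l1_sub_le _ _).trans ((add_le_add h1 h2).trans ?_)
  have h4 : 2 * L * K * ((t - s) ^ 2 + (t - s) * counts N s t +
      counts N s t * (counts N s t - 1)) ≤ max K (2 * L * K) * ((t - s) ^ 2 +
      (t - s) * counts N s t + counts N s t * (counts N s t - 1)) :=
    mul_le_mul_of_nonneg_right (le_max_right _ _) (by positivity)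
  have h5 : 0 ≤ L * K * (t - s) ^ 2 := by positivity
  have h6 : 0 ≤ L * K * (counts N s t * (counts N s t - 1)) := mul_nonneg (by positivity) h3
  nlinarith

end Model

end CDKF

end

/-! ### Paths of the information process -/

noncomputable section

namespace CDKF

variable {n M : ℕ}

lemma tendsto_matrix_inv {ι : Type*} {l : Filter ι} {F : ι → Matrix (Fin n) (Fin n) ℝ}
    {P : Matrix (Fin n) (Fin n) ℝ} (hP : P.PosDef) (hF : Filter.Tendsto F l (nhds P)) :
    Filter.Tendsto (fun u => (F u)⁻¹) l (nhds P⁻¹) := by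
  simp only [Matrix.inv_def, Ring.inverse_eq_inv']
  have hd : Filter.Tendsto (fun u => (F u).det) l (nhds P.det) :=
    ((continuous_id.matrix_det).tendsto P).comp hF
  have ha : Filter.Tendsto (fun u => (F u).adjugate) l (nhds P.adjugate) :=
    ((continuous_id.matrix_adjugate).tendsto P).comp hF
  exact (hd.inv₀ hP.det_pos.ne').smul ha

lemma tendsto_matrix {ι : Type*} {l : Filter ι} {F : ι → Matrix (Fin n) (Fin n) ℝ}
    {P : Matrix (Fin n) (Fin n) ℝ}
    (h : ∀ i k, Filter.Tendsto (fun u => F u i k) l (nhds (P i k))) :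
    Filter.Tendsto F l (nhds P) :=
  tendsto_pi_nhds.2 fun i => tendsto_pi_nhds.2 fun k => h i k

lemma tendsto_entry {ι : Type*} {l : Filter ι} {F : ι → Matrix (Fin n) (Fin n) ℝ}
    {P : Matrix (Fin n) (Fin n) ℝ} (h : Filter.Tendsto F l (nhds P)) (i k : Fin n) :
    Filter.Tendsto (fun u => F u i k) l (nhds (P i k)) :=
  ((continuous_id.matrix_elem i k).tendsto P).comp h

namespace CovPath

variable {m : Model n M} {T : ℝ} {N : Fin M → ℝ → ℕ} {P : ℝ → Matrix (Fin n) (Fin n) ℝ}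

lemma eq_leftLim_sub (h : CovPath m T N P) {t : ℝ} (ht : t ∈ Set.Ioc 0 T) :
    P t = Function.leftLim P t - ∑ j, jump (N j) t • m.g j (Function.leftLim P t) := by
  have hI : Filter.Tendsto (fun s => matInt (fun u => m.covDrift (P u)) 0 s)
      (nhdsWithin t (Set.Iio t)) (nhds (matInt (fun u => m.covDrift (P u)) 0 t)) := by
    refine tendsto_matrix fun i k => ?_
    refine ((integral_primitive_continuousOn (h.drift_integrableOn i k)) t
      ⟨ht.1.le, ht.2⟩).mono_left ?_
    rw [nhdsWithin_le_iff]
    exact Filter.mem_of_superset (Ioo_mem_nhdsLT ht.1) fun s hs => ⟨hs.1.le, hs.2.le.trans ht.2⟩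
  have hlim : Function.leftLim P t = P 0 + matInt (fun s => m.covDrift (P s)) 0 t -
      ∑ j, ∑ u ∈ (h.counting j).jumps with u < t,
        jump (N j) u • m.g j (Function.leftLim P u) := by
    refine tendsto_nhds_unique (h.tendsto_left ht)
      (((hI.const_add (P 0)).sub_const (∑ j, ∑ u ∈ (h.counting j).jumps with u < t,
        jump (N j) u • m.g j (Function.leftLim P u))).congr' ?_)
    filter_upwards [Ioo_mem_nhdsLT ht.1, Filter.eventually_all.2 fun j =>
      eventually_le_iff_left (h.counting j).jumps t] with s hs hs'
    rw [h.sde' ⟨hs.1.le, hs.2.le.trans ht.2⟩]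
    congr 1
    exact Finset.sum_congr rfl fun j _ => by rw [Finset.filter_congr (hs' j)]
  have hP := h.sde' ⟨ht.1.le, ht.2⟩
  rw [Finset.sum_congr rfl fun j _ => sum_filter_le_eq (h.counting j).jumps
    (fun u => jump (N j) u • m.g j (Function.leftLim P u)) t
    fun hJ => by rw [(h.counting j).jump_eq_zero ht hJ, zero_smul]] at hP
  rw [hP, Finset.sum_add_distrib, ← sub_sub, ← hlim]

/-- At most one sensor jumps at a time. -/
def NoCommonJumps (h : CovPath m T N P) : Prop :=
  ∀ i j, i ≠ j → ∀ t, t ∈ (h.counting i).jumps → t ∉ (h.counting j).jumps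

/-- With at most one sensor jumping, the jump subtracts a single correction and Woodbury applies.
Simultaneous corrections would all be evaluated at the same left limit, and the information gains
would not simply add. -/
lemma inv_jump (h : CovPath m T N P) (hs : h.NoCommonJumps) {t : ℝ} (ht : t ∈ Set.Ioc 0 T) :
    (Function.leftLim P t).PosDef ∧
    (P t)⁻¹ = (Function.leftLim P t)⁻¹ + ∑ j, jump (N j) t • m.S j := by
  have hP := h.eq_leftLim_sub ht
  have hpd := h.posDef t ⟨ht.1.le, ht.2⟩
  by_cases hj : ∃ j, t ∈ (h.counting j).jumps
  · obtain ⟨j, hj⟩ := hj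
    have h0 : ∀ i, i ≠ j → jump (N i) t = 0 := fun i hi =>
      (h.counting i).jump_eq_zero ht (hs j i hi.symm t hj)
    have hsum : ∀ F : Fin M → Matrix (Fin n) (Fin n) ℝ, ∑ i, jump (N i) t • F i = F j := fun F => by
      rw [Finset.sum_eq_single j (fun i _ hi => by rw [h0 i hi, zero_smul]) (by simp),
        (h.counting j).jump_eq_one hj, one_smul]
    rw [hsum] at hP
    rw [hsum, hP]
    rw [hP] at hpd
    have hl := posDef_of_sub_corr (m.R_posDef j) (h.leftLim_posSemidef ht) hpd
    exact ⟨hl, inv_sub_corr (m.R_posDef j) hl⟩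
  · push Not at hj
    have hsum : ∀ F : Fin M → Matrix (Fin n) (Fin n) ℝ, ∑ i, jump (N i) t • F i = 0 := fun F =>
      Finset.sum_eq_zero fun i _ => by rw [(h.counting i).jump_eq_zero ht (hj i), zero_smul]
    rw [hsum, sub_zero] at hP
    rw [hsum, add_zero, ← hP]
    exact ⟨hpd, rfl⟩

lemma inv_cadlagOn (h : CovPath m T N P) (hs : h.NoCommonJumps) (i k : Fin n) :
    CadlagOn T fun t => (P t)⁻¹ i k where
  right t ht := tendsto_entry (tendsto_matrix_inv (h.posDef t ⟨ht.1, ht.2.le⟩) (h.right t ht)) i k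
  left _ ht := ⟨_, tendsto_entry (tendsto_matrix_inv (h.inv_jump hs ht).1 (h.tendsto_left ht)) i k⟩

lemma infoDrift_cadlagOn (h : CovPath m T N P) (hs : h.NoCommonJumps) (i k : Fin n) :
    CadlagOn T fun t => m.infoDrift (P t)⁻¹ i k := by
  have hc : Continuous m.infoDrift := by unfold Model.infoDrift; fun_prop
  constructor
  · intro t ht
    exact tendsto_entry ((hc.tendsto _).comp
      (tendsto_matrix_inv (h.posDef t ⟨ht.1, ht.2.le⟩) (h.right t ht))) i k
  · intro t ht
    exact ⟨_, tendsto_entry ((hc.tendsto _).comp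
      (tendsto_matrix_inv (h.inv_jump hs ht).1 (h.tendsto_left ht))) i k⟩

lemma infoDrift_integrableOn (h : CovPath m T N P) (hs : h.NoCommonJumps) :
    MatIntegrableOn (fun t => m.infoDrift (P t)⁻¹) 0 T := fun i k =>
  (h.infoDrift_cadlagOn hs i k).integrableOn

lemma inv_mul_covDrift_mul_inv {X : Matrix (Fin n) (Fin n) ℝ} (hX : X.PosDef) :
    X⁻¹ * m.covDrift X * X⁻¹ = -m.infoDrift X⁻¹ := by
  have hu : IsUnit X.det := (Matrix.isUnit_iff_isUnit_det X).1 hX.isUnit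
  have h1 : X⁻¹ * (m.A * X) * X⁻¹ = X⁻¹ * m.A := by
    rw [Matrix.mul_assoc, Matrix.mul_assoc, Matrix.mul_nonsing_inv _ hu, Matrix.mul_one]
  have h2 : X⁻¹ * (X * m.Aᵀ) * X⁻¹ = m.Aᵀ * X⁻¹ := by
    rw [← Matrix.mul_assoc, Matrix.nonsing_inv_mul _ hu, Matrix.one_mul]
  simp only [Model.covDrift, Model.infoDrift, Matrix.mul_add, Matrix.add_mul, h1, h2]
  abel

/-- No jump occurs immediately after t, so P has right derivative `covDrift`. The identity P_u⁻¹ -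
P_t⁻¹ = -P_u⁻¹(P_u - P_t)P_t⁻¹ carries it over to the inverse. -/
lemma hasDerivWithinAt_inv (h : CovPath m T N P) {t : ℝ} (ht : t ∈ Set.Ico 0 T) (i k : Fin n) :
    HasDerivWithinAt (fun u => (P u)⁻¹ i k) (m.infoDrift (P t)⁻¹ i k) (Set.Ici t) t := by
  have htI : t ∈ Set.Icc 0 T := ⟨ht.1, ht.2.le⟩
  have hle : nhdsWithin t (Set.Ici t \ {t}) ≤ nhdsWithin t (Set.Ici t) :=
    nhdsWithin_mono _ Set.sdiff_subset
  have hslope : Filter.Tendsto (fun u => (u - t)⁻¹ • (P u - P t)) (nhdsWithin t (Set.Ici t \ {t}))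
      (nhds (m.covDrift (P t))) := by
    refine tendsto_matrix fun i k => ?_
    have hd := hasDerivWithinAt_integral_of_right ((h.drift_integrableOn.mono le_rfl le_rfl) i k) ht
      (by
        have hc : Continuous m.covDrift := by unfold Model.covDrift; fun_prop
        exact tendsto_entry ((hc.tendsto _).comp (h.right t ht)) i k)
    refine (hasDerivWithinAt_iff_tendsto_slope.1 hd).congr' ?_
    filter_upwards [hle (Filter.eventually_all.2 fun j =>
      eventually_le_iff_right (h.counting j).jumps t), hle (Ico_mem_nhdsGE ht.2)] with u hu hu'
    have huI : u ∈ Set.Icc 0 T := ⟨ht.1.trans hu'.1, hu'.2.le⟩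
    have e : P u - P t = matInt (fun u => m.covDrift (P u)) 0 u -
        matInt (fun u => m.covDrift (P u)) 0 t := by
      rw [h.sde' huI, h.sde' htI]
      simp only [fun j => Finset.filter_congr (hu j)]
      abel
    rw [slope_def_module, e]; rfl
  have hY : Filter.Tendsto (fun u => (P u)⁻¹) (nhdsWithin t (Set.Ici t \ {t})) (nhds (P t)⁻¹) :=
    (tendsto_matrix_inv (h.posDef t htI) (h.right t ht)).mono_left hle
  have hlim := ((hY.mul hslope).mul_const (P t)⁻¹).neg
  rw [inv_mul_covDrift_mul_inv (h.posDef t htI), neg_neg] at hlim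
  rw [hasDerivWithinAt_iff_tendsto_slope]
  refine (tendsto_entry hlim i k).congr' ?_
  filter_upwards [hle (Ico_mem_nhdsGE ht.2)] with u hu'
  have huI : u ∈ Set.Icc 0 T := ⟨ht.1.trans hu'.1, hu'.2.le⟩
  have hu1 : IsUnit (P u).det := (Matrix.isUnit_iff_isUnit_det _).1 (h.posDef u huI).isUnit
  have hu2 : IsUnit (P t).det := (Matrix.isUnit_iff_isUnit_det _).1 (h.posDef t htI).isUnit
  have e : -((P u)⁻¹ * ((u - t)⁻¹ • (P u - P t)) * (P t)⁻¹) =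
      (u - t)⁻¹ • ((P u)⁻¹ - (P t)⁻¹) := by
    rw [Matrix.mul_smul, Matrix.smul_mul, Matrix.mul_sub, Matrix.sub_mul,
      Matrix.nonsing_inv_mul _ hu1, Matrix.one_mul, Matrix.mul_assoc, Matrix.mul_nonsing_inv _ hu2,
      Matrix.mul_one, ← smul_neg, neg_sub]
  rw [e, slope_def_module]; rfl

/-- The equation of the information process. -/
lemma info_increment (h : CovPath m T N P) (hsim : h.NoCommonJumps) {s t : ℝ}
    (hs : s ∈ Set.Icc 0 T) (ht : t ∈ Set.Icc 0 T) (hst : s ≤ t) :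
    (P t)⁻¹ - (P s)⁻¹ = matInt (fun u => m.infoDrift (P u)⁻¹) s t +
      ∑ j, ((N j t : ℝ) - N j s) • m.S j := by
  have hint := h.infoDrift_integrableOn hsim
  -- Information minus accumulated gains minus integrated drift has zero right derivative, and by
  -- `inv_jump` it does not jump, so it is constant.
  have key : ∀ t ∈ Set.Icc 0 T, ∀ i k, (P t)⁻¹ i k - ∑ j, (N j t : ℝ) * m.S j i k -
      ∫ u in (0 : ℝ)..t, m.infoDrift (P u)⁻¹ i k = (P 0)⁻¹ i k := by
    intro t ht i k
    have := eq_of_right_deriv_zero (T := T) (f := fun t => (P t)⁻¹ i k -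
      ∑ j, (N j t : ℝ) * m.S j i k - ∫ u in (0 : ℝ)..t, m.infoDrift (P u)⁻¹ i k) ?_ ?_ t ht
    · simpa [fun j => (h.counting j).zero] using this
    · intro t ht
      have hN : HasDerivWithinAt (fun t => ∑ j, (N j t : ℝ) * m.S j i k) 0 (Set.Ici t) t := by
        refine (hasDerivWithinAt_const t _ (∑ j, (N j t : ℝ) * m.S j i k)).congr_of_eventuallyEq
          ?_ rfl
        filter_upwards [Filter.eventually_all.2 fun j => (h.counting j).eventually_right ht] with s hs
        simp only [hs]
      have := ((h.hasDerivWithinAt_inv ht i k).sub hN).sub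
        (hasDerivWithinAt_integral_of_right (hint i k) ht ((h.infoDrift_cadlagOn hsim i k).right t ht))
      exact this.congr_deriv (by ring)
    · intro t ht
      have hN : Filter.Tendsto (fun t => ∑ j, (N j t : ℝ) * m.S j i k) (nhdsWithin t (Set.Iio t))
          (nhds (∑ j, ((Function.leftLim (N j) t : ℕ) : ℝ) * m.S j i k)) := by
        refine tendsto_const_nhds.congr' ?_
        filter_upwards [Filter.eventually_all.2 fun j => (h.counting j).eventually_left ht] with s hs
        simp only [hs]
      have hI : Filter.Tendsto (fun t => ∫ u in (0 : ℝ)..t, m.infoDrift (P u)⁻¹ i k)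
          (nhdsWithin t (Set.Iio t)) (nhds (∫ u in (0 : ℝ)..t, m.infoDrift (P u)⁻¹ i k)) := by
        refine ((integral_primitive_continuousOn (hint i k)) t ⟨ht.1.le, ht.2⟩).mono_left ?_
        rw [nhdsWithin_le_iff]
        exact Filter.mem_of_superset (Ioo_mem_nhdsLT ht.1)
          fun s hs => ⟨hs.1.le, hs.2.le.trans ht.2⟩
      have hj := h.inv_jump hsim ht
      have hlim := ((tendsto_entry (tendsto_matrix_inv hj.1 (h.tendsto_left ht)) i k).sub hN).sub hI
      convert hlim using 2
      rw [hj.2]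
      simp only [Matrix.add_apply, Matrix.sum_apply, Matrix.smul_apply, smul_eq_mul, jump, sub_mul,
        Finset.sum_sub_distrib]
      ring
  rw [← matInt_split (hint.mono le_rfl ht.2) hs.1 hst]
  ext i k
  have h1 := key t ht i k
  have h2 := key s hs i k
  simp only [Matrix.add_apply, Matrix.sub_apply, Matrix.sum_apply, Matrix.smul_apply, smul_eq_mul,
    sub_mul, Finset.sum_sub_distrib, matInt, Matrix.of_apply]
  linarith

end CovPath

namespace Model

variable (m : Model n M)

/-- A bound for the information paths in terms of a bound for the initial value and of the
number of measurements. -/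
lemma exists_infoPath_bound (T c₀ : ℝ) : ∃ c, 0 ≤ c ∧ ∀ (N : Fin M → ℝ → ℕ)
    (P : ℝ → Matrix (Fin n) (Fin n) ℝ) (h : CovPath m T N P), h.NoCommonJumps → l1 (P 0)⁻¹ ≤ c₀ →
    ∀ t ∈ Set.Icc 0 T, l1 (P t)⁻¹ ≤ c * (1 + counts N 0 T) := by
  obtain ⟨σ, hσ⟩ := Finite.exists_le fun j => (m.S j).trace
  have hA := l1_nonneg m.A
  set ρ := Real.exp (2 * (l1 m.A * n) * T) with hρ
  have hρ0 : 0 < ρ := Real.exp_pos _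
  refine ⟨n * ((|c₀| + |σ|) * ρ), by positivity, fun N P h hsim hc t ht => ?_⟩
  have hT := ht.1.trans ht.2
  have h0 : (0 : ℝ) ∈ Set.Icc 0 T := ⟨le_rfl, hT⟩
  have hTI : T ∈ Set.Icc 0 T := ⟨hT, le_rfl⟩
  have hcount : 0 ≤ counts N 0 T :=
    Finset.sum_nonneg fun j _ => (h.counting j).sub_nonneg h0 hTI hT
  have hYi : MatIntegrableOn (fun u => (P u)⁻¹) 0 T := fun i k => (h.inv_cadlagOn hsim i k).integrableOn
  -- The quadratic term -YQY has nonpositive trace, so despite the Riccati drift the trace grows at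
  -- most linearly in itself, plus a bounded gain for each measurement.
  have htr : (P t)⁻¹.trace ≤ (|c₀| + |σ| * counts N 0 T) *
      Real.exp (2 * (l1 m.A * n) * (t - 0)) := by
    refine gronwall_integral (f := fun t => (P t)⁻¹.trace) (T := T) (by positivity) ?_
      (fun t ht => ?_) t ht
    · exact integrable_finsetSum _ fun i _ => hYi i i
    have hinc := congrArg Matrix.trace (h.info_increment hsim h0 ht ht.1)
    have hi := (h.infoDrift_integrableOn hsim).mono le_rfl ht.2
    rw [Matrix.trace_sub, Matrix.trace_add, trace_matInt ht.1 hi, Matrix.trace_sum] at hinc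
    have hj : ∑ j, (((N j t : ℝ) - N j 0) • m.S j).trace ≤ |σ| * counts N 0 T := by
      rw [counts, Finset.mul_sum]
      refine Finset.sum_le_sum fun j _ => ?_
      rw [Matrix.trace_smul, smul_eq_mul, mul_comm]
      have h1 := (h.counting j).sub_nonneg h0 ht ht.1
      have h2 := (h.counting j).sub_nonneg ht hTI ht.2
      exact mul_le_mul ((hσ j).trans (le_abs_self _)) (by linarith) h1 (abs_nonneg _)
    have hPi : IntervalIntegrable (fun u => (P u)⁻¹.trace) volume 0 t :=
      (intervalIntegrable_iff_integrableOn_Icc_of_le ht.1).2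
        (integrable_finsetSum _ fun i _ => (hYi.mono le_rfl ht.2) i i)
    have hbound : ∫ u in (0 : ℝ)..t, (m.infoDrift (P u)⁻¹).trace ≤
        ∫ u in (0 : ℝ)..t, 2 * (l1 m.A * n) * (P u)⁻¹.trace := by
      refine intervalIntegral.integral_mono_on ht.1 ?_ (hPi.const_mul _) fun u hu => ?_
      · exact (intervalIntegrable_iff_integrableOn_Icc_of_le ht.1).2
          (integrable_finsetSum _ fun i _ => hi i i)
      · have hY := (h.posDef u ⟨hu.1, hu.2.trans ht.2⟩).inv.posSemidef
        have e : (m.Aᵀ * (P u)⁻¹).trace = ((P u)⁻¹ * m.A).trace := by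
          rw [← Matrix.trace_transpose, Matrix.transpose_mul, Matrix.transpose_transpose,
            hY.transpose_eq]
        have e2 : -((P u)⁻¹ * m.A).trace ≤ n * (P u)⁻¹.trace * l1 m.A := by
          rw [← Matrix.trace_neg]
          refine (trace_le_l1 _).trans ?_
          rw [l1_neg]
          exact l1_mul_le_of_le hY.l1_le_trace le_rfl
        have e3 : 0 ≤ ((P u)⁻¹ * m.Q * (P u)⁻¹).trace := by
          have := m.Q_posSemidef.mul_mul_conjTranspose_same (P u)⁻¹
          rw [Matrix.conjTranspose_eq_transpose_of_trivial, hY.transpose_eq] at this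
          exact this.trace_nonneg
        rw [Model.infoDrift, Matrix.trace_sub, Matrix.trace_sub, Matrix.trace_neg, e]
        linarith
    rw [intervalIntegral.integral_const_mul] at hbound
    have := (trace_le_l1 (P 0)⁻¹).trans (hc.trans (le_abs_self _))
    linarith
  refine (h.posDef t ht).inv.posSemidef.l1_le_trace.trans ?_
  rw [mul_assoc]
  refine mul_le_mul_of_nonneg_left (htr.trans ?_) (Nat.cast_nonneg _)
  have h1 : Real.exp (2 * (l1 m.A * n) * (t - 0)) ≤ ρ := by
    rw [hρ, sub_zero]; gcongr; exact ht.2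
  have h2 : |c₀| + |σ| * counts N 0 T ≤ (|c₀| + |σ|) * (1 + counts N 0 T) := by
    have := mul_nonneg (abs_nonneg c₀) hcount
    have := abs_nonneg σ
    nlinarith
  calc _ ≤ (|c₀| + |σ|) * (1 + counts N 0 T) * ρ :=
        mul_le_mul h2 h1 (Real.exp_pos _).le (by positivity)
    _ = _ := by ring

/-- The increments of an information path and an upper bound for them that is linear in the path,
with an error that is quadratic in the mean. -/
lemma exists_infoPath_expansion (T c₀ b : ℝ) : ∃ C, 0 ≤ C ∧ ∀ (N : Fin M → ℝ → ℕ)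
    (P : ℝ → Matrix (Fin n) (Fin n) ℝ) (h : CovPath m T N P), h.NoCommonJumps → l1 (P 0)⁻¹ ≤ c₀ →
    ∀ s ∈ Set.Icc 0 T, ∀ t ∈ Set.Icc 0 T, s ≤ t →
    l1 ((P t)⁻¹ - (P s)⁻¹) ≤ C * ((t - s) * (1 + counts N 0 T) ^ 2 + counts N s t) ∧
    ∀ Z, Zᵀ = Z → l1 Z ≤ b → ∀ x, x ⬝ᵥ x = 1 →
      qf (P t)⁻¹ x - qf (P s)⁻¹ x ≤ (t - s) * qf (m.linDrift Z (P s)⁻¹) x +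
        ∑ j, ((N j t : ℝ) - N j s) * qf (m.S j) x +
        C * ((t - s) ^ 2 * (1 + counts N 0 T) ^ 2 + (t - s) * counts N s t) := by
  obtain ⟨c, hc0, hc⟩ := m.exists_infoPath_bound T c₀
  obtain ⟨σ, hσ⟩ := Finite.exists_le fun j => l1 (m.S j)
  have hA := l1_nonneg m.A
  have hQ := l1_nonneg m.Q
  set C₁ := 2 * l1 m.A * c + c * l1 m.Q * c + |σ| with hC₁
  have hC₁0 : 0 ≤ C₁ := by positivity
  set γ := 2 * (l1 m.A + l1 m.Q * |b|) with hγ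
  have hγ0 : 0 ≤ γ := by positivity
  refine ⟨max C₁ (γ * C₁), le_max_of_le_left hC₁0, fun N P h hsim hP0 => ?_⟩
  have hcP := hc N P h hsim hP0
  have hinc : ∀ s ∈ Set.Icc 0 T, ∀ t ∈ Set.Icc 0 T, s ≤ t →
      l1 ((P t)⁻¹ - (P s)⁻¹) ≤ C₁ * ((t - s) * (1 + counts N 0 T) ^ 2 + counts N s t) :=
    fun s hs t ht hst => by
    have hT := ht.1.trans ht.2
    have hcount : 0 ≤ counts N 0 T :=
      Finset.sum_nonneg fun j _ => (h.counting j).sub_nonneg ⟨le_rfl, hT⟩ ⟨hT, le_rfl⟩ hT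
    have hst0 : 0 ≤ t - s := sub_nonneg.2 hst
    have hcst : 0 ≤ counts N s t :=
      Finset.sum_nonneg fun j _ => (h.counting j).sub_nonneg hs ht hst
    rw [h.info_increment hsim hs ht hst]
    have h1 : l1 (matInt (fun u => m.infoDrift (P u)⁻¹) s t) ≤
        (2 * l1 m.A * c + c * l1 m.Q * c) * (1 + counts N 0 T) ^ 2 * (t - s) := by
      refine l1_matInt_le_const hst ((h.infoDrift_integrableOn hsim).mono hs.1 ht.2) ?_
      refine (ae_restrict_iff' measurableSet_Icc).2 (Filter.Eventually.of_forall fun u hu => ?_)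
      refine (m.l1_infoDrift_le (hcP u ⟨hs.1.trans hu.1, hu.2.trans ht.2⟩)).trans ?_
      -- The drift is quadratic in a path of size c(1 + counts); its linear part is raised to the
      -- same square since 1 + counts ≥ 1.
      have : 0 ≤ 2 * l1 m.A * c * ((1 + counts N 0 T) * counts N 0 T) := by positivity
      nlinarith
    have h2 : l1 (∑ j, ((N j t : ℝ) - N j s) • m.S j) ≤ |σ| * counts N s t := by
      rw [counts, Finset.mul_sum]
      refine (l1_sum_le _ _).trans (Finset.sum_le_sum fun j _ => ?_)
      have hj := (h.counting j).sub_nonneg hs ht hst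
      rw [l1_smul, abs_of_nonneg hj, mul_comm]
      exact mul_le_mul_of_nonneg_right ((hσ j).trans (le_abs_self _)) hj
    refine (l1_add_le _ _).trans ((add_le_add h1 h2).trans ?_)
    have h3 : 0 ≤ |σ| * ((t - s) * (1 + counts N 0 T) ^ 2) := by positivity
    have h4 : 0 ≤ (2 * l1 m.A * c + c * l1 m.Q * c) * counts N s t := by positivity
    rw [hC₁]; linarith
  intro s hs t ht hst
  have hT := ht.1.trans ht.2
  have hcount : 0 ≤ counts N 0 T :=
    Finset.sum_nonneg fun j _ => (h.counting j).sub_nonneg ⟨le_rfl, hT⟩ ⟨hT, le_rfl⟩ hT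
  have hst0 : 0 ≤ t - s := sub_nonneg.2 hst
  have hcst : 0 ≤ counts N s t :=
    Finset.sum_nonneg fun j _ => (h.counting j).sub_nonneg hs ht hst
  refine ⟨(hinc s hs t ht hst).trans (mul_le_mul_of_nonneg_right (le_max_left _ _)
    (by positivity)), fun Z hZ hZb x hx => ?_⟩
  have hi := (h.infoDrift_integrableOn hsim).mono hs.1 ht.2
  have hq := congrArg (fun X => qf X x) (h.info_increment hsim hs ht hst)
  simp only [qf_sub, qf_add, qf_sum, qf_smul] at hq
  rw [qf_matInt hst hi] at hq
  -- The drift is replaced by its tangent at Z before the state is frozen at s. The Lipschitz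
  -- constant γ of the tangent is deterministic, whereas that of the quadratic drift would grow with
  -- the random size of the path.
  have hle : ∫ u in s..t, qf (m.infoDrift (P u)⁻¹) x ≤ ∫ _u in s..t,
      (qf (m.linDrift Z (P s)⁻¹) x +
        γ * (C₁ * ((t - s) * (1 + counts N 0 T) ^ 2 + counts N s t))) := by
    refine intervalIntegral.integral_mono_on hst ?_ (by simp) fun u hu => ?_
    · refine (intervalIntegrable_iff_integrableOn_Icc_of_le hst).2 ?_
      simp only [qf_eq_sum]
      exact integrable_finsetSum _ fun i _ => integrable_finsetSum _ fun k _ =>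
        ((hi i k).const_mul _).mul_const _
    · have hu' : u ∈ Set.Icc 0 T := ⟨hs.1.trans hu.1, hu.2.trans ht.2⟩
      have e1 := (m.linDrift_sub_infoDrift hZ (h.posDef u hu').inv.transpose_eq).qf_nonneg x
      have e2 : |qf (m.linDrift Z (P u)⁻¹ - m.linDrift Z (P s)⁻¹) x| ≤
          γ * l1 ((P u)⁻¹ - (P s)⁻¹) := by
        rw [m.linDrift_sub_linDrift, qf_neg, abs_neg]
        have hsym : ((P u)⁻¹ - (P s)⁻¹)ᵀ = (P u)⁻¹ - (P s)⁻¹ := by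
          rw [Matrix.transpose_sub, (h.posDef u hu').inv.transpose_eq,
            (h.posDef s hs).inv.transpose_eq]
        refine (abs_qf_mul_add_mul_transpose_le hsym hx
          (abs_mulVec_le (abs_le_one_of_dotProduct hx))).trans ?_
        rw [l1_transpose, mul_one]
        refine mul_le_mul_of_nonneg_right ?_ (l1_nonneg _)
        refine mul_le_mul_of_nonneg_left ((l1_add_le _ _).trans ?_) zero_le_two
        exact add_le_add le_rfl (l1_mul_le_of_le le_rfl (hZb.trans (le_abs_self _)))
      have e3 : l1 ((P u)⁻¹ - (P s)⁻¹) ≤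
          C₁ * ((t - s) * (1 + counts N 0 T) ^ 2 + counts N s t) := by
        refine (hinc s hs u hu' hu.1).trans (mul_le_mul_of_nonneg_left ?_ hC₁0)
        refine add_le_add (mul_le_mul_of_nonneg_right (by linarith [hu.2]) (sq_nonneg _))
          (Finset.sum_le_sum fun j _ => ?_)
        have := (h.counting j).sub_nonneg hu' ht hu.2
        linarith
      have e4 := mul_le_mul_of_nonneg_left e3 hγ0
      rw [qf_sub] at e1 e2
      linarith [(abs_le.1 e2).2]
  rw [intervalIntegral.integral_const, smul_eq_mul] at hle
  have hmax : γ * C₁ * ((t - s) ^ 2 * (1 + counts N 0 T) ^ 2 + (t - s) * counts N s t) ≤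
      max C₁ (γ * C₁) * ((t - s) ^ 2 * (1 + counts N 0 T) ^ 2 + (t - s) * counts N s t) :=
    mul_le_mul_of_nonneg_right (le_max_right _ _) (by positivity)
  have e : (t - s) * (γ * (C₁ * ((t - s) * (1 + counts N 0 T) ^ 2 + counts N s t))) =
    γ * C₁ * ((t - s) ^ 2 * (1 + counts N 0 T) ^ 2 + (t - s) * counts N s t) := by ring
  linarith

end Model

end CDKF

end

noncomputable section

namespace CDKF

variable {n M : ℕ}

/-! ### Moments of Poisson variables -/

/-- Index shift: the factor k cancels against the factorial and releases one factor r. -/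
lemma hasSum_poisson_mul (r : ℝ≥0) :
    HasSum (fun k : ℕ => Real.exp (-r) * r ^ k / k.factorial * (k : ℝ)) r := by
  have h := (hasSum_one_poissonMeasure r).mul_left (r : ℝ)
  rw [mul_one] at h
  rw [← hasSum_nat_add_iff' 1]
  simp only [Finset.range_one, Finset.sum_singleton, Nat.cast_zero, mul_zero, sub_zero]
  have e : ∀ k : ℕ, Real.exp (-r) * (r : ℝ) ^ (k + 1) / ((k + 1).factorial : ℝ) * ((k + 1 : ℕ) : ℝ) =
      r * (Real.exp (-r) * (r : ℝ) ^ k / (k.factorial : ℝ)) := fun k => by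
    rw [Nat.factorial_succ]
    have : (k.factorial : ℝ) ≠ 0 := Nat.cast_ne_zero.2 k.factorial_ne_zero
    push_cast
    field_simp
    ring
  simp only [e]
  exact h

lemma hasSum_poisson_sq (r : ℝ≥0) :
    HasSum (fun k : ℕ => Real.exp (-r) * r ^ k / k.factorial * (k : ℝ) ^ 2) (r + r ^ 2) := by
  have h := ((hasSum_poisson_mul r).mul_left (r : ℝ)).add
    ((hasSum_one_poissonMeasure r).mul_left (r : ℝ))
  rw [← hasSum_nat_add_iff' 1]
  simp only [Finset.range_one, Finset.sum_singleton, Nat.cast_zero, mul_zero, sub_zero,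
    ne_eq, OfNat.ofNat_ne_zero, not_false_eq_true, zero_pow]
  have e : ∀ k : ℕ, Real.exp (-r) * (r : ℝ) ^ (k + 1) / ((k + 1).factorial : ℝ) *
      ((k + 1 : ℕ) : ℝ) ^ 2 = r * (Real.exp (-r) * (r : ℝ) ^ k / (k.factorial : ℝ) * (k : ℝ)) +
        r * (Real.exp (-r) * (r : ℝ) ^ k / (k.factorial : ℝ)) := fun k => by
    rw [Nat.factorial_succ]
    have : (k.factorial : ℝ) ≠ 0 := Nat.cast_ne_zero.2 k.factorial_ne_zero
    push_cast
    field_simp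
    ring
  rw [show (r : ℝ) * r + r * 1 = r + r ^ 2 by ring] at h
  simp only [e]
  exact h

variable {Ω : Type*} {mΩ : MeasurableSpace Ω} {μ : Measure Ω}

lemma poisson_moments {X : Ω → ℕ} (hX : Measurable X) {r : ℝ≥0}
    (h : μ.map X = poissonMeasure r) :
    Integrable (fun ω => (X ω : ℝ)) μ ∧ Integrable (fun ω => (X ω : ℝ) ^ 2) μ ∧
    ∫ ω, (X ω : ℝ) ∂μ = r ∧ ∫ ω, (X ω : ℝ) ^ 2 ∂μ = r + r ^ 2 := by
  have i1 : Integrable (fun k : ℕ => (k : ℝ)) (poissonMeasure r) := by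
    rw [integrable_poissonMeasure_iff]
    simpa using (hasSum_poisson_mul r).summable
  have i2 : Integrable (fun k : ℕ => (k : ℝ) ^ 2) (poissonMeasure r) := by
    rw [integrable_poissonMeasure_iff]
    simpa using (hasSum_poisson_sq r).summable
  have m : ∀ f : ℕ → ℝ, ∀ ν : Measure ℕ, AEStronglyMeasurable f ν := fun f ν =>
    (measurable_from_top).aestronglyMeasurable
  have e : ∀ f : ℕ → ℝ, ∫ ω, f (X ω) ∂μ = ∫ k, f k ∂(poissonMeasure r) := fun f => by
    rw [← h, integral_map hX.aemeasurable (m f _)]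
  refine ⟨?_, ?_, ?_, ?_⟩
  · rw [← h] at i1; exact (integrable_map_measure (m _ _) hX.aemeasurable).1 i1
  · rw [← h] at i2; exact (integrable_map_measure (m _ _) hX.aemeasurable).1 i2
  · rw [e fun k => (k : ℝ)]
    exact (hasSum_integral_poissonMeasure i1).unique (by simpa using hasSum_poisson_mul r)
  · rw [e fun k => (k : ℝ) ^ 2]
    exact (hasSum_integral_poissonMeasure i2).unique (by simpa using hasSum_poisson_sq r)

namespace IsPoissonFamily

variable {T : ℝ} {lam : Fin M → ℝ → ℝ} {ℱ : Filtration ℝ mΩ} {N : Fin M → ℝ → Ω → ℕ}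

lemma ae_countingPath (hN : IsPoissonFamily T lam ℱ μ N) :
    ∀ᵐ ω ∂μ, ∀ j, CountingPath T fun t => N j t ω := by
  filter_upwards [hN.paths] with ω hω j
  obtain ⟨h1, h2, h3, h4⟩ := hω j
  exact ⟨h1, h2, h3, h4⟩

lemma measurable (hN : IsPoissonFamily T lam ℱ μ N) (j : Fin M) {t : ℝ} (ht : t ∈ Set.Icc 0 T) :
    Measurable (N j t) := (hN.adapted j t ht).mono (ℱ.le t) le_rfl

/-- Subtraction of natural numbers truncates at zero; it agrees with real subtraction because the
paths are nondecreasing. -/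
lemma ae_cast_sub (hN : IsPoissonFamily T lam ℱ μ N) (j : Fin M) {s t : ℝ} (hs : s ∈ Set.Icc 0 T)
    (ht : t ∈ Set.Icc 0 T) (hst : s ≤ t) :
    (fun ω => (N j t ω : ℝ) - N j s ω) =ᵐ[μ] fun ω => ((N j t ω - N j s ω : ℕ) : ℝ) := by
  filter_upwards [hN.ae_countingPath] with ω hω
  exact (Nat.cast_sub ((hω j).mono hs ht hst)).symm

lemma moments (hN : IsPoissonFamily T lam ℱ μ N) (hlam : IsSchedule T lam) (j : Fin M) {s t : ℝ}
    (hs : s ∈ Set.Icc 0 T) (ht : t ∈ Set.Icc 0 T) (hst : s ≤ t) :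
    Integrable (fun ω => (N j t ω : ℝ) - N j s ω) μ ∧
    Integrable (fun ω => ((N j t ω : ℝ) - N j s ω) ^ 2) μ ∧
    ∫ ω, ((N j t ω : ℝ) - N j s ω) ∂μ = acc lam j s t ∧
    ∫ ω, ((N j t ω : ℝ) - N j s ω) ^ 2 ∂μ = acc lam j s t + acc lam j s t ^ 2 := by
  have hae := hN.ae_cast_sub j hs ht hst
  have hae2 : (fun ω => ((N j t ω : ℝ) - N j s ω) ^ 2) =ᵐ[μ]
      fun ω => ((N j t ω - N j s ω : ℕ) : ℝ) ^ 2 := hae.mono fun ω h => by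
    simp only at h ⊢; rw [h]
  obtain ⟨B, hB0, hB⟩ := hlam.exists_bound
  have hacc := (acc_mem hlam hB j hs.1 hst ht.2).1
  have h := poisson_moments ((hN.measurable j ht).sub (hN.measurable j hs)) (hN.law j s hs t ht hst)
  have e : ((∫ u in s..t, lam j u).toNNReal : ℝ) = acc lam j s t := Real.coe_toNNReal _ hacc
  rw [e] at h
  obtain ⟨h1, h2, h3, h4⟩ := h
  exact ⟨h1.congr hae.symm, h2.congr hae2.symm, (integral_congr_ae hae).trans h3,
    (integral_congr_ae hae2).trans h4⟩

lemma indepFun_sub (hN : IsPoissonFamily T lam ℱ μ N) {i j : Fin M} (hij : i ≠ j) {s t : ℝ}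
    (hs : s ∈ Set.Icc 0 T) (ht : t ∈ Set.Icc 0 T) (hst : s ≤ t) :
    IndepFun (fun ω => (N i t ω : ℝ) - N i s ω) (fun ω => (N j t ω : ℝ) - N j s ω) μ := by
  have h := ((hN.indep s hs t ht hst).indepFun hij).comp (φ := fun k : ℕ => (k : ℝ))
    (ψ := fun k : ℕ => (k : ℝ)) measurable_from_top measurable_from_top
  exact h.congr (hN.ae_cast_sub i hs ht hst).symm (hN.ae_cast_sub j hs ht hst).symm

/-- The product of the increments of two sensors, including the case of equal sensors. -/
lemma integral_mul_sub (hN : IsPoissonFamily T lam ℱ μ N) (hlam : IsSchedule T lam) (i j : Fin M)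
    {s t : ℝ} (hs : s ∈ Set.Icc 0 T) (ht : t ∈ Set.Icc 0 T) (hst : s ≤ t) :
    Integrable (fun ω => ((N i t ω : ℝ) - N i s ω) * ((N j t ω : ℝ) - N j s ω)) μ ∧
    ∫ ω, ((N i t ω : ℝ) - N i s ω) * ((N j t ω : ℝ) - N j s ω) ∂μ =
      (if i = j then acc lam i s t else 0) + acc lam i s t * acc lam j s t := by
  have hi := hN.moments hlam i hs ht hst
  have hj := hN.moments hlam j hs ht hst
  by_cases hij : i = j
  · subst hij
    simp only [← sq, if_true]
    exact ⟨hi.2.1, hi.2.2.2⟩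
  · have hind := hN.indepFun_sub hij hs ht hst
    refine ⟨hind.integrable_mul hi.1 hj.1, ?_⟩
    rw [hind.integral_fun_mul_eq_mul_integral hi.1.aestronglyMeasurable hj.1.aestronglyMeasurable,
      hi.2.2.1, hj.2.2.1, if_neg hij, zero_add]

/-- Increments are independent of the past. -/
lemma integral_sub_mul (hN : IsPoissonFamily T lam ℱ μ N) (hlam : IsSchedule T lam) (j : Fin M)
    {s t : ℝ} (hs : s ∈ Set.Icc 0 T) (ht : t ∈ Set.Icc 0 T) (hst : s ≤ t) {φ : Ω → ℝ}
    (hφ : Measurable[ℱ s] φ) (hφi : Integrable φ μ) :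
    Integrable (fun ω => ((N j t ω : ℝ) - N j s ω) * φ ω) μ ∧
    ∫ ω, ((N j t ω : ℝ) - N j s ω) * φ ω ∂μ = acc lam j s t * ∫ ω, φ ω ∂μ := by
  have hj := hN.moments hlam j hs ht hst
  have hind0 : IndepFun (fun ω => N j t ω - N j s ω) φ μ := by
    rw [IndepFun_iff_Indep]
    refine indep_of_indep_of_le_right (indep_of_indep_of_le_left (hN.indep_past s hs t ht hst) ?_)
      hφ.comap_le
    exact le_iSup (fun j => MeasurableSpace.comap (fun ω => N j t ω - N j s ω) ⊤) j
  have hind : IndepFun (fun ω => (N j t ω : ℝ) - N j s ω) φ μ :=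
    (hind0.comp (φ := fun k : ℕ => (k : ℝ)) (ψ := id) measurable_from_top measurable_id).congr
      (hN.ae_cast_sub j hs ht hst).symm Filter.EventuallyEq.rfl
  refine ⟨hind.integrable_mul hj.1 hφi, ?_⟩
  rw [hind.integral_fun_mul_eq_mul_integral hj.1.aestronglyMeasurable hφi.aestronglyMeasurable,
    hj.2.2.1]

/-- In the second moment the diagonal supplies exactly the first moment. Hence counts·(counts - 1)
has mean (∑ acc)², of second order in the length of the interval. -/
lemma counts_moments (hN : IsPoissonFamily T lam ℱ μ N) (hlam : IsSchedule T lam)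
    {s t : ℝ} (hs : s ∈ Set.Icc 0 T) (ht : t ∈ Set.Icc 0 T) (hst : s ≤ t) :
    Integrable (fun ω => counts (fun j t => N j t ω) s t) μ ∧
    Integrable (fun ω => counts (fun j t => N j t ω) s t ^ 2) μ ∧
    ∫ ω, counts (fun j t => N j t ω) s t ∂μ = ∑ j, acc lam j s t ∧
    ∫ ω, counts (fun j t => N j t ω) s t ^ 2 ∂μ =
      ∑ j, acc lam j s t + (∑ j, acc lam j s t) ^ 2 := by
  have h1 := fun j => hN.moments hlam j hs ht hst
  have h2 := fun i j => hN.integral_mul_sub hlam i j hs ht hst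
  have e : ∀ ω, counts (fun j t => N j t ω) s t ^ 2 =
      ∑ i, ∑ j, ((N i t ω : ℝ) - N i s ω) * ((N j t ω : ℝ) - N j s ω) := fun ω => by
    rw [counts, sq, Finset.sum_mul_sum]
  refine ⟨integrable_finsetSum _ fun j _ => (h1 j).1, ?_, ?_, ?_⟩
  · simp only [e]
    exact integrable_finsetSum _ fun i _ => integrable_finsetSum _ fun j _ => (h2 i j).1
  · simp only [counts]
    rw [integral_finsetSum _ fun j _ => (h1 j).1]
    exact Finset.sum_congr rfl fun j _ => (h1 j).2.2.1
  · simp only [e]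
    rw [integral_finsetSum _ fun i _ => integrable_finsetSum _ fun j _ => (h2 i j).1]
    simp only [fun i => integral_finsetSum Finset.univ fun j _ => (h2 i j).1, fun i j => (h2 i j).2]
    simp only [Finset.sum_add_distrib, Finset.sum_ite_eq, Finset.mem_univ, if_true]
    rw [sq, Finset.sum_mul_sum]

lemma sum_acc_le {B : ℝ} (hlam : IsSchedule T lam) (hB : RateBound T lam B) {s t : ℝ}
    (hs : s ∈ Set.Icc 0 T) (ht : t ∈ Set.Icc 0 T) (hst : s ≤ t) :
    0 ≤ ∑ j, acc lam j s t ∧ ∑ j, acc lam j s t ≤ M * B * (t - s) := by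
  have h := fun j => acc_mem hlam hB j hs.1 hst ht.2
  refine ⟨Finset.sum_nonneg fun j _ => (h j).1, (Finset.sum_le_sum fun j _ => (h j).2).trans ?_⟩
  simp [mul_assoc]

/-- Almost surely no two sensors measure at the same time. -/
lemma ae_no_common_jumps [IsFiniteMeasure μ] (hN : IsPoissonFamily T lam ℱ μ N)
    (hlam : IsSchedule T lam) (hT : 0 < T) :
    ∀ᵐ ω ∂μ, ∀ i j, i ≠ j → ∀ t ∈ Set.Ioc 0 T,
      N i t ω ≠ Function.leftLim (fun t => N i t ω) t →
      N j t ω = Function.leftLim (fun t => N j t ω) t := by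
  refine ae_all_iff.2 fun i => ae_all_iff.2 fun j => ?_
  by_cases hij : i = j
  · exact Filter.Eventually.of_forall fun ω h => absurd hij h
  obtain ⟨B, hB0, hB⟩ := hlam.exists_bound
  -- A grid of k + 1 equal intervals. Both sensors count in a given interval with probability at
  -- most (BT/(k+1))², by independence and Markov, so the union over all intervals has probability
  -- O(1/(k+1)).
  set τ : ℕ → ℕ → ℝ := fun k l => l * T / (k + 1) with hτ
  set A : ℕ → Set Ω := fun k => ⋃ l ∈ Finset.range (k + 1),
    {ω | 1 ≤ ((N i (τ k (l + 1)) ω : ℝ) - N i (τ k l) ω) *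
      ((N j (τ k (l + 1)) ω : ℝ) - N j (τ k l) ω)} with hA
  have hτmem : ∀ k l, l ≤ k + 1 → τ k l ∈ Set.Icc 0 T := fun k l hl => by
    refine ⟨by positivity, ?_⟩
    rw [hτ]; simp only
    rw [div_le_iff₀ (by positivity), mul_comm]
    have : (l : ℝ) ≤ k + 1 := by exact_mod_cast hl
    gcongr
  have hτstep : ∀ k l, τ k (l + 1) - τ k l = T / (k + 1) := fun k l => by
    simp only [hτ]; push_cast; ring
  have hτle : ∀ k l, τ k l ≤ τ k (l + 1) := fun k l => by
    have h1 := hτstep k l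
    have : 0 ≤ T / ((k : ℝ) + 1) := by positivity
    linarith
  have hμA : ∀ k, μ.real (A k) ≤ (B * T) ^ 2 * (1 / ((k : ℝ) + 1)) := fun k => by
    have h1 : ∀ l ∈ Finset.range (k + 1), μ.real {ω | 1 ≤ ((N i (τ k (l + 1)) ω : ℝ) -
        N i (τ k l) ω) * ((N j (τ k (l + 1)) ω : ℝ) - N j (τ k l) ω)} ≤
        (B * (T / (k + 1))) * (B * (T / (k + 1))) := fun l hl => by
      have hl' := Finset.mem_range.1 hl
      have hs := hτmem k l (by omega)
      have ht := hτmem k (l + 1) (by omega)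
      have hint := hN.integral_mul_sub hlam i j hs ht (hτle k l)
      have hm := mul_meas_ge_le_integral_of_nonneg (μ := μ) (f := fun ω =>
        ((N i (τ k (l + 1)) ω : ℝ) - N i (τ k l) ω) * ((N j (τ k (l + 1)) ω : ℝ) - N j (τ k l) ω))
        (by
          filter_upwards [hN.ae_countingPath] with ω hω
          exact mul_nonneg ((hω i).sub_nonneg hs ht (hτle k l))
            ((hω j).sub_nonneg hs ht (hτle k l))) hint.1 1
      rw [hint.2, if_neg hij, zero_add, one_mul] at hm
      have hi := acc_mem hlam hB i hs.1 (hτle k l) ht.2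
      have hj := acc_mem hlam hB j hs.1 (hτle k l) ht.2
      rw [hτstep] at hi hj
      exact hm.trans (mul_le_mul hi.2 hj.2 hj.1 (hi.1.trans hi.2))
    refine (measureReal_biUnion_finset_le _ _).trans ((Finset.sum_le_sum h1).trans (le_of_eq ?_))
    simp only [Finset.sum_const, Finset.card_range, nsmul_eq_mul]
    push_cast
    field_simp
  -- The regularity of the paths is part of the event, so it is contained in every `A k` pointwise;
  -- its own measurability is not needed.
  set bad : Set Ω := {ω | (∀ j, CountingPath T fun t => N j t ω) ∧ ∃ t ∈ Set.Ioc 0 T,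
    N i t ω ≠ Function.leftLim (fun t => N i t ω) t ∧
    N j t ω ≠ Function.leftLim (fun t => N j t ω) t} with hbad
  have hsub : ∀ k, bad ⊆ A k := fun k ω hω => by
    obtain ⟨hc, t, ht, hti, htj⟩ := hω
    have hk : (0 : ℝ) < k + 1 := by positivity
    -- The ceiling selects the grid interval that contains t and is open on the left, so its left
    -- endpoint lies strictly before the jump.
    set c := ⌈t * (k + 1) / T⌉₊ with hcdef
    have hpos : 0 < t * (k + 1) / T := div_pos (mul_pos ht.1 hk) hT
    have hc0 : 0 < c := Nat.ceil_pos.2 hpos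
    obtain ⟨l, hl⟩ : ∃ l, c = l + 1 := ⟨c - 1, by omega⟩
    have hup : t ≤ τ k (l + 1) := by
      have := Nat.le_ceil (t * (k + 1) / T)
      rw [← hcdef, hl, div_le_iff₀ hT] at this
      simp only [hτ]
      rw [le_div_iff₀ hk]; exact this
    have hlow : τ k l < t := by
      have := Nat.ceil_lt_add_one hpos.le
      rw [← hcdef, hl] at this
      push_cast at this
      have h2 : (l : ℝ) < t * (k + 1) / T := by linarith
      rw [lt_div_iff₀ hT] at h2
      simp only [hτ]
      rw [div_lt_iff₀ hk]; exact h2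
    have hlk : l < k + 1 := by
      have : c ≤ k + 1 := by
        refine Nat.ceil_le.2 ?_
        rw [div_le_iff₀ hT]
        push_cast
        have := ht.2
        nlinarith
      omega
    have key : ∀ r, N r t ω ≠ Function.leftLim (fun t => N r t ω) t →
        (1 : ℝ) ≤ (N r (τ k (l + 1)) ω : ℝ) - N r (τ k l) ω := fun r hr => by
      have hJ : t ∈ (hc r).jumps := (hc r).mem_jumps.2 ⟨ht, hr⟩
      have h1 := (hc r).jump_eq_one hJ
      have h2 := (hc r).le_leftLim (hτmem k l (by omega)).1 hlow ht.2
      have h3 := (hc r).mono ⟨ht.1.le, ht.2⟩ (hτmem k (l + 1) (by omega)) hup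
      have h2' : (N r (τ k l) ω : ℝ) ≤ (Function.leftLim (fun t => N r t ω) t : ℕ) :=
        Nat.cast_le.2 h2
      have h3' : (N r t ω : ℝ) ≤ N r (τ k (l + 1)) ω := Nat.cast_le.2 h3
      rw [jump] at h1
      linarith
    simp only [hA, Set.mem_iUnion]
    exact ⟨l, Finset.mem_range.2 hlk, one_le_mul_of_one_le_of_one_le (key i hti) (key j htj)⟩
  have hzero : μ bad = 0 := by
    have hle : μ.real bad ≤ 0 := by
      have hlim : Filter.Tendsto (fun k : ℕ => (B * T) ^ 2 * (1 / ((k : ℝ) + 1))) Filter.atTop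
          (nhds ((B * T) ^ 2 * 0)) := tendsto_one_div_add_atTop_nhds_zero_nat.const_mul _
      rw [mul_zero] at hlim
      exact ge_of_tendsto' hlim fun k => (measureReal_mono (hsub k) (measure_ne_top _ _)).trans (hμA k)
    exact (measureReal_eq_zero_iff).1 (le_antisymm hle measureReal_nonneg)
  filter_upwards [hN.ae_countingPath, measure_eq_zero_iff_ae_notMem.1 hzero] with ω h1 h2 _ t ht hti
  by_contra htj
  exact h2 ⟨h1, t, ht, hti, htj⟩

/-- Conditioning on an event of the initial σ-algebra preserves the Poisson family. -/
lemma cond [IsProbabilityMeasure μ] (hN : IsPoissonFamily T lam ℱ μ N) {G : Set Ω}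
    (hG : MeasurableSet[ℱ 0] G) (hG0 : μ G ≠ 0) : IsPoissonFamily T lam ℱ (μ[|G]) N := by
  have hGm : MeasurableSet G := ℱ.le 0 G hG
  have hfin : μ G ≠ ∞ := measure_ne_top _ _
  -- G lies in ℱ 0 and hence in every ℱ s with s ≥ 0, of which the later increments are independent;
  -- conditioning on G does not change their probabilities.
  have key : ∀ s ∈ Set.Icc 0 T, ∀ t ∈ Set.Icc 0 T, s ≤ t → ∀ E,
      MeasurableSet[⨆ j, MeasurableSpace.comap (fun ω => N j t ω - N j s ω) ⊤] E →
      μ[|G] E = μ E := fun s hs t ht hst E hE => by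
    have h := (Indep_iff _ _ _).1 (hN.indep_past s hs t ht hst) E G hE (ℱ.mono hs.1 G hG)
    rw [cond_apply hGm, Set.inter_comm, h, mul_comm, mul_assoc,
      ENNReal.mul_inv_cancel hG0 hfin, mul_one]
  have hpre : ∀ s t j (B : Set ℕ), MeasurableSet[⨆ j, MeasurableSpace.comap
      (fun ω => N j t ω - N j s ω) ⊤] ((fun ω => N j t ω - N j s ω) ⁻¹' B) := fun s t j B =>
    (le_iSup (fun j => MeasurableSpace.comap (fun ω => N j t ω - N j s ω) ⊤) j) _ ⟨B, trivial, rfl⟩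
  refine ⟨hN.adapted, cond_absolutelyContinuous.ae_le hN.paths, fun j s hs t ht hst => ?_,
    fun s hs t ht hst => ?_, fun s hs t ht hst => ?_⟩
  · rw [← hN.law j s hs t ht hst]
    have hm : Measurable fun ω => N j t ω - N j s ω := (hN.measurable j ht).sub (hN.measurable j hs)
    refine Measure.ext fun B hB => ?_
    rw [Measure.map_apply hm hB, Measure.map_apply hm hB]
    exact key s hs t ht hst _ (hpre s t j B)
  · rw [iIndepFun_iff_measure_inter_preimage_eq_mul]
    intro S sets hsets
    rw [key s hs t ht hst _ (Finset.measurableSet_biInter _ fun j _ => hpre s t j _),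
      (iIndepFun_iff_measure_inter_preimage_eq_mul.1 (hN.indep s hs t ht hst)) S hsets]
    exact Finset.prod_congr rfl fun j _ => (key s hs t ht hst _ (hpre s t j _)).symm
  · rw [Indep_iff]
    intro E F hE hF
    rw [key s hs t ht hst E hE, cond_apply hGm, cond_apply hGm]
    -- The intersection G ∩ F is again an event of the past, so independence from the past survives
    -- the conditioning.
    have h := (Indep_iff _ _ _).1 (hN.indep_past s hs t ht hst) E (G ∩ F) hE
      ((ℱ.mono hs.1 G hG).inter hF)
    rw [Set.inter_left_comm, h, mul_left_comm]

end IsPoissonFamily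

namespace IsCovProcess

variable {T : ℝ} {lam : Fin M → ℝ → ℝ} {ℱ : Filtration ℝ mΩ} {N : Fin M → ℝ → Ω → ℕ}
  {m : Model n M} {P : ℝ → Ω → Matrix (Fin n) (Fin n) ℝ}

lemma cond (hP : IsCovProcess m T ℱ μ N P) (G : Set Ω) : IsCovProcess m T ℱ (μ[|G]) N P :=
  ⟨hP.adapted, cond_absolutelyContinuous.ae_le hP.posDef,
    cond_absolutelyContinuous.ae_le hP.cadlag, cond_absolutelyContinuous.ae_le hP.sde⟩

lemma ae_covPath (hP : IsCovProcess m T ℱ μ N P) (hN : IsPoissonFamily T lam ℱ μ N) :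
    ∀ᵐ ω ∂μ, CovPath m T (fun j t => N j t ω) fun t => P t ω := by
  filter_upwards [hP.posDef, hP.cadlag, hP.sde, hN.ae_countingPath] with ω h1 h2 h3 h4
  exact ⟨h4, h1, h2.1, h2.2, h3⟩

lemma ae_noCommonJumps [IsFiniteMeasure μ] (hP : IsCovProcess m T ℱ μ N P)
    (hN : IsPoissonFamily T lam ℱ μ N) (hlam : IsSchedule T lam) (hT : 0 < T) :
    ∀ᵐ ω ∂μ, ∃ h : CovPath m T (fun j t => N j t ω) fun t => P t ω, h.NoCommonJumps := by
  filter_upwards [hP.ae_covPath hN, hN.ae_no_common_jumps hlam hT] with ω h1 h2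
  refine ⟨h1, fun i j hij t hi hj => ?_⟩
  have hi' := (h1.counting i).mem_jumps.1 hi
  have hj' := (h1.counting j).mem_jumps.1 hj
  exact hj'.2 (h2 i j hij t hi'.1 hi'.2)

end IsCovProcess

end CDKF
end

noncomputable section

namespace CDKF

variable {n M : ℕ} {Ω : Type*} {mΩ : MeasurableSpace Ω} {ν : Measure Ω}

/-! ### Means of random variables and matrices -/

/-- `f` is integrable with mean `v`. -/
def HasMean (ν : Measure Ω) (f : Ω → ℝ) (v : ℝ) : Prop := Integrable f ν ∧ ∫ ω, f ω ∂ν = v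

namespace HasMean

variable {f g : Ω → ℝ} {v w : ℝ}

lemma add (hf : HasMean ν f v) (hg : HasMean ν g w) :
    HasMean ν (fun ω => f ω + g ω) (v + w) :=
  ⟨hf.1.add hg.1, by rw [integral_add hf.1 hg.1, hf.2, hg.2]⟩

lemma sub (hf : HasMean ν f v) (hg : HasMean ν g w) :
    HasMean ν (fun ω => f ω - g ω) (v - w) :=
  ⟨hf.1.sub hg.1, by rw [integral_sub hf.1 hg.1, hf.2, hg.2]⟩

lemma const_mul (hf : HasMean ν f v) (r : ℝ) : HasMean ν (fun ω => r * f ω) (r * v) :=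
  ⟨hf.1.const_mul r, by rw [integral_const_mul, hf.2]⟩

lemma mul_const (hf : HasMean ν f v) (r : ℝ) : HasMean ν (fun ω => f ω * r) (v * r) :=
  ⟨hf.1.mul_const r, by rw [integral_mul_const, hf.2]⟩

lemma sum {ι : Type*} {s : Finset ι} {f : ι → Ω → ℝ} {v : ι → ℝ}
    (h : ∀ i ∈ s, HasMean ν (f i) (v i)) :
    HasMean ν (fun ω => ∑ i ∈ s, f i ω) (∑ i ∈ s, v i) :=
  ⟨integrable_finsetSum _ fun i hi => (h i hi).1, by
    rw [integral_finsetSum _ fun i hi => (h i hi).1]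
    exact Finset.sum_congr rfl fun i hi => (h i hi).2⟩

lemma const [IsProbabilityMeasure ν] (r : ℝ) : HasMean ν (fun _ => r) r :=
  ⟨integrable_const r, by simp⟩

lemma mono (hf : HasMean ν f v) (hg : HasMean ν g w) (h : ∀ᵐ ω ∂ν, f ω ≤ g ω) : v ≤ w := by
  rw [← hf.2, ← hg.2]; exact integral_mono_ae hf.1 hg.1 h

end HasMean

/-- The entrywise mean of a random matrix. -/
def meanMat (ν : Measure Ω) (X : Ω → Matrix (Fin n) (Fin n) ℝ) : Matrix (Fin n) (Fin n) ℝ :=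
  Matrix.of fun i k => ∫ ω, X ω i k ∂ν

lemma linear_eq_sum {F : Matrix (Fin n) (Fin n) ℝ → ℝ} (hF : IsLinearMap ℝ F)
    (X : Matrix (Fin n) (Fin n) ℝ) :
    F X = ∑ i, ∑ k, X i k * F (Matrix.single i k 1) := by
  have h : IsLinearMap.mk' F hF (∑ i, ∑ k, Matrix.single i k (X i k)) =
      ∑ i, ∑ k, X i k * F (Matrix.single i k 1) := by
    rw [map_sum]
    refine Finset.sum_congr rfl fun i _ => ?_
    rw [map_sum]
    refine Finset.sum_congr rfl fun k _ => ?_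
    have e : Matrix.single i k (X i k) = X i k • Matrix.single i k (1 : ℝ) := by
      rw [Matrix.smul_single, smul_eq_mul, mul_one]
    rw [e, map_smul, smul_eq_mul, IsLinearMap.mk'_apply]
  rwa [← Matrix.matrix_eq_sum_single X] at h

/-- The reason for linearizing first: affine functionals commute with the mean, so the pathwise
one-step bounds close into bounds for the mean path alone. Affinity is expressed as linearity of F -
F 0. -/
lemma hasMean_affine [IsProbabilityMeasure ν] {F : Matrix (Fin n) (Fin n) ℝ → ℝ}
    (hF : IsLinearMap ℝ fun X => F X - F 0) {X : Ω → Matrix (Fin n) (Fin n) ℝ}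
    (hX : ∀ i k, Integrable (fun ω => X ω i k) ν) :
    HasMean ν (fun ω => F (X ω)) (F (meanMat ν X)) := by
  have e : ∀ Y, F Y = ∑ i, ∑ k, Y i k * (F (Matrix.single i k 1) - F 0) + F 0 := fun Y => by
    rw [← linear_eq_sum hF, sub_add_cancel]
  rw [e (meanMat ν X)]
  simp only [fun ω => e (X ω)]
  refine HasMean.add (HasMean.sum fun i _ => HasMean.sum fun k _ => HasMean.mul_const ?_ _)
    (HasMean.const _)
  exact ⟨hX i k, rfl⟩

lemma measurable_affine {m' : MeasurableSpace Ω} {F : Matrix (Fin n) (Fin n) ℝ → ℝ}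
    (hF : IsLinearMap ℝ fun X => F X - F 0) {X : Ω → Matrix (Fin n) (Fin n) ℝ}
    (hX : ∀ i k, Measurable fun ω => X ω i k) : Measurable fun ω => F (X ω) := by
  have e : ∀ Y, F Y = ∑ i, ∑ k, Y i k * (F (Matrix.single i k 1) - F 0) + F 0 := fun Y => by
    rw [← linear_eq_sum hF, sub_add_cancel]
  simp only [fun ω => e (X ω)]
  fun_prop

lemma qf_zero (x : Fin n → ℝ) : qf 0 x = 0 := by simp [qf]

lemma isLinearMap_qf (x : Fin n → ℝ) :
    IsLinearMap ℝ fun X : Matrix (Fin n) (Fin n) ℝ => qf X x - qf 0 x := by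
  refine ⟨fun X Y => ?_, fun r X => ?_⟩
  · simp [qf_add, qf_zero]
  · simp [qf_smul, qf_zero]

lemma isLinearMap_qf_covDrift (m : Model n M) (x : Fin n → ℝ) :
    IsLinearMap ℝ fun X => qf (m.covDrift X) x - qf (m.covDrift 0) x := by
  refine ⟨fun X Y => ?_, fun r X => ?_⟩
  · simp only [Model.covDrift, mul_add, add_mul, mul_zero, zero_mul, qf_add, qf_zero]; ring
  · simp only [Model.covDrift, Matrix.mul_smul, Matrix.smul_mul, mul_zero, zero_mul, qf_add,
      qf_smul, smul_eq_mul, qf_zero]; ring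

lemma isLinearMap_qf_gainForm {p : ℕ} (H : Matrix (Fin p) (Fin n) ℝ) (R : Matrix (Fin p) (Fin p) ℝ)
    (K : Matrix (Fin n) (Fin p) ℝ) (x : Fin n → ℝ) :
    IsLinearMap ℝ fun X => qf (gainForm H R K X) x - qf (gainForm H R K 0) x := by
  refine ⟨fun X Y => ?_, fun r X => ?_⟩
  · simp only [gainForm, Matrix.mul_add, Matrix.add_mul, Matrix.mul_zero, Matrix.zero_mul, qf_add,
      qf_sub, qf_zero]; ring
  · simp only [gainForm, Matrix.mul_add, Matrix.add_mul, Matrix.mul_smul, Matrix.smul_mul,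
      Matrix.mul_zero, Matrix.zero_mul, qf_add, qf_sub, qf_smul, smul_eq_mul, qf_zero]; ring

lemma isLinearMap_qf_linDrift (m : Model n M) (Z : Matrix (Fin n) (Fin n) ℝ) (x : Fin n → ℝ) :
    IsLinearMap ℝ fun X => qf (m.linDrift Z X) x - qf (m.linDrift Z 0) x := by
  refine ⟨fun X Y => ?_, fun r X => ?_⟩
  · simp only [Model.linDrift, Matrix.mul_add, Matrix.add_mul, Matrix.mul_zero, Matrix.zero_mul,
      qf_add, qf_sub, qf_neg, qf_zero]; ring
  · simp only [Model.linDrift, Matrix.mul_smul, Matrix.smul_mul, Matrix.mul_zero, Matrix.zero_mul,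
      qf_add, qf_sub, qf_neg, qf_smul, smul_eq_mul, qf_zero]; ring

lemma meanMat_transpose {X : Ω → Matrix (Fin n) (Fin n) ℝ} (hX : ∀ᵐ ω ∂ν, (X ω)ᵀ = X ω) :
    (meanMat ν X)ᵀ = meanMat ν X := by
  ext i k
  exact integral_congr_ae (hX.mono fun ω h => congrFun (congrFun h i) k)

lemma integrable_entry_of_l1_le {X : Ω → Matrix (Fin n) (Fin n) ℝ} {f : Ω → ℝ}
    (hX : ∀ i k, AEStronglyMeasurable (fun ω => X ω i k) ν) (hf : Integrable f ν)
    (h : ∀ᵐ ω ∂ν, l1 (X ω) ≤ f ω) (i k : Fin n) : Integrable (fun ω => X ω i k) ν :=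
  hf.mono' (hX i k) (h.mono fun _ hω => (abs_entry_le_l1 _ i k).trans hω)

/-- The entrywise `ℓ¹` norm of a mean is at most the mean of the norms. -/
lemma l1_meanMat_sub_le {X X' : Ω → Matrix (Fin n) (Fin n) ℝ}
    (hX : ∀ i k, Integrable (fun ω => X ω i k) ν) (hX' : ∀ i k, Integrable (fun ω => X' ω i k) ν)
    {f : Ω → ℝ} {v : ℝ} (hf : HasMean ν f v) (h : ∀ᵐ ω ∂ν, l1 (X ω - X' ω) ≤ f ω) :
    l1 (meanMat ν X - meanMat ν X') ≤ v := by
  have h1 : HasMean ν (fun ω => l1 (X ω - X' ω)) (∑ i, ∑ k, ∫ ω, |X ω i k - X' ω i k| ∂ν) :=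
    HasMean.sum fun i _ => HasMean.sum fun k _ => ⟨((hX i k).sub (hX' i k)).abs, rfl⟩
  refine le_trans ?_ (h1.mono hf h)
  refine Finset.sum_le_sum fun i _ => Finset.sum_le_sum fun k _ => ?_
  have : (meanMat ν X - meanMat ν X') i k = ∫ ω, (X ω i k - X' ω i k) ∂ν :=
    (integral_sub (hX i k) (hX' i k)).symm
  rw [this]
  exact abs_integral_le_integral_abs

lemma continuousOn_of_l1_sub_le {F : ℝ → Matrix (Fin n) (Fin n) ℝ} {T K : ℝ}
    (h : ∀ s ∈ Set.Icc 0 T, ∀ t ∈ Set.Icc 0 T, s ≤ t → l1 (F t - F s) ≤ K * (t - s)) :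
    ContinuousOn F (Set.Icc 0 T) := by
  refine continuousOn_pi.2 fun i => continuousOn_pi.2 fun k => ?_
  refine (LipschitzOnWith.of_dist_le_mul (K := K.toNNReal) fun s hs t ht => ?_).continuousOn
  have key : ∀ s ∈ Set.Icc 0 T, ∀ t ∈ Set.Icc 0 T, s ≤ t →
      |F t i k - F s i k| ≤ K.toNNReal * (t - s) := fun s hs t ht hst =>
    (abs_entry_le_l1 (F t - F s) i k).trans ((h s hs t ht hst).trans
      (mul_le_mul_of_nonneg_right (Real.le_coe_toNNReal K) (sub_nonneg.2 hst)))
  rw [Real.dist_eq, Real.dist_eq]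
  rcases le_total s t with hst | hst
  · rw [abs_sub_comm, abs_sub_comm s, abs_of_nonneg (sub_nonneg.2 hst)]
    exact key s hs t ht hst
  · rw [abs_of_nonneg (sub_nonneg.2 hst)]
    exact key t ht s hs hst

lemma measurable_inv_entry {m' : MeasurableSpace Ω} {X : Ω → Matrix (Fin n) (Fin n) ℝ}
    (hX : ∀ i k, Measurable fun ω => X ω i k) (i k : Fin n) :
    Measurable fun ω => (X ω)⁻¹ i k := by
  have hdet : ∀ {Y : Ω → Matrix (Fin n) (Fin n) ℝ}, (∀ i k, Measurable fun ω => Y ω i k) →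
      Measurable fun ω => (Y ω).det := fun hY => by
    simp only [Matrix.det_apply]
    refine Finset.measurable_fun_sum _ fun σ _ => ?_
    exact (Finset.measurable_fun_prod _ fun i _ => hY _ _).const_smul _
  simp only [Matrix.inv_def, Ring.inverse_eq_inv', Matrix.smul_apply, smul_eq_mul,
    Matrix.adjugate_apply]
  refine (hdet hX).inv.mul (hdet fun a b => ?_)
  by_cases ha : a = k
  · subst ha; simp
  · simpa [Matrix.updateRow_ne ha] using hX a b

end CDKF
end

noncomputable section

namespace CDKF

variable {n M : ℕ} {Ω : Type*} {mΩ : MeasurableSpace Ω} {ν : Measure Ω} {m : Model n M} {T : ℝ}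
  {lam : Fin M → ℝ → ℝ} {ℱ : Filtration ℝ mΩ} {N : Fin M → ℝ → Ω → ℕ}
  {P : ℝ → Ω → Matrix (Fin n) (Fin n) ℝ}

/-! ### One-step inequalities for the mean paths -/

namespace IsCovProcess

lemma measurable_entry (hP : IsCovProcess m T ℱ ν N P) {t : ℝ} (ht : t ∈ Set.Icc 0 T) (i k : Fin n) :
    Measurable fun ω => P t ω i k := (hP.adapted t ht i k).mono (ℱ.le t) le_rfl

lemma integrable_entry [IsProbabilityMeasure ν] (hP : IsCovProcess m T ℱ ν N P)
    (hN : IsPoissonFamily T lam ℱ ν N) {c₀ : ℝ} (h0 : ∀ᵐ ω ∂ν, l1 (P 0 ω) ≤ c₀) {t : ℝ}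
    (ht : t ∈ Set.Icc 0 T) (i k : Fin n) : Integrable (fun ω => P t ω i k) ν := by
  obtain ⟨c, hc0, hc⟩ := m.exists_covPath_bound T c₀
  refine integrable_entry_of_l1_le (fun i k => (hP.measurable_entry ht i k).aestronglyMeasurable)
    (integrable_const c) ?_ i k
  filter_upwards [hP.ae_covPath hN, h0] with ω h1 h2
  exact hc _ _ h1 h2 t ht

lemma transpose_meanMat (hP : IsCovProcess m T ℱ ν N P) {t : ℝ} (ht : t ∈ Set.Icc 0 T) :
    (meanMat ν (P t))ᵀ = meanMat ν (P t) :=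
  meanMat_transpose (hP.posDef.mono fun _ h => (h t ht).transpose_eq)

/-- The mean covariance path is continuous and a subsolution of the gain-linearized surrogate. -/
lemma exists_mean_step [IsProbabilityMeasure ν] (hP : IsCovProcess m T ℱ ν N P)
    (hN : IsPoissonFamily T lam ℱ ν N) (hlam : IsSchedule T lam) {c₀ : ℝ}
    (h0 : ∀ᵐ ω ∂ν, l1 (P 0 ω) ≤ c₀) :
    ContinuousOn (fun t => meanMat ν (P t)) (Set.Icc 0 T) ∧ ∃ C', 0 ≤ C' ∧
    ∀ s ∈ Set.Icc 0 T, ∀ t ∈ Set.Icc 0 T, s < t →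
      ∀ K : (j : Fin M) → Matrix (Fin n) (Fin (m.p j)) ℝ, ∀ x, x ⬝ᵥ x = 1 →
      qf (meanMat ν (P t)) x - qf (meanMat ν (P s)) x ≤
        (t - s) * qf (m.covDrift (meanMat ν (P s))) x -
        ∑ j, acc lam j s t * qf (gainForm (m.H j) (m.R j) (K j) (meanMat ν (P s))) x +
        C' * (t - s) ^ 2 := by
  obtain ⟨B, hB0, hB⟩ := hlam.exists_bound
  obtain ⟨C, hC0, hC⟩ := m.exists_covPath_expansion T c₀
  have hint := fun (t : ℝ) ht => hP.integrable_entry hN h0 (t := t) ht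
  have hcm := fun (s t : ℝ) hs ht hst => hN.counts_moments hlam (s := s) (t := t) hs ht hst
  -- The terms 1, MB and (MB)² bound the means of (t-s)², (t-s)·counts and counts·(counts - 1),
  -- relative to (t-s)².
  refine ⟨continuousOn_of_l1_sub_le (K := C * (1 + M * B)) fun s hs t ht hst => ?_,
    C * (1 + M * B + (M * B) ^ 2), by positivity, fun s hs t ht hst K x hx => ?_⟩
  · obtain ⟨k1, k2, k3, k4⟩ := hcm s t hs ht hst
    refine (l1_meanMat_sub_le (hint t ht) (hint s hs)
      (((HasMean.const (t - s)).add ⟨k1, k3⟩).const_mul C) ?_).trans ?_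
    · filter_upwards [hP.ae_covPath hN, h0] with ω h1 h2
      exact (hC _ _ h1 h2 s hs t ht hst).1
    · rw [mul_assoc]
      refine mul_le_mul_of_nonneg_left ?_ hC0
      linarith [(IsPoissonFamily.sum_acc_le hlam hB hs ht hst).2]
  · obtain ⟨k1, k2, k3, k4⟩ := hcm s t hs ht hst.le
    have hacc := IsPoissonFamily.sum_acc_le hlam hB hs ht hst.le
    have hL := (hasMean_affine (isLinearMap_qf x) (hint t ht)).sub
      (hasMean_affine (isLinearMap_qf x) (hint s hs))
    -- The increment after s is independent of P s, so the mean of the product factors; the affine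
    -- minorant then passes to the mean of P s.
    have hG : ∀ j, HasMean ν
        (fun ω => ((N j t ω : ℝ) - N j s ω) * qf (gainForm (m.H j) (m.R j) (K j) (P s ω)) x)
        (acc lam j s t * qf (gainForm (m.H j) (m.R j) (K j) (meanMat ν (P s))) x) := fun j => by
      have h1 := hasMean_affine (isLinearMap_qf_gainForm (m.H j) (m.R j) (K j) x) (hint s hs)
      have h2 := hN.integral_sub_mul hlam j hs ht hst.le
        (measurable_affine (isLinearMap_qf_gainForm (m.H j) (m.R j) (K j) x) (hP.adapted s hs)) h1.1
      exact ⟨h2.1, by rw [h2.2, h1.2]⟩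
    have hD : HasMean ν (fun ω => counts (fun j t => N j t ω) s t) (∑ j, acc lam j s t) := ⟨k1, k3⟩
    have hD2 : HasMean ν (fun ω => counts (fun j t => N j t ω) s t ^ 2)
      (∑ j, acc lam j s t + (∑ j, acc lam j s t) ^ 2) := ⟨k2, k4⟩
    have hR := (((hasMean_affine (isLinearMap_qf_covDrift m x) (hint s hs)).const_mul (t - s)).sub
      (HasMean.sum fun j (_ : j ∈ Finset.univ) => hG j)).add
      ((((HasMean.const ((t - s) ^ 2)).add (hD.const_mul (t - s))).add (hD2.sub hD)).const_mul C)
    refine (hL.mono hR ?_).trans ?_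
    · filter_upwards [hP.ae_covPath hN, h0] with ω h1 h2
      have h3 := (hC _ _ h1 h2 s hs t ht hst.le).2
      have h4 := (abs_le.1 ((abs_qf_le hx).trans h3)).2
      simp only [qf_sub, qf_smul, qf_sum] at h4
      -- Each correction is replaced by its affine minorant with an arbitrary gain; the
      -- nonnegativity of the increments preserves the inequality.
      have h5 : ∀ j, ((N j t ω : ℝ) - N j s ω) *
          qf (gainForm (m.H j) (m.R j) (K j) (P s ω)) x ≤
          ((N j t ω : ℝ) - N j s ω) * qf (m.g j (P s ω)) x := fun j => by
        refine mul_le_mul_of_nonneg_left ?_ ((h1.counting j).sub_nonneg hs ht hst.le)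
        have h6 := (corr_sub_gainForm (m.R_posDef j) (h1.posDef s hs).posSemidef (H := m.H j)
          (K j)).qf_nonneg x
        rw [qf_sub, ← m.g_eq_corr] at h6
        linarith
      have h7 := Finset.sum_le_sum fun j (_ : j ∈ Finset.univ) => h5 j
      have h8 : counts (fun j t => N j t ω) s t * (counts (fun j t => N j t ω) s t - 1) =
        counts (fun j t => N j t ω) s t ^ 2 - counts (fun j t => N j t ω) s t := by ring
      rw [h8] at h4
      linarith
    · have hts : 0 ≤ t - s := sub_nonneg.2 hst.le
      have h1 : (t - s) ^ 2 + (t - s) * ∑ j, acc lam j s t +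
          (∑ j, acc lam j s t + (∑ j, acc lam j s t) ^ 2 - ∑ j, acc lam j s t) ≤
          (1 + M * B + (M * B) ^ 2) * (t - s) ^ 2 := by
        have h2 := mul_le_mul_of_nonneg_left hacc.2 hts
        have h3 := pow_le_pow_left₀ hacc.1 hacc.2 2
        nlinarith
      have := mul_le_mul_of_nonneg_left h1 hC0
      linarith

lemma measurable_info (hP : IsCovProcess m T ℱ ν N P) {t : ℝ} (ht : t ∈ Set.Icc 0 T) (i k : Fin n) :
    Measurable fun ω => info P t ω i k :=
  measurable_inv_entry (hP.measurable_entry ht) i k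

lemma integrable_info_entry [IsProbabilityMeasure ν] (hP : IsCovProcess m T ℱ ν N P)
    (hN : IsPoissonFamily T lam ℱ ν N) (hlam : IsSchedule T lam) (hT : 0 < T) {c₀ : ℝ}
    (h0 : ∀ᵐ ω ∂ν, l1 (info P 0 ω) ≤ c₀) {t : ℝ} (ht : t ∈ Set.Icc 0 T) (i k : Fin n) :
    Integrable (fun ω => info P t ω i k) ν := by
  obtain ⟨c, hc0, hc⟩ := m.exists_infoPath_bound T c₀
  obtain ⟨k1, -⟩ := hN.counts_moments hlam ⟨le_rfl, hT.le⟩ ⟨hT.le, le_rfl⟩ hT.le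
  refine integrable_entry_of_l1_le (fun i k => (hP.measurable_info ht i k).aestronglyMeasurable)
    (((integrable_const (1 : ℝ)).add k1).const_mul c) ?_ i k
  filter_upwards [hP.ae_noCommonJumps hN hlam hT, h0] with ω ⟨h, h1⟩ h2
  exact hc _ _ h h1 h2 t ht

lemma transpose_meanMat_info (hP : IsCovProcess m T ℱ ν N P) {t : ℝ} (ht : t ∈ Set.Icc 0 T) :
    (meanMat ν (info P t))ᵀ = meanMat ν (info P t) :=
  meanMat_transpose (hP.posDef.mono fun _ h => (h t ht).inv.transpose_eq)

/-- The mean information path is continuous and a subsolution of the linearized surrogate. -/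
lemma exists_mean_info_step [IsProbabilityMeasure ν] (hP : IsCovProcess m T ℱ ν N P)
    (hN : IsPoissonFamily T lam ℱ ν N) (hlam : IsSchedule T lam) (hT : 0 < T) {c₀ b : ℝ}
    (h0 : ∀ᵐ ω ∂ν, l1 (info P 0 ω) ≤ c₀) :
    ContinuousOn (fun t => meanMat ν (info P t)) (Set.Icc 0 T) ∧ ∃ C', 0 ≤ C' ∧
    ∀ s ∈ Set.Icc 0 T, ∀ t ∈ Set.Icc 0 T, s < t → ∀ Z, Zᵀ = Z → l1 Z ≤ b → ∀ x, x ⬝ᵥ x = 1 →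
      qf (meanMat ν (info P t)) x - qf (meanMat ν (info P s)) x ≤
        (t - s) * qf (m.linDrift Z (meanMat ν (info P s))) x +
        ∑ j, acc lam j s t * qf (m.S j) x + C' * (t - s) ^ 2 := by
  obtain ⟨B, hB0, hB⟩ := hlam.exists_bound
  obtain ⟨C, hC0, hC⟩ := m.exists_infoPath_expansion T c₀ b
  have hint := fun (t : ℝ) ht => hP.integrable_info_entry hN hlam hT h0 (t := t) ht
  have hcm := fun (s t : ℝ) hs ht hst => hN.counts_moments hlam (s := s) (t := t) hs ht hst
  -- The random factor in the information expansion enters only through this second moment, which is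
  -- finite for Poisson counts.
  set D := ∫ ω, (1 + counts (fun j t => N j t ω) 0 T) ^ 2 ∂ν with hDdef
  have hD0 : 0 ≤ D := integral_nonneg fun ω => sq_nonneg _
  have hDm : HasMean ν (fun ω => (1 + counts (fun j t => N j t ω) 0 T) ^ 2) D := by
    obtain ⟨k1, k2, -⟩ := hcm 0 T ⟨le_rfl, hT.le⟩ ⟨hT.le, le_rfl⟩ hT.le
    refine ⟨?_, rfl⟩
    refine (((integrable_const (1 : ℝ)).add (k1.const_mul 2)).add k2).congr
      (Filter.Eventually.of_forall fun ω => ?_)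
    simp only [Pi.add_apply]; ring
  refine ⟨continuousOn_of_l1_sub_le (K := C * (D + M * B)) fun s hs t ht hst => ?_,
    C * (D + M * B), by positivity, fun s hs t ht hst Z hZ hZb x hx => ?_⟩
  · obtain ⟨k1, k2, k3, k4⟩ := hcm s t hs ht hst
    refine (l1_meanMat_sub_le (hint t ht) (hint s hs)
      (((hDm.const_mul (t - s)).add ⟨k1, k3⟩).const_mul C) ?_).trans ?_
    · filter_upwards [hP.ae_noCommonJumps hN hlam hT, h0] with ω ⟨h, h1⟩ h2
      exact (hC _ _ h h1 h2 s hs t ht hst).1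
    · rw [mul_assoc]
      refine mul_le_mul_of_nonneg_left ?_ hC0
      linarith [(IsPoissonFamily.sum_acc_le hlam hB hs ht hst).2]
  · obtain ⟨k1, k2, k3, k4⟩ := hcm s t hs ht hst.le
    have hacc := IsPoissonFamily.sum_acc_le hlam hB hs ht hst.le
    have hL := (hasMean_affine (isLinearMap_qf x) (hint t ht)).sub
      (hasMean_affine (isLinearMap_qf x) (hint s hs))
    -- The information gain of a measurement does not depend on the state, so the mean increment
    -- suffices and independence from the past plays no role.
    have hG : ∀ j, HasMean ν (fun ω => ((N j t ω : ℝ) - N j s ω) * qf (m.S j) x)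
        (acc lam j s t * qf (m.S j) x) := fun j => by
      have h1 := hN.moments hlam j hs ht hst.le
      exact HasMean.mul_const ⟨h1.1, h1.2.2.1⟩ _
    have hR := (((hasMean_affine (isLinearMap_qf_linDrift m Z x) (hint s hs)).const_mul
      (t - s)).add (HasMean.sum fun j (_ : j ∈ Finset.univ) => hG j)).add
      (((hDm.const_mul ((t - s) ^ 2)).add
        (HasMean.const_mul ⟨k1, k3⟩ (t - s))).const_mul C)
    refine (hL.mono hR ?_).trans ?_
    · filter_upwards [hP.ae_noCommonJumps hN hlam hT, h0] with ω ⟨h, h1⟩ h2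
      exact (hC _ _ h h1 h2 s hs t ht hst.le).2 Z hZ hZb x hx
    · have hts : 0 ≤ t - s := sub_nonneg.2 hst.le
      have h1 : (t - s) ^ 2 * D + (t - s) * ∑ j, acc lam j s t ≤ (D + M * B) * (t - s) ^ 2 := by
        have h2 := mul_le_mul_of_nonneg_left hacc.2 hts
        nlinarith
      have := mul_le_mul_of_nonneg_left h1 hC0
      linarith

end IsCovProcess

end CDKF
end

noncomputable section

namespace CDKF

variable {n M : ℕ} {Ω : Type*} {mΩ : MeasurableSpace Ω} {μ : Measure Ω}

/-! ### From means over cells to conditional means -/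

lemma sigmaOf_le {m' : MeasurableSpace Ω} {Z : Ω → Matrix (Fin n) (Fin n) ℝ}
    (hZ : ∀ i k, Measurable[m'] fun ω => Z ω i k) : sigmaOf Z ≤ m' :=
  iSup_le fun i => iSup_le fun k => (hZ i k).comap_le

lemma measurable_sigmaOf (Z : Ω → Matrix (Fin n) (Fin n) ℝ) (i k : Fin n) :
    Measurable[sigmaOf Z] fun ω => Z ω i k :=
  Measurable.mono (comap_measurable _)
    (le_iSup_of_le i (le_iSup (fun k => MeasurableSpace.comap (fun ω => Z ω i k) (borel ℝ)) k)) le_rfl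

/-- The null fibres are countably many, so together they form a null set. -/
lemma ae_measure_fiber_ne_zero {β : Type*} [Countable β] (μ : Measure Ω) (c : Ω → β) :
    ∀ᵐ ω ∂μ, μ (c ⁻¹' {c ω}) ≠ 0 := by
  have h : ∀ b, ∀ᵐ ω ∂μ, c ω = b → μ (c ⁻¹' {b}) ≠ 0 := fun b => by
    by_cases hb : μ (c ⁻¹' {b}) = 0
    · filter_upwards [measure_eq_zero_iff_ae_notMem.1 hb] with ω hω hc
      exact absurd hc hω
    · exact Filter.Eventually.of_forall fun _ _ => hb
  filter_upwards [ae_all_iff.2 h] with ω hω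
  exact hω _ rfl

/-- The grid cell of a matrix at scale `1 / r`. -/
def cell (r : ℝ) (X : Matrix (Fin n) (Fin n) ℝ) : Fin n → Fin n → ℤ := fun i k => ⌊r * X i k⌋

lemma measurable_cell {m' : MeasurableSpace Ω} {X : Ω → Matrix (Fin n) (Fin n) ℝ}
    (hX : ∀ i k, Measurable fun ω => X ω i k) (r : ℝ) : Measurable fun ω => cell r (X ω) :=
  measurable_pi_lambda _ fun i => measurable_pi_lambda _ fun k =>
    Int.measurable_floor.comp ((hX i k).const_mul r)

lemma l1_sub_le_of_cell_eq {r : ℝ} (hr : 0 < r) {X Y : Matrix (Fin n) (Fin n) ℝ}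
    (h : cell r X = cell r Y) : l1 (X - Y) ≤ n ^ 2 / r := by
  have h1 : ∀ i k, |(X - Y) i k| ≤ 1 / r := fun i k => by
    have h2 := Int.abs_sub_lt_one_of_floor_eq_floor (congrFun (congrFun h i) k)
    rw [← mul_sub, abs_mul, abs_of_pos hr] at h2
    rw [le_div_iff₀ hr, mul_comm]
    exact h2.le
  refine (Finset.sum_le_sum fun i _ => Finset.sum_le_sum fun k _ => h1 i k).trans (le_of_eq ?_)
  simp only [Finset.sum_const, Finset.card_univ, Fintype.card_fin, nsmul_eq_mul]
  ring

lemma lintegral_condLExp_cond [IsFiniteMeasure μ] {m' : MeasurableSpace Ω} (hm : m' ≤ mΩ)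
    {G : Set Ω} (hG : MeasurableSet[m'] G) (f : Ω → ℝ≥0∞) :
    ∫⁻ ω, condLExp m' μ f ω ∂(μ[|G]) = ∫⁻ ω, f ω ∂(μ[|G]) := by
  rw [ProbabilityTheory.cond, lintegral_smul_measure, lintegral_smul_measure,
    setLIntegral_condLExp hm μ f hG]

lemma hasMean_toReal_condLExp [IsFiniteMeasure μ] {m' : MeasurableSpace Ω} (hm : m' ≤ mΩ)
    {G : Set Ω} (hG : MeasurableSet[m'] G) {f : Ω → ℝ≥0∞} (hf : ∫⁻ ω, f ω ∂(μ[|G]) ≠ ∞) :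
    HasMean (μ[|G]) (fun ω => (condLExp m' μ f ω).toReal) (∫⁻ ω, f ω ∂(μ[|G])).toReal := by
  have hmeas : Measurable[mΩ] (condLExp m' μ f) := measurable_condLExp' _ _ _
  have e := lintegral_condLExp_cond hm hG f (μ := μ)
  refine ⟨integrable_toReal_of_lintegral_ne_top hmeas.aemeasurable (by rw [e]; exact hf), ?_⟩
  rw [integral_toReal hmeas.aemeasurable (ae_lt_top hmeas (by rw [e]; exact hf)), e]

/-- X need not be integrable under μ. Integrability on G makes the integrals of the positive and
negative parts over G finite, and each of them equals the integral of its conditional expectation.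
-/
lemma hasMean_condMean [IsFiniteMeasure μ] {X Z : Ω → Matrix (Fin n) (Fin n) ℝ}
    (hZ : sigmaOf Z ≤ mΩ) {G : Set Ω} (hG : MeasurableSet[sigmaOf Z] G)
    (hX : ∀ i k, Integrable (fun ω => X ω i k) (μ[|G])) (i k : Fin n) :
    HasMean (μ[|G]) (fun ω => condMean μ X Z ω i k) (meanMat (μ[|G]) X i k) := by
  have h := (hasMean_toReal_condLExp hZ hG (hX i k).lintegral_lt_top.ne).sub
    (hasMean_toReal_condLExp hZ hG (hX i k).neg.lintegral_lt_top.ne)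
  refine ⟨h.1, h.2.trans ?_⟩
  exact (integral_eq_lintegral_pos_part_sub_lintegral_neg_part (hX i k)).symm

lemma measurable_condMean (X Z : Ω → Matrix (Fin n) (Fin n) ℝ) (i k : Fin n) :
    Measurable[sigmaOf Z] fun ω => condMean μ X Z ω i k :=
  Measurable.sub (measurable_condLExp _ _ _).ennreal_toReal (measurable_condLExp _ _ _).ennreal_toReal

lemma condMean_transpose {X Z : Ω → Matrix (Fin n) (Fin n) ℝ}
    (hX : ∀ᵐ ω ∂μ, (X ω)ᵀ = X ω) : ∀ᵐ ω ∂μ, (condMean μ X Z ω)ᵀ = condMean μ X Z ω := by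
  have h : ∀ i k, ∀ᵐ ω ∂μ, condMean μ X Z ω k i = condMean μ X Z ω i k := fun i k => by
    have e : ∀ᵐ ω ∂μ, X ω k i = X ω i k := hX.mono fun ω h => congrFun (congrFun h i) k
    filter_upwards [condLExp_congr_ae (mΩ := sigmaOf Z)
        (e.mono fun ω h => congrArg ENNReal.ofReal h),
      condLExp_congr_ae (mΩ := sigmaOf Z)
        (e.mono fun ω h => congrArg (fun r => ENNReal.ofReal (-r)) h)] with ω h1 h2
    exact congrArg₂ (fun u v : ℝ≥0∞ => u.toReal - v.toReal) h1 h2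
  filter_upwards [ae_all_iff.2 fun i => ae_all_iff.2 (h i)] with ω hω
  ext i k
  exact hω i k

lemma posSemidef_add_of_l1_le {D : Matrix (Fin n) (Fin n) ℝ} (hD : Dᵀ = D) {ε : ℝ}
    (h : l1 D ≤ ε) : (D + ε • 1).PosSemidef := by
  refine posSemidef_of_unit (by simp [hD]) fun x hx => ?_
  rw [qf_add, qf_smul, qf_one, hx]
  have := (abs_le.1 ((abs_qf_le (X := D) hx).trans h)).1
  linarith

lemma l1_meanMat_sub_const_le {ν : Measure Ω} [IsProbabilityMeasure ν]
    {X : Ω → Matrix (Fin n) (Fin n) ℝ} (hX : ∀ i k, Integrable (fun ω => X ω i k) ν)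
    {X₀ : Matrix (Fin n) (Fin n) ℝ} {ε : ℝ} (h : ∀ᵐ ω ∂ν, l1 (X ω - X₀) ≤ ε) :
    l1 (meanMat ν X - X₀) ≤ ε := by
  have e : meanMat ν (fun _ => X₀) = X₀ := by ext i k; simp [meanMat]
  have := l1_meanMat_sub_le hX (fun i k => integrable_const (X₀ i k)) (HasMean.const ε) h
  rwa [e] at this

/-- A bound by the mean over every small cell of positive probability gives the bound by the
conditional mean. -/
theorem ae_posSemidef_sub_condMean [IsProbabilityMeasure μ]
    {X Z Xhat : Ω → Matrix (Fin n) (Fin n) ℝ} (hZ : sigmaOf Z ≤ mΩ)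
    (hXt : ∀ᵐ ω ∂μ, (X ω)ᵀ = X ω)
    (h : ∀ᵐ ω₀ ∂μ, ∃ κ, 0 ≤ κ ∧ ∀ ε, 0 < ε → ∀ G, MeasurableSet[sigmaOf Z] G → μ G ≠ 0 →
      (∀ ω ∈ G, l1 (Z ω - Z ω₀) ≤ ε) → (∀ i k, Integrable (fun ω => X ω i k) (μ[|G])) ∧
      (Xhat ω₀ - meanMat (μ[|G]) X + (ε * κ) • 1).PosSemidef) :
    ∀ᵐ ω ∂μ, (Xhat ω - condMean μ X Z ω).PosSemidef := by
  set W := condMean μ X Z with hW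
  -- The cells record both Z and W. The first component makes the hypothesis applicable; the second
  -- makes W nearly constant on the cell. W is a function of the information in Z, so the cell still
  -- belongs to that σ-algebra.
  set c : ℕ → Ω → (Fin n → Fin n → ℤ) × (Fin n → Fin n → ℤ) := fun r ω =>
    (cell (r + 1) (Z ω), cell (r + 1) (W ω)) with hc
  filter_upwards [h, condMean_transpose (Z := Z) hXt,
    ae_all_iff.2 fun r => ae_measure_fiber_ne_zero μ (c r)] with ω₀ ⟨κ, hκ0, hκ⟩ hWt hcell
  -- The share κ comes from the hypothesis and the share 1 from the oscillation of W over the cell.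
  refine posSemidef_of_forall_add (c := κ + 1) fun ε hε => ?_
  obtain ⟨r, hr⟩ := exists_nat_gt ((n : ℝ) ^ 2 / ε)
  have hr0 : (0 : ℝ) < r + 1 := by positivity
  have hrε : (n : ℝ) ^ 2 / (r + 1) ≤ ε := by
    rw [div_lt_iff₀ hε] at hr
    rw [div_le_iff₀ hr0]
    nlinarith
  set G := c r ⁻¹' {c r ω₀} with hGdef
  have hG : MeasurableSet[sigmaOf Z] G :=
    (Measurable.prodMk (measurable_cell (measurable_sigmaOf Z) (r + 1))
      (measurable_cell (measurable_condMean X Z) (r + 1))) (measurableSet_singleton _)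
  have hGmem : ∀ ω ∈ G, l1 (Z ω - Z ω₀) ≤ ε ∧ l1 (W ω - W ω₀) ≤ ε := fun ω hω => by
    have e : c r ω = c r ω₀ := hω
    exact ⟨(l1_sub_le_of_cell_eq hr0 (congrArg Prod.fst e)).trans hrε,
      (l1_sub_le_of_cell_eq hr0 (congrArg Prod.snd e)).trans hrε⟩
  obtain ⟨hXi, hpsd⟩ := hκ ε hε G hG (hcell r) fun ω hω => (hGmem ω hω).1
  have : IsProbabilityMeasure (μ[|G]) := cond_isProbabilityMeasure (hcell r)
  have hWm := hasMean_condMean hZ hG hXi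
  have hWX : meanMat (μ[|G]) W = meanMat (μ[|G]) X := by
    ext i k; exact (hWm i k).2
  have hl := l1_meanMat_sub_const_le (X₀ := W ω₀) (fun i k => (hWm i k).1)
    ((ae_cond_mem (hZ _ hG)).mono fun ω hω => (hGmem ω hω).2)
  rw [hWX] at hl
  have hsym : (meanMat (μ[|G]) X)ᵀ = meanMat (μ[|G]) X :=
    meanMat_transpose (cond_absolutelyContinuous.ae_le hXt)
  have h2 := posSemidef_add_of_l1_le (by rw [Matrix.transpose_sub, hsym, hWt]) hl
  convert hpsd.add h2 using 1
  rw [mul_add, add_smul, mul_one]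
  abel

/-! ### The two comparison theorems -/

variable {m : Model n M} {T : ℝ} {lam : Fin M → ℝ → ℝ} {ℱ : Filtration ℝ mΩ}
  {N : Fin M → ℝ → Ω → ℕ} {P : ℝ → Ω → Matrix (Fin n) (Fin n) ℝ}

lemma l1_le_of_l1_sub_le {X Y : Matrix (Fin n) (Fin n) ℝ} {ε : ℝ} (h : l1 (X - Y) ≤ ε) :
    l1 X ≤ l1 Y + ε := by
  have := l1_add_le (X - Y) Y
  rw [sub_add_cancel] at this
  linarith

lemma posSemidef_sub_meanMat {ν : Measure Ω} [IsProbabilityMeasure ν]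
    {X : Ω → Matrix (Fin n) (Fin n) ℝ} (hX : ∀ i k, Integrable (fun ω => X ω i k) ν)
    (hXt : (meanMat ν X)ᵀ = meanMat ν X) {X₀ : Matrix (Fin n) (Fin n) ℝ} (hX₀ : X₀ᵀ = X₀)
    {ε : ℝ} (h : ∀ᵐ ω ∂ν, l1 (X ω - X₀) ≤ ε) : (X₀ - meanMat ν X + ε • 1).PosSemidef := by
  refine posSemidef_add_of_l1_le (by rw [Matrix.transpose_sub, hXt, hX₀]) ?_
  rw [l1_sub_comm]
  exact l1_meanMat_sub_const_le hX h

/-- For almost every ω₀, the surrogate path at ω₀ is compared with the mean under conditioning on a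
cell around the initial information at ω₀. The factor in the error depends only on ω₀ and t, through
a bound on that one path, so it survives the shrinking of the cell. -/
theorem IsCovProcess.info_le_surrogate [IsProbabilityMeasure μ] (hP : IsCovProcess m T ℱ μ N P)
    (hN : IsPoissonFamily T lam ℱ μ N) (hlam : IsSchedule T lam) (hT : 0 < T)
    {Yhat : ℝ → Ω → Matrix (Fin n) (Fin n) ℝ}
    (hY : ∀ᵐ ω ∂μ, IsSolution T (m.infoField lam) fun t => Yhat t ω)
    (hY0 : ∀ᵐ ω ∂μ, Yhat 0 ω = info P 0 ω) {t : ℝ} (ht : t ∈ Set.Icc 0 T) :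
    ∀ᵐ ω ∂μ, (Yhat t ω - condMean μ (info P t) (info P 0) ω).PosSemidef := by
  have h0T : (0 : ℝ) ∈ Set.Icc 0 T := ⟨le_rfl, hT.le⟩
  have hσ : sigmaOf (info P 0) ≤ ℱ 0 := sigmaOf_le (measurable_inv_entry (hP.adapted 0 h0T))
  obtain ⟨B, hB0, hB⟩ := hlam.exists_bound
  refine ae_posSemidef_sub_condMean (hσ.trans (ℱ.le 0))
    (hP.posDef.mono fun ω h => (h t ht).inv.transpose_eq) ?_
  filter_upwards [hY, hY0, hP.posDef] with ω₀ h1 h2 h3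
  obtain ⟨b, hb0, hb⟩ := exists_l1_bound h1.continuousOn
  have hsym : (info P 0 ω₀)ᵀ = info P 0 ω₀ := (h3 0 h0T).inv.transpose_eq
  refine ⟨_, (Real.exp_pos ((2 * (2 * (l1 m.A + l1 m.Q * b)) + 1) * (t - 0))).le,
    fun ε hε G hG hG0 hZ => ?_⟩
  have : IsProbabilityMeasure (μ[|G]) := cond_isProbabilityMeasure hG0
  have hPG := hP.cond G
  have hNG := hN.cond (hσ _ hG) hG0
  have hmem : ∀ᵐ ω ∂(μ[|G]), l1 (info P 0 ω - info P 0 ω₀) ≤ ε :=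
    (ae_cond_mem (ℱ.le 0 _ (hσ _ hG))).mono hZ
  -- On the cell the initial information is bounded, which makes all the means below finite.
  have hc := hmem.mono fun ω => l1_le_of_l1_sub_le
  have hint := fun {t : ℝ} ht => hPG.integrable_info_entry hNG hlam hT hc (t := t) ht
  obtain ⟨hcont, C', hC', hstep⟩ := hPG.exists_mean_info_step hNG hlam hT (b := b) hc
  refine ⟨hint ht, ?_⟩
  refine m.info_comparison hlam hB hB0 h1.isCurve (by simp only [h2, hsym]) hb hcont
    (fun t ht => hPG.transpose_meanMat_info ht) hC' hstep hε ?_ t ht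
  simp only [h2]
  exact posSemidef_sub_meanMat (hint h0T) (hPG.transpose_meanMat_info h0T) hsym hmem

/-- The same cell argument, with the affine minorants of the correction in the role of the tangents
of the Riccati drift. The rate κ depends on ω₀ only through the bound b for the surrogate path. -/
theorem IsCovProcess.cov_le_surrogate [IsProbabilityMeasure μ] (hP : IsCovProcess m T ℱ μ N P)
    (hN : IsPoissonFamily T lam ℱ μ N) (hlam : IsSchedule T lam) (hT : 0 < T)
    {Phat : ℝ → Ω → Matrix (Fin n) (Fin n) ℝ}
    (hPh : ∀ᵐ ω ∂μ, IsSolution T (m.covField lam) fun t => Phat t ω)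
    (hP0 : ∀ᵐ ω ∂μ, Phat 0 ω = P 0 ω) {t : ℝ} (ht : t ∈ Set.Icc 0 T) :
    ∀ᵐ ω ∂μ, (Phat t ω - condMean μ (P t) (P 0) ω).PosSemidef := by
  have h0T : (0 : ℝ) ∈ Set.Icc 0 T := ⟨le_rfl, hT.le⟩
  have hσ : sigmaOf (P 0) ≤ ℱ 0 := sigmaOf_le (hP.adapted 0 h0T)
  obtain ⟨B, hB0, hB⟩ := hlam.exists_bound
  refine ae_posSemidef_sub_condMean (hσ.trans (ℱ.le 0))
    (hP.posDef.mono fun ω h => (h t ht).transpose_eq) ?_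
  filter_upwards [hPh, hP0, hP.posDef] with ω₀ h1 h2 h3
  obtain ⟨b, hb0, hb⟩ := exists_l1_bound h1.continuousOn
  obtain ⟨κ, hκ0, hκ⟩ := m.exists_cov_comparison (b := b) hlam hB hB0
  refine ⟨_, (Real.exp_pos (κ * (t - 0))).le, fun ε hε G hG hG0 hZ => ?_⟩
  have : IsProbabilityMeasure (μ[|G]) := cond_isProbabilityMeasure hG0
  have hPG := hP.cond G
  have hNG := hN.cond (hσ _ hG) hG0
  have hmem : ∀ᵐ ω ∂(μ[|G]), l1 (P 0 ω - P 0 ω₀) ≤ ε :=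
    (ae_cond_mem (ℱ.le 0 _ (hσ _ hG))).mono hZ
  have hc := hmem.mono fun ω => l1_le_of_l1_sub_le
  have hint := fun {t : ℝ} ht => hPG.integrable_entry hNG hc (t := t) ht
  obtain ⟨hcont, C', hC', hstep⟩ := hPG.exists_mean_step hNG hlam hc
  refine ⟨hint ht, ?_⟩
  refine hκ (fun t => Phat t ω₀) (fun t => meanMat (μ[|G]) (P t)) h1.isCurve
    (by simp only [h2]; exact (h3 0 h0T).posSemidef) hb hcont
    (fun t ht => hPG.transpose_meanMat ht) C' hC' hstep ε hε ?_ t ht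
  simp only [h2]
  exact posSemidef_sub_meanMat (hint h0T) (hPG.transpose_meanMat h0T) (h3 0 h0T).transpose_eq hmem

end CDKF
end

theorem mainTheorem1 {Ω : Type*} {mΩ : MeasurableSpace Ω} (μ : Measure Ω) [IsProbabilityMeasure μ]
    {n M : ℕ} (m : CDKF.Model n M) (T : ℝ) (hT : 0 < T)
    (lam : Fin M → ℝ → ℝ) (hlam : CDKF.IsSchedule T lam)
    (ℱ : Filtration ℝ mΩ) (N : Fin M → ℝ → Ω → ℕ) (hN : CDKF.IsPoissonFamily T lam ℱ μ N)
    (P : ℝ → Ω → Matrix (Fin n) (Fin n) ℝ) (hP : CDKF.IsCovProcess m T ℱ μ N P)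
    (hmom : CDKF.FiniteMoments T μ P)
    (Yhat Phat : ℝ → Ω → Matrix (Fin n) (Fin n) ℝ)
    (hYhat : ∀ᵐ ω ∂μ, CDKF.IsSolution T (m.infoField lam) (fun t => Yhat t ω))
    (hYhat0 : ∀ᵐ ω ∂μ, Yhat 0 ω = CDKF.info P 0 ω)
    (hPhat : ∀ᵐ ω ∂μ, CDKF.IsSolution T (m.covField lam) (fun t => Phat t ω))
    (hPhat0 : ∀ᵐ ω ∂μ, Phat 0 ω = P 0 ω) :
    ∀ t ∈ Set.Icc 0 T,
      (∀ᵐ ω ∂μ, (Yhat t ω - CDKF.condMean μ (CDKF.info P t) (CDKF.info P 0) ω).PosSemidef) ∧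
      (∀ᵐ ω ∂μ, (Phat t ω - CDKF.condMean μ (P t) (P 0) ω).PosSemidef) :=
  fun _ ht => ⟨hP.info_le_surrogate hN hlam hT hYhat hYhat0 ht,
    hP.cov_le_surrogate hN hlam hT hPhat hPhat0 ht⟩
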